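/- **Setting.** Let $\Gamma\subset G=\mathrm{PSL}_2(\mathbb R)$ be a torsion-free lattice (a discrete subgroup of finite covolume) with cusps, i.e. with parabolic fixed points in $\mathbb R\cup\{\infty\}$; for a cusp $\mathfrak a$ let $\Gamma_{\mathfrak a}$ be its stabilizer in $\Gamma$. Let $V$ be a finite-dimensional complex inner product space and $\chi:\Gamma\to\mathrm{GL}(V)$ a representation such that $\chi(\gamma)$ is unitary for every $\gamma$ in the stabilizer of a cusp. For a cusp $\mathfrak a$ let $P_{\mathfrak a}$ be the orthogonal projection of $V$ onto the space of $\chi(\Gamma_{\mathfrak a})$-fixed vectors, and let $\sigma_{\mathfrak a}\in G$ be a scaling matrix: $\sigma_{\mathfrak a}\infty=\mathfrak a$ and $\sigma_{\mathfrak a}^{-1}\Gamma_{\mathfrak a}\sigma_{\mathfrak a}=\pm\begin{pmatrix}1&\mathbb Z\\0&1\end{pmatrix}$. Write $e(x)=e^{2\pi i x}$, $\mu\begin{pmatrix}a&b\\c&d\end{pmatrix}=a^2+b^2+c^2+d^2$ and $u(z,w)=|z-w|^2/(\operatorname{Im}z\,\operatorname{Im}w)$. The Eisenstein series is $$E_{\mathfrak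 a}(z,s,\chi)=\sum_{\gamma\in\Gamma_{\mathfrak a}\backslash\Gamma}\operatorname{Im}(\sigma_{\mathfrak a}^{-1}\gamma z)^s\,\chi(\gamma^{-1})P_{\mathfrak a}.$$ Call $\sigma_0>1$ *admissible* if $\|\chi(\gamma)\|=O(\mu(\gamma)^{\sigma_0-1})$ and, for $z,w\in\mathbb H$, $\|\chi(\gamma)\|=O((u(z,\gamma w)+1)^{\sigma_0-1})$, where the first implied constant is independent of $\gamma\in\Gamma$ and the second one is independent of $\gamma$ and depends continuously on $z,w$. Let $\mathfrak a,\mathfrak b$ be cusps that are equal or $\Gamma$-inequivalent. Let $\delta_{\mathfrak a,\mathfrak b}$ be $1$ if $\mathfrak a=\mathfrak b$ and $0$ otherwise. For $c>0$, let $d$ mod $c$ run through a set of representatives modulo $c\mathbb Z$ of the reals for which some $\omega_{(c,d)}=\pm\begin{pmatrix}*&*\\c&d\end{pmatrix}$ lies in $\sigma_{\mathfrak a}^{-1}\Gamma\sigma_{\mathfrak b}$, fix one such $\omega_{(c,d)}$ for each representative $d$, and for $r\in\mathbb R$ put $$\mathcal S_{\mathfrak a,\mathfrak b}(r,c,\chi)=\sum_{d\,(c)}e\!\left(r\tfrac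 dc\right)\chi\big(\sigma_{\mathfrak b}\,\omega_{(c,d)}^{-1}\,\sigma_{\mathfrak a}^{-1}\big).$$ All choices of representatives are allowed. Sums over $c>0$ run over those $c$ for which some $\omega_{(c,d)}$ exists. Let $\varepsilon\in\{1,-1\}$ and let $\gamma_{\mathfrak b}=\sigma_{\mathfrak b}\begin{pmatrix}1&\varepsilon\\0&1\end{pmatrix}\sigma_{\mathfrak b}^{-1}$, which for $\varepsilon=\pm1$ are the two generators of $\Gamma_{\mathfrak b}$. Let $1=e(\nu_1),e(\nu_2),\dots,e(\nu_{k(\mathfrak b)})$ be the distinct eigenvalues of $\chi(\gamma_{\mathfrak b})$, with $\nu_j\in[0,1)$, $\nu_1=0$, where $e(\nu_1)=1$ is listed even if it is not an eigenvalue, and let $P_j$ be the orthogonal projection onto the $e(\nu_j)$-eigenspace (so $P_1=P_{\mathfrak b}$). Let $$K_s(y)=\tfrac12\int_0^\infty e^{-y(t+t^{-1})/2}t^s\frac{dt}t,\qquad W_s(z)=2|y|^{1/2}K_{s-\frac12}(2\pi|y|)\,e(x)\quad(z=x+iy,\ y\neq0).$$ **Theorem.** An admissible $\sigma_0>1$ exists.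 For every admissible $\sigma_0$ and every $s\in\mathbb C$ with $\operatorname{Re}(s)>\sigma_0$, each of the sums $\mathcal S_{\mathfrak a,\mathfrak b}(r,c,\chi)$ is finite, and the series $$\varphi_{\mathfrak a,\mathfrak b}(s)=\pi^{\frac12}\frac{\Gamma(s-\frac12)}{\Gamma(s)}\,P_{\mathfrak b}\sum_{c>0}c^{-2s}\,\mathcal S_{\mathfrak a,\mathfrak b}(0,c,\chi)\,P_{\mathfrak a},$$ $$\varphi_{\mathfrak a,\mathfrak b,j}(r,s)=\frac{\pi^s}{\Gamma(s)}|r|^{s-1}\,P_j\sum_{c>0}c^{-2s}\,\mathcal S_{\mathfrak a,\mathfrak b}(r,c,\chi)\,P_{\mathfrak a}$$ converge absolutely (the sums over $c$ for every $r\in\mathbb R$). For every $z=x+iy\in\mathbb H$, the Eisenstein series $E_{\mathfrak a}(\sigma_{\mathfrak b}z,s,\chi)$ converges absolutely and $$\begin{aligned}E_{\mathfrak a}(\sigma_{\mathfrak b}z,s,\chi)={}&\delta_{\mathfrak a,\mathfrak b}\,y^sP_{\mathfrak a}+\varphi_{\mathfrak a,\mathfrak b}(s)\,y^{1-s}+\sum_{k\neq0}\varphi_{\mathfrak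 a,\mathfrak b,1}(k,s)\,W_s(kz)\\&+\sum_{j=2}^{k(\mathfrak b)}\sum_{k\in\mathbb Z}\varphi_{\mathfrak a,\mathfrak b,j}(k+\varepsilon\nu_j,s)\,W_s\big((k+\varepsilon\nu_j)z\big),\end{aligned}$$ where the sums over $k$ converge absolutely. In particular, for $\varepsilon=-1$ the frequencies are $k-\nu_j$. -/

import Mathlib

open scoped MatrixGroups UpperHalfPlane InnerProductSpace

noncomputable section

namespace TwistedEisenstein

/-! ### The group `PSL(2, ℝ)` and its actions -/

/-- The action of `PSL(2, ℝ)` on the upper half-plane by linear fractional transformations. -/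
instance instActionUHP : MulAction PSL(2, ℝ) ℍ :=
  MulAction.compHom ℍ Matrix.ProjectiveSpecialLinearGroup.toPGL

lemma smul_mk_uhp (A : SL(2, ℝ)) (z : ℍ) : (A : PSL(2, ℝ)) • z = A • z := by
  change Matrix.ProjGenLinGroup.mk (Matrix.SpecialLinearGroup.toGL A) • z = A • z
  rw [UpperHalfPlane.pglMk_smul]
  rfl

lemma toGL_center_smul (A : SL(2, ℝ)) (hA : A ∈ Subgroup.center SL(2, ℝ)) (x : OnePoint ℝ) :
    Matrix.SpecialLinearGroup.toGL A • x = x := by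
  obtain ⟨r, hr, h⟩ := Matrix.SpecialLinearGroup.mem_center_iff.1 hA
  have hr0 : r ≠ 0 := by rintro rfl; simp at hr
  have h00 : A 0 0 = r := by rw [← h]; simp
  have h11 : A 1 1 = r := by rw [← h]; simp
  have h01 : A 0 1 = 0 := by rw [← h]; simp
  have h10 : A 1 0 = 0 := by rw [← h]; simp
  cases x with
  | infty => rw [OnePoint.smul_infty_eq_self_iff]; exact h10
  | coe x =>
    rw [OnePoint.smul_some_eq_ite]
    simp [h00, h11, h01, h10, hr0]

/-- The action of `PSL(2, ℝ)` on `ℝ ∪ {∞}` by linear fractional transformations. -/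
instance instActionBoundary : MulAction PSL(2, ℝ) (OnePoint ℝ) :=
  MulAction.compHom (OnePoint ℝ)
    (QuotientGroup.lift (Subgroup.center SL(2, ℝ))
      ((MulAction.toPermHom (GL (Fin 2) ℝ) (OnePoint ℝ)).comp Matrix.SpecialLinearGroup.toGL)
      (fun A hA => Equiv.ext fun x => toGL_center_smul A hA x))

lemma smul_mk_boundary (A : SL(2, ℝ)) (x : OnePoint ℝ) :
    (A : PSL(2, ℝ)) • x = Matrix.SpecialLinearGroup.toGL A • x := rfl

/-- The matrix `(1 x; 0 1)`. -/
def translSL (x : ℝ) : SL(2, ℝ) := ⟨!![1, x; 0, 1], by simp⟩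

/-- The class of the matrix `(1 x; 0 1)` in `PSL(2, ℝ)`. -/
def transl (x : ℝ) : PSL(2, ℝ) := (translSL x : PSL(2, ℝ))

lemma im_transl_smul (x : ℝ) (z : ℍ) : (transl x • z).im = z.im := by
  rw [transl, smul_mk_uhp, ← UpperHalfPlane.coe_im, UpperHalfPlane.coe_specialLinearGroup_apply]
  simp [translSL]

/-- `(c, d)` is the bottom row of one of the two matrices `±A` representing `g`. -/
def HasBottomRow (g : PSL(2, ℝ)) (c d : ℝ) : Prop :=
  ∃ A : SL(2, ℝ), (A : PSL(2, ℝ)) = g ∧ A 1 0 = c ∧ A 1 1 = d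

/-! ### Lattices and cusps -/

/-- A lattice in `PSL(2, ℝ)`: a discrete subgroup with a fundamental domain in the upper
half-plane of finite hyperbolic area (`volume` on `ℍ` is `dx dy / y ^ 2`). -/
structure IsLattice (Γ : Subgroup PSL(2, ℝ)) : Prop where
  discrete : DiscreteTopology Γ
  finite_covolume : ∃ F : Set ℍ, MeasureTheory.IsFundamentalDomain Γ F ∧
    MeasureTheory.volume F < ⊤

/-- Torsion-freeness: the only element of finite order is the identity. -/
def TorsionFree (Γ : Subgroup PSL(2, ℝ)) : Prop :=
  ∀ γ : Γ, IsOfFinOrder γ → γ = 1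

/-- A cusp of `Γ`: a fixed point in `ℝ ∪ {∞}` of a parabolic element of `Γ`, that is, a cusp
of the preimage of `Γ` in `SL(2, ℝ)`. -/
def IsCuspOf (Γ : Subgroup PSL(2, ℝ)) (x : OnePoint ℝ) : Prop :=
  IsCusp x ((Γ.comap (QuotientGroup.mk' (Subgroup.center SL(2, ℝ)))).map
    Matrix.SpecialLinearGroup.toGL)

/-- A cusp `pt` of `Γ` together with a scaling matrix `σ`, that is, `σ ∞ = pt` and
`σ⁻¹ Γ_pt σ` is the group of integral translations. -/
structure ScaledCusp (Γ : Subgroup PSL(2, ℝ)) where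
  pt : OnePoint ℝ
  isCusp : IsCuspOf Γ pt
  σ : PSL(2, ℝ)
  smul_infty : σ • (OnePoint.infty : OnePoint ℝ) = pt
  conj_stabilizer : ∀ g : PSL(2, ℝ),
    (σ * g * σ⁻¹ ∈ Γ ∧ (σ * g * σ⁻¹) • pt = pt) ↔ ∃ k : ℤ, g = transl k

variable {Γ : Subgroup PSL(2, ℝ)}

/-- The stabilizer `Γ_𝔞` of the cusp in `Γ`. -/
def ScaledCusp.stab (a : ScaledCusp Γ) : Subgroup Γ := MulAction.stabilizer Γ a.pt

/-- The generator `σ (1 1; 0 1) σ⁻¹` of the stabilizer of the cusp. -/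
def ScaledCusp.gen (a : ScaledCusp Γ) : Γ :=
  ⟨a.σ * transl 1 * a.σ⁻¹, ((a.conj_stabilizer (transl 1)).2 ⟨1, by simp⟩).1⟩

open Classical in
/-- Kronecker's delta for cusps. -/
def cuspDelta (a b : ScaledCusp Γ) : ℂ := if a.pt = b.pt then 1 else 0

/-! ### Representations -/

/-- `e(x) = exp(2 π i x)`. -/
def e (x : ℝ) : ℂ := Complex.exp (2 * Real.pi * Complex.I * x)

section Representation

variable {V : Type*} [NormedAddCommGroup V] [InnerProductSpace ℂ V]

/-- `χ` is unitary at the cusps: `χ γ` (which is invertible as `Γ` is a group) is unitary whenever `γ` fixes a cusp of `Γ`. -/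
def UnitaryAtCusps (χ : Γ →* (V →L[ℂ] V)) : Prop :=
  ∀ x : OnePoint ℝ, IsCuspOf Γ x → ∀ γ : Γ, γ • x = x →
    ∀ v w : V, ⟪χ γ v, χ γ w⟫_ℂ = ⟪v, w⟫_ℂ

/-- `u(z, w) = |z - w| ^ 2 / (Im z * Im w)`. -/
def uDist (z w : ℍ) : ℝ := ‖(z : ℂ) - (w : ℂ)‖ ^ 2 / (z.im * w.im)

/-- `σ₀ > 1` is such that `‖χ γ‖ = O(μ(γ) ^ (σ₀ - 1))`, where `μ(γ)` is the sum of the squares of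
the matrix entries, and `‖χ γ‖ = O((u(z, γ w) + 1) ^ (σ₀ - 1))` with an implied constant
depending continuously on `z` and `w`. -/
structure IsGrowthExponent (χ : Γ →* (V →L[ℂ] V)) (σ₀ : ℝ) : Prop where
  one_lt : 1 < σ₀
  bound_mu : ∃ C : ℝ, 0 < C ∧ ∀ (A : SL(2, ℝ)) (hA : (A : PSL(2, ℝ)) ∈ Γ),
    ‖χ ⟨(A : PSL(2, ℝ)), hA⟩‖ ≤
      C * (A 0 0 ^ 2 + A 0 1 ^ 2 + A 1 0 ^ 2 + A 1 1 ^ 2) ^ (σ₀ - 1)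
  bound_u : ∃ C : ℍ × ℍ → ℝ, Continuous C ∧ (∀ p, 0 < C p) ∧ ∀ (γ : Γ) (z w : ℍ),
    ‖χ γ‖ ≤ C (z, w) * (uDist z (γ • w) + 1) ^ (σ₀ - 1)

/-- The space of vectors fixed by the stabilizer of the cusp. -/
def fixedSpace (χ : Γ →* (V →L[ℂ] V)) (a : ScaledCusp Γ) : Submodule ℂ V where
  carrier := {v | ∀ γ ∈ a.stab, χ γ v = v}
  add_mem' := fun hv hw γ hγ => by rw [map_add, hv γ hγ, hw γ hγ]
  zero_mem' := fun γ _ => map_zero _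
  smul_mem' := fun c v hv γ hγ => by rw [map_smul, hv γ hγ]

variable [FiniteDimensional ℂ V]

/-- The orthogonal projection `P_𝔞` onto the space of vectors fixed by `Γ_𝔞`. -/
def cuspProj (χ : Γ →* (V →L[ℂ] V)) (a : ScaledCusp Γ) : V →L[ℂ] V :=
  (fixedSpace χ a).starProjection

/-- The orthogonal projection onto the eigenspace of `T` for the eigenvalue `e(x)`
(zero if `e(x)` is not an eigenvalue). -/
def eigenProj (T : V →L[ℂ] V) (x : ℝ) : V →L[ℂ] V :=
  (Module.End.eigenspace (T : V →ₗ[ℂ] V) (e x)).starProjection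

/-- `ν 0, …, ν m` are pairwise distinct elements of `[0, 1)` with `ν 0 = 0` such that the
eigenvalues of `T` of the form `e(x)` are the `e(ν j)`, except that `e(ν 0) = 1` is listed even if
it is not an eigenvalue. -/
structure IsPhaseList (T : V →L[ℂ] V) {m : ℕ} (ν : Fin (m + 1) → ℝ) : Prop where
  injective : Function.Injective ν
  zero : ν 0 = 0
  mem_Ico : ∀ j, ν j ∈ Set.Ico (0 : ℝ) 1
  hasEigenvalue : ∀ j, j ≠ 0 → Module.End.HasEigenvalue (T : V →ₗ[ℂ] V) (e (ν j))
  complete : ∀ x ∈ Set.Ico (0 : ℝ) 1,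
    Module.End.HasEigenvalue (T : V →ₗ[ℂ] V) (e x) → ∃ j, ν j = x

/-! ### The Eisenstein series -/

lemma map_comp_cuspProj (χ : Γ →* (V →L[ℂ] V)) (a : ScaledCusp Γ) {γ : Γ} (hγ : γ ∈ a.stab) :
    χ γ * cuspProj χ a = cuspProj χ a := by
  ext v
  exact (fixedSpace χ a).starProjection_apply_mem v γ hγ

/-- The term `Im(σ_𝔞⁻¹ γ z) ^ s χ(γ⁻¹) P_𝔞` of the Eisenstein series. -/
def eisTerm (χ : Γ →* (V →L[ℂ] V)) (a : ScaledCusp Γ) (s : ℂ) (z : ℍ) (γ : Γ) : V →L[ℂ] V :=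
  (((a.σ⁻¹ • γ • z).im : ℂ) ^ s) • (χ γ⁻¹ * cuspProj χ a)

lemma eisTerm_mul (χ : Γ →* (V →L[ℂ] V)) (a : ScaledCusp Γ) (s : ℂ) (z : ℍ) (γ : Γ) {τ : Γ}
    (hτ : τ ∈ a.stab) : eisTerm χ a s z (τ * γ) = eisTerm χ a s z γ := by
  obtain ⟨k, hk⟩ := (a.conj_stabilizer (a.σ⁻¹ * (τ : PSL(2, ℝ)) * a.σ)).1 (by
    have h : a.σ * (a.σ⁻¹ * (τ : PSL(2, ℝ)) * a.σ) * a.σ⁻¹ = τ := by group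
    rw [h]
    exact ⟨τ.2, hτ⟩)
  have h1 : a.σ⁻¹ • (τ * γ) • z = transl k • a.σ⁻¹ • γ • z := by
    rw [← hk, mul_smul τ γ z, ← mul_smul _ a.σ⁻¹]
    simp only [Subgroup.smul_def, ← mul_smul]
    group
  have h2 : χ (τ * γ)⁻¹ * cuspProj χ a = χ γ⁻¹ * cuspProj χ a := by
    rw [mul_inv_rev, map_mul, mul_assoc, map_comp_cuspProj χ a (a.stab.inv_mem hτ)]
  rw [eisTerm, eisTerm, h1, h2, im_transl_smul]

/-- The term of the Eisenstein series as a function on `Γ_𝔞 \ Γ`. -/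
def eisSummand (χ : Γ →* (V →L[ℂ] V)) (a : ScaledCusp Γ) (s : ℂ) (z : ℍ) :
    Quotient (QuotientGroup.rightRel a.stab) → (V →L[ℂ] V) :=
  Quotient.lift (eisTerm χ a s z) (fun γ δ h => by
    have h' := QuotientGroup.rightRel_apply.1 h
    have := eisTerm_mul χ a s z γ h'
    rw [inv_mul_cancel_right] at this
    exact this.symm)

/-- The Eisenstein series `E_𝔞(z, s, χ)`, with values in `End V`. -/
def eisenstein (χ : Γ →* (V →L[ℂ] V)) (a : ScaledCusp Γ) (z : ℍ) (s : ℂ) : V →L[ℂ] V :=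
  ∑' q, eisSummand χ a s z q

/-! ### Kloosterman sums and Fourier coefficients -/

/-- The set of all `c > 0` that occur as lower left entries of elements of `σ_𝔞⁻¹ Γ σ_𝔟`. -/
def moduli (a b : ScaledCusp Γ) : Set ℝ :=
  {c | 0 < c ∧ ∃ (γ : Γ) (d : ℝ), HasBottomRow (a.σ⁻¹ * γ * b.σ) c d}

/-- A choice of representatives: for every `c > 0`, a set `D c` of representatives modulo `c` of
all those `d` for which `(c, d)` is the bottom row of an element of `σ_𝔞⁻¹ Γ σ_𝔟`, and for
each `d ∈ D c` an element `γ c d` of `Γ` such that `ω = σ_𝔞⁻¹ (γ c d) σ_𝔟` has bottom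
row `(c, d)`. -/
structure DoubleCosetReps (a b : ScaledCusp Γ) where
  D : ℝ → Set ℝ
  γ : ℝ → ℝ → Γ
  bottomRow : ∀ c, 0 < c → ∀ d ∈ D c, HasBottomRow (a.σ⁻¹ * γ c d * b.σ) c d
  existsUnique : ∀ c, 0 < c → ∀ (d : ℝ) (δ : Γ), HasBottomRow (a.σ⁻¹ * δ * b.σ) c d →
    ∃! d', d' ∈ D c ∧ ∃ k : ℤ, d = d' + k * c

variable {a b : ScaledCusp Γ}

/-- The Kloosterman sum `𝓢(r, c, χ) = ∑ e(r d / c) χ(σ_𝔟 ω⁻¹ σ_𝔞⁻¹)` over `d` modulo `c`. -/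
def kloosterman (χ : Γ →* (V →L[ℂ] V)) (R : DoubleCosetReps a b) (r c : ℝ) : V →L[ℂ] V :=
  ∑ᶠ d ∈ R.D c, e (r * d / c) • χ (R.γ c d)⁻¹

/-- The term `c ^ (-2 s) 𝓢(r, c, χ)`. -/
def kloostermanTerm (χ : Γ →* (V →L[ℂ] V)) (R : DoubleCosetReps a b) (r : ℝ) (s : ℂ)
    (c : moduli a b) : V →L[ℂ] V :=
  (((c : ℝ) : ℂ) ^ (-2 * s)) • kloosterman χ R r c

/-- The coefficient `φ(s)` of `y ^ (1 - s)`. -/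
def constCoeff (χ : Γ →* (V →L[ℂ] V)) (R : DoubleCosetReps a b) (s : ℂ) : V →L[ℂ] V :=
  ((Real.pi : ℂ) ^ (1 / 2 : ℂ) * Complex.Gamma (s - 1 / 2) / Complex.Gamma s) •
    (cuspProj χ b * (∑' c, kloostermanTerm χ R 0 s c) * cuspProj χ a)

/-- The coefficient `φ(r, s)` for `r ≠ 0`, where `P` is the projection to an eigenspace. -/
def fourierCoeff (χ : Γ →* (V →L[ℂ] V)) (R : DoubleCosetReps a b) (P : V →L[ℂ] V)
    (r : ℝ) (s : ℂ) : V →L[ℂ] V :=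
  ((Real.pi : ℂ) ^ s / Complex.Gamma s * ((|r| : ℝ) : ℂ) ^ (s - 1)) •
    (P * (∑' c, kloostermanTerm χ R r s c) * cuspProj χ a)

end Representation

/-! ### The Whittaker function -/

/-- The `K`-Bessel function `K_s(y) = (1 / 2) ∫_0^∞ exp(-y (t + 1 / t) / 2) t ^ s dt / t`. -/
def besselK (s : ℂ) (y : ℝ) : ℂ :=
  (1 / 2 : ℂ) * ∫ t in Set.Ioi (0 : ℝ), (Real.exp (-y * (t + t⁻¹) / 2) : ℂ) * (t : ℂ) ^ s / t

/-- The Whittaker function `W_s(z) = 2 |y| ^ (1 / 2) K_{s - 1 / 2}(2 π |y|) e(x)`, for `z = x + i y`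
with `y ≠ 0` in the upper or in the lower half-plane. -/
def whittaker (s z : ℂ) : ℂ :=
  2 * (Real.sqrt |z.im| : ℂ) * besselK (s - 1 / 2) (2 * Real.pi * |z.im|) * e z.re

end TwistedEisenstein

end

open scoped MatrixGroups UpperHalfPlane InnerProductSpace
noncomputable section
namespace TwistedEisenstein

section

/-! ### Displacement functions -/

/-! The proof has three parts: polynomial growth of `χ`, absolute convergence, and Poisson summation
at the cusp.

Growth (`exists_isGrowthExponent`). A torsion-free lattice has a thick-thin decomposition: up to the
group, every point lies in a compact set or is moved very little by one of finitely many parabolic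
elements (`exists_thick_thin`). It comes from a Margulis lemma, proved by showing that commutators
of small matrices are quadratically small, and from a volume packing argument. If two points of the
resulting set `F` become close under `γ`, then `γ` (or its inverse) is in a finite set or conjugates
one of finitely many parabolics into a finite set. Such conjugators fill finitely many cosets of
centralizers of parabolics, and `χ` is unitary on these centralizers, so `χ γ` is bounded
(`exists_local_bound`). Moving each point into `F` gives a submultiplicative cocycle that is bounded
on short steps. Along a path that climbs to a high horocycle, crosses it in one step and descends,
it is at most a power of `cosh` of the distance (`chain_bound`).

Convergence. The lower left entry of `g' * g⁻¹` is the 2 by 2 minor of the two bottom rows, and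
nonzero lower left entries are bounded away from zero. So the fractions `d / c` modulo 1 are
separated by a multiple of `1 / (c c')`, there are `O(X ^ 2)` of them with `c ≤ X`, and `∑ c ^ (-2
τ)` converges for `τ > 1`. Translations at both cusps have norm at most one under `χ`, so
representatives with all entries `O(c)` suffice to get `‖χ γ⁻¹‖ = O(c ^ (2 (σ₀ - 1)))`
(`exists_norm_inv_le`).

Expansion. The cosets are the bottom rows `(c, d + k c)`, plus the trivial coset when the cusps
coincide. On the `e(ν j)`-eigenspace the `k`-th translation acts by the phase `e(-ε ν j k)`, so the
sum over `k` is a twisted Poisson sum with frequencies `n + ε ν j` (`tsum_powerKernel_smul`). The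
Fourier transform of `(t ^ 2 + y ^ 2) ^ (-s)` is a `K`-Bessel function, or a quotient of Gamma
values at frequency zero. -/

/-- `2 * cosh d(z, A z) - 2` for the hyperbolic distance `d`. -/
def displ (A : SL(2, ℝ)) (z : ℍ) : ℝ :=
  ((A 1 0 * (z.re ^ 2 + z.im ^ 2) + (A 1 1 - A 0 0) * z.re - A 0 1) / z.im) ^ 2
    + (A 0 0 + A 1 1) ^ 2 - 4

lemma det_eq_one' (A : SL(2, ℝ)) : A 0 0 * A 1 1 - A 0 1 * A 1 0 = 1 := by
  have := A.det_coe
  rwa [Matrix.det_fin_two] at this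

lemma uDist_eq (z w : ℍ) : uDist z w = 2 * Real.cosh (dist z w) - 2 := by
  rw [UpperHalfPlane.cosh_dist, uDist, Complex.dist_eq]
  have := z.im_pos
  have := w.im_pos
  field_simp
  ring

lemma uDist_nonneg (z w : ℍ) : 0 ≤ uDist z w := by
  rw [uDist_eq]; linarith [Real.one_le_cosh (dist z w)]

lemma normSq_denom_pos' (A : SL(2, ℝ)) (z : ℍ) :
    0 < (A 1 0 * z.re + A 1 1) ^ 2 + (A 1 0 * z.im) ^ 2 := by
  have := det_eq_one' A
  have := z.im_pos
  by_cases h : A 1 0 = 0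
  · have : A 1 1 ≠ 0 := by rintro h'; simp [h, h'] at *
    rw [h]
    have : 0 < (A 1 1) ^ 2 := by positivity
    simpa
  · have : A 1 0 * z.im ≠ 0 := by positivity
    positivity

lemma im_smul_SL (A : SL(2, ℝ)) (z : ℍ) :
    (A • z).im = z.im / ((A 1 0 * z.re + A 1 1) ^ 2 + (A 1 0 * z.im) ^ 2) := by
  have h : (A • z).im = z.im / Complex.normSq (UpperHalfPlane.denom A z) := by
    change (Matrix.SpecialLinearGroup.toGL A • z).im = _
    rw [UpperHalfPlane.im_smul_eq_div_normSq]
    simp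
  rw [h]
  congr 1
  simp [UpperHalfPlane.denom, Complex.normSq_apply]
  ring

/-- `z - A z` is the fixed-point quadratic of `A` at `z` divided by the denominator of `A`. By `det
= 1` the squared modulus of that quadratic is `z.im ^ 2 * displ A z`. -/
lemma two_mul_cosh_dist_smul (A : SL(2, ℝ)) (z : ℍ) :
    2 * Real.cosh (dist z (A • z)) = displ A z + 2 := by
  have h1 : 2 * Real.cosh (dist z (A • z)) = uDist z (A • z) + 2 := by rw [uDist_eq]; ring
  rw [h1, uDist, im_smul_SL]
  have hpos := normSq_denom_pos' A z
  have hy := z.im_pos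
  have hdet := det_eq_one' A
  have hne : ((A 1 0 : ℂ) * z + A 1 1) ≠ 0 := by
    intro h
    have h1 := congrArg Complex.re h
    have h2 := congrArg Complex.im h
    simp at h1 h2
    rcases h2 with h2 | h2
    · simp [h2] at h1; simp [h1, h2] at hpos
    · exact absurd h2 hy.ne'
  have e1 : (z : ℂ) - ((A • z : ℍ) : ℂ) =
      ((A 1 0 : ℂ) * z ^ 2 + (A 1 1 - A 0 0) * z - A 0 1) / ((A 1 0 : ℂ) * z + A 1 1) := by
    have h2 : ((A • z : ℍ) : ℂ) = ((A 0 0 : ℂ) * z + A 0 1) / ((A 1 0 : ℂ) * z + A 1 1) :=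
      UpperHalfPlane.coe_specialLinearGroup_apply A z
    rw [h2, eq_div_iff hne, sub_mul, div_mul_cancel₀ _ hne]
    ring
  have e2 : ‖((A 1 0 : ℂ) * z + A 1 1)‖ ^ 2 = (A 1 0 * z.re + A 1 1) ^ 2 + (A 1 0 * z.im) ^ 2 := by
    rw [← Complex.normSq_eq_norm_sq, Complex.normSq_apply]; simp; ring
  have e3 : ‖((A 1 0 : ℂ) * z ^ 2 + (A 1 1 - A 0 0) * z - A 0 1)‖ ^ 2 =
      z.im ^ 2 * displ A z := by
    rw [← Complex.normSq_eq_norm_sq, Complex.normSq_apply, displ]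
    simp [pow_two]
    field_simp
    linear_combination (-4 * z.im ^ 2) * hdet
  rw [e1, norm_div, div_pow, e2, e3]
  have := hpos.ne'
  rw [show z.im ^ 2 * displ A z / ((A 1 0 * z.re + A 1 1) ^ 2 + (A 1 0 * z.im) ^ 2) /
    (z.im * (z.im / ((A 1 0 * z.re + A 1 1) ^ 2 + (A 1 0 * z.im) ^ 2))) = displ A z from ?_]
  generalize ((A 1 0 * z.re + A 1 1) ^ 2 + (A 1 0 * z.im) ^ 2) = D at *
  field_simp

lemma displ_eq_uDist (A : SL(2, ℝ)) (z : ℍ) : displ A z = uDist z (A • z) := by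
  rw [uDist_eq, two_mul_cosh_dist_smul]; ring

lemma displ_nonneg (A : SL(2, ℝ)) (z : ℍ) : 0 ≤ displ A z := by
  rw [displ_eq_uDist]; exact uDist_nonneg _ _

/-- `2 cosh r - 2`. -/
def chord (r : ℝ) : ℝ := 2 * Real.cosh r - 2

lemma displ_eq_chord (A : SL(2, ℝ)) (z : ℍ) : displ A z = chord (dist z (A • z)) := by
  rw [displ_eq_uDist, uDist_eq, chord]

lemma chord_le_chord {r s : ℝ} (hr : 0 ≤ r) (hs : 0 ≤ s) : chord r ≤ chord s ↔ r ≤ s := by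
  rw [chord, chord]
  have := Real.cosh_le_cosh (x := r) (y := s)
  rw [abs_of_nonneg hr, abs_of_nonneg hs] at this
  rw [← this]; constructor <;> intro <;> linarith

lemma displ_conj (g A : SL(2, ℝ)) (z : ℍ) : displ (g * A * g⁻¹) (g • z) = displ A z := by
  rw [displ_eq_chord, displ_eq_chord]
  simp [mul_smul]

lemma displ_neg (A : SL(2, ℝ)) (z : ℍ) : displ (-A) z = displ A z := by
  simp [displ]; ring

/-! ### Matrix norms and commutators of small elements. -/

/-- Sum of the squares of the entries. -/
def msq (M : Matrix (Fin 2) (Fin 2) ℝ) : ℝ := M 0 0 ^ 2 + M 0 1 ^ 2 + M 1 0 ^ 2 + M 1 1 ^ 2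

lemma msq_nonneg (M : Matrix (Fin 2) (Fin 2) ℝ) : 0 ≤ msq M := by unfold msq; positivity

lemma msq_mul_le (M N : Matrix (Fin 2) (Fin 2) ℝ) : msq (M * N) ≤ msq M * msq N := by
  have cs (a b c d : ℝ) : (a * c + b * d) ^ 2 ≤ (a ^ 2 + b ^ 2) * (c ^ 2 + d ^ 2) := by
    nlinarith [sq_nonneg (a * d - b * c)]
  simp only [msq, Matrix.mul_apply, Fin.sum_univ_two]
  have h1 := cs (M 0 0) (M 0 1) (N 0 0) (N 1 0)
  have h2 := cs (M 0 0) (M 0 1) (N 0 1) (N 1 1)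
  have h3 := cs (M 1 0) (M 1 1) (N 0 0) (N 1 0)
  have h4 := cs (M 1 0) (M 1 1) (N 0 1) (N 1 1)
  nlinarith

lemma msq_sub_le (M N : Matrix (Fin 2) (Fin 2) ℝ) : msq (M - N) ≤ 2 * msq M + 2 * msq N := by
  have h (a b : ℝ) : (a - b) ^ 2 ≤ 2 * a ^ 2 + 2 * b ^ 2 := by nlinarith [sq_nonneg (a + b)]
  simp only [msq, Matrix.sub_apply]
  linarith [h (M 0 0) (N 0 0), h (M 0 1) (N 0 1), h (M 1 0) (N 1 0), h (M 1 1) (N 1 1)]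

lemma msq_inv (A : SL(2, ℝ)) : msq (A⁻¹ : SL(2, ℝ)) = msq A := by
  simp [msq, Matrix.SpecialLinearGroup.coe_inv, Matrix.adjugate_fin_two]; ring

lemma displ_I (A : SL(2, ℝ)) : displ A UpperHalfPlane.I = msq A - 2 := by
  have := det_eq_one' A
  simp [displ, msq]
  linear_combination 2 * this

lemma msq_eq_cosh (A : SL(2, ℝ)) :
    msq A = 2 * Real.cosh (dist UpperHalfPlane.I (A • UpperHalfPlane.I)) := by
  rw [two_mul_cosh_dist_smul, displ_I]; ring

/-- For trace at least 2 this bounds the distance of `A` from the identity matrix by its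
displacement. -/
lemma msq_sub_one (A : SL(2, ℝ)) :
    msq ((A : Matrix (Fin 2) (Fin 2) ℝ) - 1) = displ A UpperHalfPlane.I - 2 * (A 0 0 + A 1 1 - 2) := by
  rw [displ_I]
  simp [msq]
  ring

/-- With `X = A - 1` and `Y = B - 1`, the commutator minus 1 is `(X Y - Y X) A⁻¹ B⁻¹`, hence
quadratically small when `A` and `B` are close to 1. -/
lemma displ_commutator_le {A B : SL(2, ℝ)} (hA : 2 ≤ A 0 0 + A 1 1) (hB : 2 ≤ B 0 0 + B 1 1) :
    displ (A * B * A⁻¹ * B⁻¹) UpperHalfPlane.I ≤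
      8 * displ A UpperHalfPlane.I * displ B UpperHalfPlane.I *
        ((displ A UpperHalfPlane.I + 2) * (displ B UpperHalfPlane.I + 2)) ∧
    msq (((A * B * A⁻¹ * B⁻¹ : SL(2, ℝ)) : Matrix (Fin 2) (Fin 2) ℝ) - 1) ≤
      4 * displ A UpperHalfPlane.I * displ B UpperHalfPlane.I *
        ((displ A UpperHalfPlane.I + 2) * (displ B UpperHalfPlane.I + 2)) := by
  set C := A * B * A⁻¹ * B⁻¹ with hC
  set X : Matrix (Fin 2) (Fin 2) ℝ := A - 1 with hX
  set Y : Matrix (Fin 2) (Fin 2) ℝ := B - 1 with hY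
  have hXle : msq X ≤ displ A UpperHalfPlane.I := by rw [hX, msq_sub_one]; linarith
  have hYle : msq Y ≤ displ B UpperHalfPlane.I := by rw [hY, msq_sub_one]; linarith
  have hCe : (C : Matrix (Fin 2) (Fin 2) ℝ) - 1 =
      (X * Y - Y * X) * ((A⁻¹ : SL(2, ℝ)) * (B⁻¹ : SL(2, ℝ)) : Matrix (Fin 2) (Fin 2) ℝ) := by
    have h1 : X * Y - Y * X = ((A * B : SL(2, ℝ)) : Matrix (Fin 2) (Fin 2) ℝ)
        - (B * A : SL(2, ℝ)) := by
      rw [hX, hY, Matrix.SpecialLinearGroup.coe_mul, Matrix.SpecialLinearGroup.coe_mul]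
      noncomm_ring
    rw [h1, sub_mul, ← Matrix.SpecialLinearGroup.coe_mul, ← Matrix.SpecialLinearGroup.coe_mul,
      ← Matrix.SpecialLinearGroup.coe_mul, hC]
    have h2 : B * A * (A⁻¹ * B⁻¹) = 1 := by group
    rw [h2, mul_assoc (A * B)]
    simp
  have h0 : 0 ≤ displ A UpperHalfPlane.I := displ_nonneg _ _
  have h0' : 0 ≤ displ B UpperHalfPlane.I := displ_nonneg _ _
  have hE : msq (X * Y - Y * X) ≤ 4 * (displ A UpperHalfPlane.I * displ B UpperHalfPlane.I) := by
    have h1 := msq_sub_le (X * Y) (Y * X)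
    have h2 := msq_mul_le X Y
    have h3 := msq_mul_le Y X
    have h4 : msq X * msq Y ≤ displ A UpperHalfPlane.I * displ B UpperHalfPlane.I :=
      mul_le_mul hXle hYle (msq_nonneg _) h0
    nlinarith
  have hCle : msq ((C : Matrix (Fin 2) (Fin 2) ℝ) - 1) ≤
      4 * displ A UpperHalfPlane.I * displ B UpperHalfPlane.I *
        ((displ A UpperHalfPlane.I + 2) * (displ B UpperHalfPlane.I + 2)) := by
    rw [hCe]
    refine (msq_mul_le _ _).trans ?_
    have h1 := msq_mul_le (A⁻¹ : SL(2, ℝ)) (B⁻¹ : SL(2, ℝ))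
    rw [msq_inv, msq_inv] at h1
    have h2 : msq A = displ A UpperHalfPlane.I + 2 := by rw [displ_I]; ring
    have h3 : msq B = displ B UpperHalfPlane.I + 2 := by rw [displ_I]; ring
    rw [h2, h3] at h1
    rw [mul_assoc 4]
    exact mul_le_mul hE h1 (msq_nonneg _) (by positivity)
  refine ⟨?_, hCle⟩
  have h5 : displ C UpperHalfPlane.I =
      msq ((C : Matrix (Fin 2) (Fin 2) ℝ) - 1) + 2 * (C 0 0 + C 1 1 - 2) := by
    rw [msq_sub_one]; ring
  -- By `det = 1` the difference of the two sides is `(tr C - 2) ^ 2 + (C 0 1 - C 1 0) ^ 2`. Hence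
  -- the displacement is at most twice `msq (C - 1)`, which turns the constant 4 into 8.
  have h6 : 2 * (C 0 0 + C 1 1 - 2) ≤ msq ((C : Matrix (Fin 2) (Fin 2) ℝ) - 1) := by
    have hdet := det_eq_one' C
    simp only [msq, Matrix.sub_apply, Matrix.one_apply]
    simp
    nlinarith [sq_nonneg (C 0 0 + C 1 1 - 2), sq_nonneg (C 0 1 - C 1 0)]
  linarith

/-! ### Centralizers of nonscalar matrices. -/

/-- `A` is not `1` or `-1`. -/
def NonScalar (A : SL(2, ℝ)) : Prop := ¬(A 0 1 = 0 ∧ A 1 0 = 0 ∧ A 1 1 = A 0 0)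

lemma not_nonScalar_iff {A : SL(2, ℝ)} : ¬NonScalar A ↔ A = 1 ∨ A = -1 := by
  rw [NonScalar, not_not]
  constructor
  · rintro ⟨h1, h2, h3⟩
    have hdet := det_eq_one' A
    rw [h1, h3] at hdet
    have : (A 0 0 - 1) * (A 0 0 + 1) = 0 := by linear_combination hdet
    rcases mul_eq_zero.1 this with h | h
    · left; ext i j; fin_cases i <;> fin_cases j <;> simp [h1, h2, h3] <;> linarith
    · right; ext i j; fin_cases i <;> fin_cases j <;> simp [h1, h2, h3] <;> linarith
  · rintro (rfl | rfl) <;> simp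

lemma mk_eq_mk_iff {A B : SL(2, ℝ)} : (A : PSL(2, ℝ)) = B ↔ B = A ∨ B = -A := by
  rw [QuotientGroup.eq]
  have key : ∀ C : SL(2, ℝ), C ∈ Subgroup.center SL(2, ℝ) ↔ C = 1 ∨ C = -1 := by
    intro C
    rw [Matrix.SpecialLinearGroup.mem_center_iff]
    constructor
    · rintro ⟨r, hr, h⟩
      rw [← not_nonScalar_iff, NonScalar, not_not, ← h]
      simp
    · rintro (rfl | rfl)
      · exact ⟨1, by simp, by simp⟩
      · exact ⟨-1, by simp, by simp [← Matrix.diagonal_neg]⟩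
  rw [key, inv_mul_eq_iff_eq_mul, inv_mul_eq_iff_eq_mul]
  simp

lemma mk_eq_one_iff {A : SL(2, ℝ)} : (A : PSL(2, ℝ)) = 1 ↔ ¬NonScalar A := by
  rw [not_nonScalar_iff, eq_comm, ← QuotientGroup.mk_one, mk_eq_mk_iff]

lemma nonScalar_conj {g A : SL(2, ℝ)} : NonScalar (g * A * g⁻¹) ↔ NonScalar A := by
  rw [← not_iff_not, ← mk_eq_one_iff, ← mk_eq_one_iff]
  have h : ((g * A * g⁻¹ : SL(2, ℝ)) : PSL(2, ℝ)) = (g : PSL(2, ℝ)) * A * (g : PSL(2, ℝ))⁻¹ := rfl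
  rw [h]
  exact conj_eq_one_iff

lemma NonScalar.neg {A : SL(2, ℝ)} (h : NonScalar A) : NonScalar (-A) := by
  intro h'; apply h; simpa using h'

/-- Proportionality of the trace-free parts: `B - tr B / 2 = β (A - tr A / 2)`. -/
def PropTo (A B : SL(2, ℝ)) (β : ℝ) : Prop :=
  B 0 1 = β * A 0 1 ∧ B 1 0 = β * A 1 0 ∧ B 1 1 - B 0 0 = β * (A 1 1 - A 0 0)

/-- The centralizer of a nonscalar 2 by 2 matrix is spanned by 1 and the matrix itself. The factor
`β` is read off at a nonzero coordinate of the trace-free part of `A`. -/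
lemma exists_propTo {A B : SL(2, ℝ)} (hA : NonScalar A) (h : A * B = B * A) :
    ∃ β, PropTo A B β := by
  have h' : (A : Matrix (Fin 2) (Fin 2) ℝ) * B = B * A := by
    rw [← Matrix.SpecialLinearGroup.coe_mul, h, Matrix.SpecialLinearGroup.coe_mul]
  have h00 := congrFun (congrFun h' 0) 0
  have h01 := congrFun (congrFun h' 0) 1
  have h10 := congrFun (congrFun h' 1) 0
  simp only [Matrix.mul_apply, Fin.sum_univ_two] at h00 h01 h10
  unfold PropTo
  by_cases hb : A 0 1 = 0
  · by_cases hc : A 1 0 = 0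
    · have hd : A 1 1 - A 0 0 ≠ 0 := fun h0 => hA ⟨hb, hc, by linarith⟩
      refine ⟨(B 1 1 - B 0 0) / (A 1 1 - A 0 0), ?_, ?_, by field_simp⟩
      · rw [hb] at h01 ⊢
        have : B 0 1 * (A 1 1 - A 0 0) = 0 := by linear_combination -h01
        simpa [hd] using this
      · rw [hc] at h10 ⊢
        have : B 1 0 * (A 1 1 - A 0 0) = 0 := by linear_combination h10
        simpa [hd] using this
    · refine ⟨B 1 0 / A 1 0, ?_, by field_simp, ?_⟩ <;> field_simp
      · linear_combination -h00
      · linear_combination -h10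
  · refine ⟨B 0 1 / A 0 1, by field_simp, ?_, ?_⟩ <;> field_simp
    · linear_combination h00
    · linear_combination h01

lemma PropTo.commute {A B C : SL(2, ℝ)} {β γ : ℝ} (hB : PropTo A B β) (hC : PropTo A C γ) :
    B * C = C * B := by
  obtain ⟨b1, b2, b3⟩ := hB
  obtain ⟨c1, c2, c3⟩ := hC
  ext i j
  fin_cases i <;> fin_cases j <;>
    simp [Matrix.mul_apply, Fin.sum_univ_two, b1, b2, c1, c2]
  · ring
  · linear_combination γ * A 0 1 * (-b3) + β * A 0 1 * c3
  · linear_combination γ * A 1 0 * b3 - β * A 1 0 * c3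
  · ring

lemma commute_trans {A B C : SL(2, ℝ)} (hA : NonScalar A) (hB : A * B = B * A)
    (hC : A * C = C * A) : B * C = C * B := by
  obtain ⟨β, hβ⟩ := exists_propTo hA hB
  obtain ⟨γ, hγ⟩ := exists_propTo hA hC
  exact hβ.commute hγ

/-- `tr ^ 2 - 4` is the discriminant, so `displ` is a quadratic form in the trace-free part.
Consequently commuting nonscalar elements are ordered by displacement in the same way at every
point. -/
lemma PropTo.displ {A B : SL(2, ℝ)} {β : ℝ} (h : PropTo A B β) (z : ℍ) :
    displ B z = β ^ 2 * displ A z := by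
  obtain ⟨h1, h2, h3⟩ := h
  have hA := det_eq_one' A
  have hB := det_eq_one' B
  have e : (B 0 0 + B 1 1) ^ 2 - 4 = β ^ 2 * ((A 0 0 + A 1 1) ^ 2 - 4) := by
    have e1 : (B 0 0 + B 1 1) ^ 2 - 4 = (B 1 1 - B 0 0) ^ 2 + 4 * B 0 1 * B 1 0 := by
      linear_combination 4 * hB
    rw [e1, h3, h1, h2]
    linear_combination -4 * β ^ 2 * hA
  unfold TwistedEisenstein.displ
  rw [h1, h2, h3, add_sub_assoc, e]
  ring

/-- A nonscalar matrix that is not elliptic has no fixed point in the upper half-plane. If both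
nonnegative summands of `displ` vanish, eliminating `A 0 1` from the vanishing discriminant leaves a
sum of two squares, and `A` is scalar. -/
lemma displ_pos {A : SL(2, ℝ)} (hA : NonScalar A) (htr : 2 ≤ |A 0 0 + A 1 1|) (z : ℍ) :
    0 < displ A z := by
  have h4 : 0 ≤ (A 0 0 + A 1 1) ^ 2 - 4 := by
    have := pow_le_pow_left₀ (by norm_num) htr 2
    rw [sq_abs] at this; linarith
  have hy := z.im_pos
  have hdet := det_eq_one' A
  by_contra hcon
  have hle := not_lt.1 hcon
  unfold displ at hle
  set P := A 1 0 * (z.re ^ 2 + z.im ^ 2) + (A 1 1 - A 0 0) * z.re - A 0 1 with hP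
  have hP0 : (P / z.im) ^ 2 = 0 := le_antisymm (by linarith) (sq_nonneg _)
  have htr0 : (A 0 0 + A 1 1) ^ 2 - 4 = 0 := le_antisymm (by linarith [sq_nonneg (P / z.im)]) h4
  have hP1 : P = 0 := by
    have := pow_eq_zero_iff (two_ne_zero) |>.1 hP0
    rcases div_eq_zero_iff.1 this with h | h
    · exact h
    · exact absurd h hy.ne'
  have hdisc : (A 1 1 - A 0 0) ^ 2 + 4 * A 0 1 * A 1 0 = 0 := by linear_combination htr0 - 4 * hdet
  have hb : A 0 1 = A 1 0 * (z.re ^ 2 + z.im ^ 2) + (A 1 1 - A 0 0) * z.re := by linarith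
  have h5 : (A 1 1 - A 0 0 + 2 * A 1 0 * z.re) ^ 2 + (2 * A 1 0 * z.im) ^ 2 = 0 := by
    rw [hb] at hdisc; linear_combination hdisc
  have h6 : 2 * A 1 0 * z.im = 0 := by
    have : (2 * A 1 0 * z.im) ^ 2 = 0 :=
      le_antisymm (by linarith [sq_nonneg (A 1 1 - A 0 0 + 2 * A 1 0 * z.re)]) (sq_nonneg _)
    simpa using this
  have h7 : A 1 0 = 0 := by
    rcases mul_eq_zero.1 h6 with h | h
    · linarith
    · exact absurd h hy.ne'
  have h8 : A 1 1 - A 0 0 = 0 := by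
    rw [h7] at h5; simpa using h5
  exact hA ⟨by rw [hb, h7, h8]; ring, h7, by linarith⟩

end

section

/-! ### Discrete subgroups of `SL(2, ℝ)` without elliptic elements -/

/-- A discrete subgroup of `SL(2, ℝ)` that contains `-1` and has no elliptic elements. -/
structure NoElliptic (G : Subgroup SL(2, ℝ)) : Prop where
  neg_one_mem : (-1 : SL(2, ℝ)) ∈ G
  discrete : DiscreteTopology G
  two_le_trace : ∀ A ∈ G, 2 ≤ |A 0 0 + A 1 1|

lemma finite_of_dist_le {G : Subgroup SL(2, ℝ)} (hG : DiscreteTopology G) {K : Set ℍ}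
    (hK : IsCompact K) (r : ℝ) : {A : SL(2, ℝ) | A ∈ G ∧ ∃ z ∈ K, dist z (A • z) ≤ r}.Finite := by
  have hL : IsCompact (Metric.cthickening r K) :=
    Metric.isCompact_of_isClosed_isBounded Metric.isClosed_cthickening hK.isBounded.cthickening
  have h := ProperlyDiscontinuousSMul.finite_disjoint_inter_image (Γ := G) hK hL
  refine (h.image (fun A : G => (A : SL(2, ℝ)))).subset ?_
  rintro A ⟨hA, z, hz, hd⟩
  refine ⟨⟨A, hA⟩, ?_, rfl⟩
  refine ⟨A • z, ⟨z, hz, rfl⟩, ?_⟩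
  exact Metric.mem_cthickening_of_dist_le _ _ _ _ hz (by rwa [dist_comm])

lemma finite_of_displ_le {G : Subgroup SL(2, ℝ)} (hG : DiscreteTopology G) {K : Set ℍ}
    (hK : IsCompact K) (r : ℝ) : {A : SL(2, ℝ) | A ∈ G ∧ ∃ z ∈ K, displ A z ≤ r}.Finite := by
  refine (finite_of_dist_le hG hK (r + 2)).subset ?_
  rintro A ⟨hA, z, hz, hd⟩
  refine ⟨hA, z, hz, ?_⟩
  rw [displ_eq_uDist, uDist_eq] at hd
  have h1 : dist z (A • z) ≤ Real.sinh (dist z (A • z)) := Real.self_le_sinh_iff.2 dist_nonneg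
  have h2 := Real.sinh_lt_cosh (dist z (A • z))
  have h3 := Real.cosh_pos (dist z (A • z))
  linarith

lemma exists_minimal {G : Subgroup SL(2, ℝ)} (hG : DiscreteTopology G) (z : ℍ)
    {A : SL(2, ℝ)} (hA : A ∈ G) (hA' : NonScalar A) :
    ∃ A₀ ∈ G, NonScalar A₀ ∧ displ A₀ z ≤ displ A z ∧
      ∀ B ∈ G, NonScalar B → displ A₀ z ≤ displ B z := by
  have hfin : {B : SL(2, ℝ) | (B ∈ G ∧ ∃ w ∈ ({z} : Set ℍ), displ B w ≤ displ A z) ∧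
      NonScalar B}.Finite :=
    (finite_of_displ_le hG isCompact_singleton _).subset fun B hB => hB.1
  obtain ⟨A₀, h1, h2⟩ := hfin.exists_minimalFor (fun B => displ B z) _ ⟨A, ⟨hA, z, rfl, le_rfl⟩, hA'⟩
  obtain ⟨⟨h3, w, rfl, h4⟩, h5⟩ := h1
  refine ⟨A₀, h3, h5, h4, fun B hB hB' => ?_⟩
  by_contra hcon
  push Not at hcon
  exact absurd (h2 ⟨⟨hB, w, rfl, hcon.le.trans h4⟩, hB'⟩ hcon.le) (not_le.2 hcon)

lemma NoElliptic.displ_pos {G : Subgroup SL(2, ℝ)} (hG : NoElliptic G) {A : SL(2, ℝ)}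
    (hA : A ∈ G) (hA' : NonScalar A) (z : ℍ) : 0 < displ A z :=
  TwistedEisenstein.displ_pos hA' (hG.two_le_trace A hA) z

lemma NoElliptic.neg_mem {G : Subgroup SL(2, ℝ)} (hG : NoElliptic G) {A : SL(2, ℝ)}
    (hA : A ∈ G) : -A ∈ G := by
  have := G.mul_mem hG.neg_one_mem hA
  simpa using this

lemma trace_conj (g A : SL(2, ℝ)) :
    (g * A * g⁻¹) 0 0 + (g * A * g⁻¹) 1 1 = A 0 0 + A 1 1 := by
  have h : Matrix.trace ((g * A * g⁻¹ : SL(2, ℝ)) : Matrix (Fin 2) (Fin 2) ℝ)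
      = Matrix.trace (A : Matrix (Fin 2) (Fin 2) ℝ) := by
    rw [Matrix.SpecialLinearGroup.coe_mul, Matrix.trace_mul_comm,
      ← Matrix.SpecialLinearGroup.coe_mul]
    have : g⁻¹ * (g * A) = A := by group
    rw [this]
  simpa [Matrix.trace_fin_two] using h

lemma exists_smul_I (z : ℍ) : ∃ g : SL(2, ℝ), g • UpperHalfPlane.I = z :=
  ⟨UpperHalfPlane.toSL2R z, UpperHalfPlane.toSL2R_smul_I z⟩

lemma displ_commutator_le' {A B : SL(2, ℝ)} (hA : 2 ≤ A 0 0 + A 1 1) (hB : 2 ≤ B 0 0 + B 1 1)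
    (z : ℍ) :
    displ (A * B * A⁻¹ * B⁻¹) z ≤
      8 * displ A z * displ B z * ((displ A z + 2) * (displ B z + 2)) ∧
    (4 * displ A z * displ B z * ((displ A z + 2) * (displ B z + 2)) < 8 →
      A * B * A⁻¹ * B⁻¹ ≠ -1) := by
  obtain ⟨g, rfl⟩ := exists_smul_I z
  have key (C : SL(2, ℝ)) : displ C (g • UpperHalfPlane.I) =
      displ (g⁻¹ * C * g) UpperHalfPlane.I := by
    rw [← displ_conj g (g⁻¹ * C * g)]
    congr 1
    group
  have h := displ_commutator_le (A := g⁻¹ * A * g) (B := g⁻¹ * B * g)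
    (by have := trace_conj g⁻¹ A; rw [inv_inv] at this; rwa [this])
    (by have := trace_conj g⁻¹ B; rw [inv_inv] at this; rwa [this])
  have e : g⁻¹ * A * g * (g⁻¹ * B * g) * (g⁻¹ * A * g)⁻¹ * (g⁻¹ * B * g)⁻¹ =
      g⁻¹ * (A * B * A⁻¹ * B⁻¹) * g := by group
  rw [e, ← key, ← key, ← key] at h
  refine ⟨h.1, fun hlt heq => ?_⟩
  have h2 := h.2.trans_lt hlt
  rw [heq] at h2
  have : g⁻¹ * -1 * g = -1 := by simp
  rw [this] at h2
  -- `msq (-1 - 1) = 8`, which explains the threshold 8.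
  simp [msq, Matrix.sub_apply] at h2
  norm_num at h2

/-- The Margulis constant for the displacement function. -/
lemma NoElliptic.commute_of_minimal {G : Subgroup SL(2, ℝ)} (hG : NoElliptic G) {z : ℍ}
    {A B : SL(2, ℝ)} (hA : A ∈ G) (hA' : NonScalar A) (hB : B ∈ G)
    (hAs : displ A z < 1 / 100) (hBs : displ B z < 1 / 100)
    (hmin : ∀ B ∈ G, NonScalar B → displ A z ≤ displ B z) : A * B = B * A := by
  -- Replacing a matrix by its negative changes neither displacement nor commutation, so both traces
  -- may be taken to be at least 2.
  wlog htA : 2 ≤ A 0 0 + A 1 1 generalizing A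
  · have htA' : 2 ≤ (-A) 0 0 + (-A) 1 1 := by
      have := hG.two_le_trace A hA
      rw [le_abs] at this
      rcases this with h | h
      · exact absurd h htA
      · simp; linarith
    have := this (hG.neg_mem hA) hA'.neg (by rwa [displ_neg]) (by simpa only [displ_neg] using hmin)
      htA'
    simpa using this
  wlog htB : 2 ≤ B 0 0 + B 1 1 generalizing B
  · have htB' : 2 ≤ (-B) 0 0 + (-B) 1 1 := by
      have := hG.two_le_trace B hB
      rw [le_abs] at this
      rcases this with h | h
      · exact absurd h htB
      · simp; linarith
    have := this (hG.neg_mem hB) (by rwa [displ_neg]) htB'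
    simpa using this
  obtain ⟨h1, h2⟩ := displ_commutator_le' htA htB z
  have hA0 : 0 < displ A z := hG.displ_pos hA hA' z
  have hB0 : 0 ≤ displ B z := displ_nonneg B z
  have hprod : (displ A z + 2) * (displ B z + 2) ≤ 9 := by nlinarith
  have hprod0 : 0 ≤ (displ A z + 2) * (displ B z + 2) := by positivity
  have hAB : 0 ≤ displ A z * displ B z := by positivity
  have hCm : A * B * A⁻¹ * B⁻¹ ∈ G := G.mul_mem (G.mul_mem (G.mul_mem hA hB) (G.inv_mem hA))
    (G.inv_mem hB)
  -- The commutator moves `z` by at most `72 * displ B z < 1` times what `A` does. As `A` is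
  -- minimal, the commutator is scalar, and it is too close to 1 to be `-1`.
  have hlt : displ (A * B * A⁻¹ * B⁻¹) z < displ A z := by
    refine h1.trans_lt ?_
    calc 8 * displ A z * displ B z * ((displ A z + 2) * (displ B z + 2))
        = 8 * (displ A z * displ B z) * ((displ A z + 2) * (displ B z + 2)) := by ring
      _ ≤ 8 * (displ A z * displ B z) * 9 := by gcongr
      _ = displ A z * (72 * displ B z) := by ring
      _ < displ A z * 1 := by gcongr; linarith
      _ = displ A z := mul_one _
  have hns : ¬NonScalar (A * B * A⁻¹ * B⁻¹) := fun h => absurd (hmin _ hCm h) (not_le.2 hlt)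
  rcases not_nonScalar_iff.1 hns with h | h
  · exact mul_inv_eq_iff_eq_mul.1 (mul_inv_eq_one.1 h)
  · refine absurd h (h2 ?_)
    nlinarith

lemma NoElliptic.commute {G : Subgroup SL(2, ℝ)} (hG : NoElliptic G) {z : ℍ}
    {A B : SL(2, ℝ)} (hA : A ∈ G) (hA' : NonScalar A) (hB : B ∈ G)
    (hAs : displ A z < 1 / 100) (hBs : displ B z < 1 / 100) : A * B = B * A := by
  obtain ⟨A₀, h0, h0', h1, h2⟩ := exists_minimal hG.discrete z hA hA'
  have hs := h1.trans_lt hAs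
  exact commute_trans h0' (hG.commute_of_minimal h0 h0' hA hs hAs h2)
    (hG.commute_of_minimal h0 h0' hB hs hBs h2)

/-! ### The preimage in `SL(2, ℝ)` of a torsion-free discrete group -/

/-- The preimage in `SL(2, ℝ)`. -/
def lift (Γ : Subgroup PSL(2, ℝ)) : Subgroup SL(2, ℝ) :=
  Γ.comap (QuotientGroup.mk' (Subgroup.center SL(2, ℝ)))

lemma mem_lift {Γ : Subgroup PSL(2, ℝ)} {A : SL(2, ℝ)} : A ∈ lift Γ ↔ (A : PSL(2, ℝ)) ∈ Γ := Iff.rfl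

lemma discreteTopology_lift {Γ : Subgroup PSL(2, ℝ)} (h : DiscreteTopology Γ) :
    DiscreteTopology (lift Γ) := by
  have h1 : IsOpen ({1} : Set Γ) := isOpen_discrete _
  obtain ⟨U, hU, hU1⟩ := isOpen_induced_iff.1 h1
  refine discreteTopology_of_isOpen_singleton_one ?_
  refine isOpen_induced_iff.2 ⟨((fun A : SL(2, ℝ) => (A : PSL(2, ℝ))) ⁻¹' U) ∩
    {A : SL(2, ℝ) | 0 < A 0 0}, ?_, ?_⟩
  · refine (hU.preimage QuotientGroup.continuous_mk).inter ?_
    refine isOpen_lt continuous_const ?_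
    exact (continuous_apply_apply 0 0).comp continuous_subtype_val
  · ext ⟨A, hA⟩
    constructor
    · rintro ⟨h2, h3⟩
      have h4 : (⟨(A : PSL(2, ℝ)), hA⟩ : Γ) ∈ ({1} : Set Γ) := by
        rw [← hU1]; exact h2
      have h5 : (A : PSL(2, ℝ)) = 1 := congrArg Subtype.val h4
      rw [mk_eq_one_iff, not_nonScalar_iff] at h5
      rcases h5 with rfl | rfl
      · rfl
      · simp at h3; norm_num at h3
    · rintro h2
      have h3 : A = 1 := congrArg Subtype.val h2
      subst h3
      refine ⟨?_, by simp⟩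
      have : (1 : Γ) ∈ Subtype.val ⁻¹' U := by rw [hU1]; rfl
      exact this

lemma noElliptic_lift {Γ : Subgroup PSL(2, ℝ)} (h : DiscreteTopology Γ) (ht : TorsionFree Γ) :
    NoElliptic (lift Γ) where
  neg_one_mem := by
    have : ((-1 : SL(2, ℝ)) : PSL(2, ℝ)) = 1 := mk_eq_one_iff.2 (not_nonScalar_iff.2 (Or.inr rfl))
    rw [mem_lift, this]; exact Γ.one_mem
  discrete := discreteTopology_lift h
  two_le_trace := by
    intro A hA
    by_contra hlt
    push Not at hlt
    have hsq : (A 0 0 + A 1 1) ^ 2 < 4 := by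
      rw [← sq_abs]; nlinarith [abs_nonneg (A 0 0 + A 1 1)]
    have hdet := det_eq_one' A
    have hc : A 1 0 ≠ 0 := by
      intro hc
      rw [hc] at hdet
      nlinarith [sq_nonneg (A 0 0 - A 1 1)]
    set D := 4 - (A 0 0 + A 1 1) ^ 2 with hD
    have hDpos : 0 < D := by rw [hD]; linarith
    -- The fixed point of the elliptic matrix `A` in the upper half-plane.
    let z : ℍ := ⟨⟨(A 0 0 - A 1 1) / (2 * A 1 0), Real.sqrt D / (2 * |A 1 0|)⟩, by
      have : 0 < |A 1 0| := abs_pos.2 hc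
      have : 0 < Real.sqrt D := Real.sqrt_pos.2 hDpos
      change 0 < Real.sqrt D / (2 * |A 1 0|)
      positivity⟩
    have hre : z.re = (A 0 0 - A 1 1) / (2 * A 1 0) := rfl
    have him : z.im ^ 2 = D / (4 * A 1 0 ^ 2) := by
      change (Real.sqrt D / (2 * |A 1 0|)) ^ 2 = _
      rw [div_pow, Real.sq_sqrt hDpos.le, mul_pow, sq_abs]; norm_num
    have hz : displ A z = 0 := by
      unfold displ
      have hP : A 1 0 * (z.re ^ 2 + z.im ^ 2) + (A 1 1 - A 0 0) * z.re - A 0 1 =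
          D / (2 * A 1 0) := by
        rw [him, hre, hD]
        field_simp
        linear_combination 16 * hdet
      rw [hP, div_pow, him]
      field_simp
      rw [hD]; ring
    have hfix : A • z = z := by
      have h1 := two_mul_cosh_dist_smul A z
      rw [hz] at h1
      have h2 : dist z (A • z) = 0 := by
        by_contra hne
        have := (Real.one_lt_cosh (x := dist z (A • z))).2 hne
        linarith
      exact (dist_eq_zero.1 h2).symm
    have hpow : ∀ n : ℕ, A ^ n • z = z := by
      intro n
      induction n with
      | zero => simp
      | succ n ih => rw [pow_succ, mul_smul, hfix, ih]
    have hfin := finite_of_dist_le (discreteTopology_lift h) (isCompact_singleton (x := z)) 0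
    have hmaps : ∀ n : ℕ, A ^ n ∈ {A : SL(2, ℝ) | A ∈ lift Γ ∧ ∃ w ∈ ({z} : Set ℍ),
        dist w (A • w) ≤ 0} := fun n => ⟨(lift Γ).pow_mem hA n, z, rfl, by rw [hpow]; simp⟩
    -- All powers of `A` fix `z`, and by discreteness only finitely many elements do.
    -- Torsion-freeness then makes `A` scalar, against `A 1 0 ≠ 0`.
    have hfo : IsOfFinOrder A := by
      by_contra hno
      have hinj := injective_pow_iff_not_isOfFinOrder.2 hno
      exact Set.infinite_of_injective_forall_mem hinj hmaps hfin
    have hfo' : IsOfFinOrder (⟨(A : PSL(2, ℝ)), hA⟩ : Γ) := by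
      rw [isOfFinOrder_iff_pow_eq_one] at hfo ⊢
      obtain ⟨n, hn, hAn⟩ := hfo
      refine ⟨n, hn, Subtype.ext ?_⟩
      change (A : PSL(2, ℝ)) ^ n = 1
      rw [← QuotientGroup.mk_pow, hAn]; rfl
    have h1 : (A : PSL(2, ℝ)) = 1 := congrArg Subtype.val (ht _ hfo')
    rw [mk_eq_one_iff, NonScalar, not_not] at h1
    exact hc h1.2.1

end

section

open MeasureTheory

/-! ### The thick part is cocompact -/

/-- The points that are moved by at least `ε` by all nontrivial elements. -/
def thick (G : Subgroup SL(2, ℝ)) (ε : ℝ) : Set ℍ :=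
  {z | ∀ A ∈ G, NonScalar A → ε ≤ displ A z}

lemma exists_chord_lt {ε : ℝ} (hε : 0 < ε) : ∃ r, 0 < r ∧ r ≤ 1 ∧ chord r < ε := by
  have h : Filter.Tendsto chord (nhds 0) (nhds (chord 0)) := by
    have : Continuous chord := by unfold chord; fun_prop
    exact this.tendsto 0
  have h0 : chord 0 = 0 := by simp [chord]
  rw [h0] at h
  have h1 := h.eventually (gt_mem_nhds hε)
  obtain ⟨δ, hδ, h2⟩ := Metric.eventually_nhds_iff.1 h1
  refine ⟨min (δ / 2) 1, by positivity, min_le_right _ _, h2 ?_⟩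
  have : 0 < min (δ / 2) 1 := by positivity
  rw [dist_zero_right, Real.norm_eq_abs, abs_of_pos this]
  exact (min_le_left _ _).trans_lt (by linarith)

lemma chord_pos {r : ℝ} (hr : 0 < r) : 0 < chord r := by
  have := (Real.one_lt_cosh (x := r)).2 hr.ne'
  unfold chord; linarith

instance measurableConstSMul_SL : MeasurableConstSMul SL(2, ℝ) ℍ where
  measurable_const_smul g := (continuous_const_smul g).measurable

instance smulInvariantMeasure_SL : SMulInvariantMeasure SL(2, ℝ) ℍ volume where
  measure_preimage_smul g _ hs :=
    SMulInvariantMeasure.measure_preimage_smul (Matrix.SpecialLinearGroup.toGL g) hs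

lemma volume_ball (z : ℍ) (r : ℝ) :
    volume (Metric.ball z r) = volume (Metric.ball UpperHalfPlane.I r) := by
  obtain ⟨g, rfl⟩ := exists_smul_I z
  have : Metric.ball (g • UpperHalfPlane.I) r = (fun w => g⁻¹ • w) ⁻¹' Metric.ball UpperHalfPlane.I r := by
    ext w
    simp only [Metric.mem_ball, Set.mem_preimage]
    rw [← dist_smul g⁻¹ w, inv_smul_smul]
  rw [this, measure_preimage_smul]

lemma volume_ball_pos (z : ℍ) {r : ℝ} (hr : 0 < r) : 0 < volume (Metric.ball z r) := by
  rw [UpperHalfPlane.volume_eq_lintegral, UpperHalfPlane.image_coe_ball]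
  set B : Set ℂ := Metric.ball ↑(z.center r) (z.im * Real.sinh r) with hB
  have hBpos : 0 < volume B := Metric.measure_ball_pos _ _ (mul_pos z.im_pos (Real.sinh_pos_iff.2 hr))
  rw [lintegral_pos_iff_support (by fun_prop)]
  refine hBpos.trans_le ?_
  rw [Measure.restrict_apply' Metric.isOpen_ball.measurableSet]
  refine measure_mono fun w hw => ⟨?_, hw⟩
  have : 0 < w.im := by
    have h1 : w ∈ ((↑) : ℍ → ℂ) '' Metric.ball (α := ℍ) z r := by
      rw [UpperHalfPlane.image_coe_ball]; exact hw
    obtain ⟨w', -, rfl⟩ := h1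
    exact w'.im_pos
  simp [this.ne']

lemma countable_of_discrete {Γ : Subgroup PSL(2, ℝ)} (h : DiscreteTopology Γ) : Countable Γ := by
  have hfin (n : ℕ) := finite_of_dist_le (discreteTopology_lift h)
    (isCompact_singleton (x := UpperHalfPlane.I)) n
  have hc : (lift Γ : Set SL(2, ℝ)).Countable := by
    refine (Set.countable_iUnion fun n => (hfin n).countable).mono fun A hA => ?_
    obtain ⟨n, hn⟩ := exists_nat_ge (dist UpperHalfPlane.I (A • UpperHalfPlane.I))
    exact Set.mem_iUnion.2 ⟨n, hA, _, rfl, hn⟩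
  have : Countable (lift Γ) := hc.to_subtype
  refine Function.Surjective.countable (f := fun A : lift Γ => (⟨(A : SL(2, ℝ)), A.2⟩ : Γ)) ?_
  rintro ⟨g, hg⟩
  obtain ⟨A, rfl⟩ := QuotientGroup.mk_surjective g
  exact ⟨⟨A, hg⟩, rfl⟩

/-- Take a finite set of thick points whose orbits are pairwise at distance at least `2 r`. The
`r`-balls around them have disjoint translates, since thickness separates the translates of a single
ball, so finite covolume bounds their number. For a set of maximal size the `2 r`-balls meet every
thick orbit. -/
lemma exists_compact_thick {Γ : Subgroup PSL(2, ℝ)} (hΓ : IsLattice Γ) {ε : ℝ} (hε : 0 < ε) :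
    ∃ K : Set ℍ, IsCompact K ∧ ∀ z ∈ thick (lift Γ) ε, ∃ A ∈ lift Γ, A • z ∈ K := by
  classical
  obtain ⟨r', hr', -, hrε⟩ := exists_chord_lt hε
  obtain ⟨r, rfl⟩ : ∃ r, r' = 2 * r := ⟨r' / 2, by ring⟩
  have hr : 0 < r := by linarith
  obtain ⟨F, hF, hFfin⟩ := hΓ.finite_covolume
  have hcount := countable_of_discrete hΓ.discrete
  have : MeasurableConstSMul Γ ℍ := ⟨fun g => by
    obtain ⟨A, hA⟩ := QuotientGroup.mk_surjective (g : PSL(2, ℝ))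
    have : (fun z : ℍ => g • z) = fun z => A • z := by
      ext1 z; rw [Subgroup.smul_def, ← hA, ← smul_mk_uhp]
    rw [this]; exact measurable_const_smul A⟩
  have : SMulInvariantMeasure Γ ℍ volume := ⟨fun g s hs => by
    obtain ⟨A, hA⟩ := QuotientGroup.mk_surjective (g : PSL(2, ℝ))
    have : (fun z : ℍ => g • z) = fun z => A • z := by
      ext1 z; rw [Subgroup.smul_def, ← hA, ← smul_mk_uhp]
    rw [this]; exact SMulInvariantMeasure.measure_preimage_smul A hs⟩
  let Sep : Finset ℍ → Prop := fun T => (∀ z ∈ T, z ∈ thick (lift Γ) ε) ∧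
    ∀ z ∈ T, ∀ w ∈ T, z ≠ w → ∀ A ∈ lift Γ, 2 * r ≤ dist z (A • w)
  have hthick : ∀ z ∈ thick (lift Γ) ε, ∀ A ∈ lift Γ, NonScalar A → 2 * r ≤ dist z (A • z) := by
    intro z hz A hA hA'
    rw [← chord_le_chord (by linarith) dist_nonneg, ← displ_eq_chord]
    exact hrε.le.trans (hz A hA hA')
  have hbound : ∀ T, Sep T → (T.card : ENNReal) * volume (Metric.ball UpperHalfPlane.I r) ≤ volume F := by
    intro T hT
    have hvol : volume (⋃ w ∈ T, Metric.ball w r) =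
        (T.card : ENNReal) * volume (Metric.ball UpperHalfPlane.I r) := by
      rw [measure_biUnion_finset]
      · simp [volume_ball]
      · intro z hz w hw hzw
        refine Metric.ball_disjoint_ball ?_
        have := hT.2 z hz w hw hzw 1 (lift Γ).one_mem
        rw [one_smul] at this; linarith
      · exact fun w _ => Metric.isOpen_ball.measurableSet
    rw [← hvol]
    by_contra hlt
    have hmeas : NullMeasurableSet (⋃ w ∈ T, Metric.ball w r) volume :=
      (T.measurableSet_biUnion fun w _ => Metric.isOpen_ball.measurableSet).nullMeasurableSet
    -- A set of larger volume than the fundamental domain contains two points related by a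
    -- nontrivial element.
    obtain ⟨x, hx, y, hy, g, hg, hgx⟩ := hF.exists_ne_one_smul_eq hmeas (not_le.1 hlt)
    simp only [Set.mem_iUnion, Metric.mem_ball, exists_prop] at hx hy
    obtain ⟨w, hw, hxw⟩ := hx
    obtain ⟨w', hw', hyw⟩ := hy
    obtain ⟨A, hA⟩ := QuotientGroup.mk_surjective (g : PSL(2, ℝ))
    have hAmem : A ∈ lift Γ := by rw [mem_lift, hA]; exact g.2
    have hAx : A • x = y := by rw [← hgx, Subgroup.smul_def, ← hA, ← smul_mk_uhp]
    have hd : dist w' (A • w) < 2 * r := by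
      calc dist w' (A • w) ≤ dist w' y + dist y (A • w) := dist_triangle _ _ _
        _ = dist y w' + dist x w := by rw [dist_comm w' y, ← hAx, dist_smul]
        _ < 2 * r := by linarith
    by_cases hww : w' = w
    · subst hww
      have hns : NonScalar A := by
        by_contra hns
        rw [← mk_eq_one_iff, hA] at hns
        exact hg (Subtype.ext hns)
      exact absurd (hthick w' (hT.1 _ hw) A hAmem hns) (not_le.2 hd)
    · exact absurd (hT.2 w' hw' w hw hww A hAmem) (not_le.2 hd)
  have hv := volume_ball_pos UpperHalfPlane.I hr
  obtain ⟨N, hN⟩ : ∃ N : ℕ, ∀ T, Sep T → T.card ≤ N := by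
    have hne : volume F / volume (Metric.ball UpperHalfPlane.I r) ≠ ⊤ :=
      ENNReal.div_ne_top hFfin.ne hv.ne'
    obtain ⟨N, hN⟩ := ENNReal.exists_nat_gt hne
    refine ⟨N, fun T hT => ?_⟩
    have h1 : (T.card : ENNReal) ≤ volume F / volume (Metric.ball UpperHalfPlane.I r) :=
      (ENNReal.le_div_iff_mul_le (Or.inl hv.ne')
        (Or.inl Metric.isBounded_ball.measure_lt_top.ne)).2 (hbound T hT)
    exact_mod_cast (h1.trans hN.le)
  obtain ⟨T, hT, hmax⟩ : ∃ T, Sep T ∧ ∀ T', Sep T' → T'.card ≤ T.card := by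
    have hP : ∃ n, n ≤ N ∧ ∃ T, Sep T ∧ T.card = n := ⟨0, by simp, ∅, by simp [Sep], rfl⟩
    let n := Nat.findGreatest (fun n => ∃ T, Sep T ∧ T.card = n) N
    have hn : ∃ T, Sep T ∧ T.card = n := by
      obtain ⟨m, hm, hTm⟩ := hP
      exact Nat.findGreatest_spec (P := fun n => ∃ T, Sep T ∧ T.card = n) hm hTm
    obtain ⟨T, hT, hTn⟩ := hn
    refine ⟨T, hT, fun T' hT' => ?_⟩
    rw [hTn]
    exact Nat.le_findGreatest (hN T' hT') ⟨T', hT', rfl⟩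
  refine ⟨⋃ w ∈ T, Metric.closedBall w (2 * r),
    T.isCompact_biUnion fun w _ => isCompact_closedBall _ _, fun z hz => ?_⟩
  by_contra hcon
  push Not at hcon
  have hfar : ∀ w ∈ T, ∀ A ∈ lift Γ, 2 * r < dist (A • z) w := by
    intro w hw A hA
    have := hcon A hA
    simp only [Set.mem_iUnion, Metric.mem_closedBall, not_exists, not_le] at this
    exact this w hw
  have hzT : z ∉ T := fun h => by
    have := hfar z h 1 (lift Γ).one_mem
    simp at this; linarith
  have hS : Sep (insert z T) := by
    refine ⟨?_, ?_⟩
    · intro w hw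
      rcases Finset.mem_insert.1 hw with rfl | h
      · exact hz
      · exact hT.1 w h
    · intro x hx y hy hxy A hA
      rcases Finset.mem_insert.1 hx with rfl | hx'
      · rcases Finset.mem_insert.1 hy with rfl | hy'
        · exact absurd rfl hxy
        · have := hfar y hy' A⁻¹ ((lift Γ).inv_mem hA)
          rw [← dist_smul A, smul_inv_smul] at this
          exact this.le
      · rcases Finset.mem_insert.1 hy with rfl | hy'
        · have := hfar x hx' A hA
          rw [dist_comm] at this
          exact this.le
        · exact hT.2 x hx' y hy' hxy A hA
  have := hmax _ hS
  rw [Finset.card_insert_of_notMem hzT] at this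
  omega

/-! ### Thick-thin decomposition -/

lemma continuous_displ (A : SL(2, ℝ)) : Continuous (displ A) := by
  have : displ A = fun z => chord (dist z (A • z)) := by ext z; rw [displ_eq_chord]
  rw [this]
  unfold chord
  have h : Continuous fun z : ℍ => dist z (A • z) := continuous_id.dist (continuous_const_smul A)
  fun_prop

/-- The displacement tends to infinity along the vertical line down to a real point `x` that `A`
does not fix. -/
lemma exists_displ_ge {A : SL(2, ℝ)} (hA : NonScalar A) (M : ℝ) : ∃ z : ℍ, M ≤ displ A z := by
  obtain ⟨x, hx⟩ : ∃ x : ℝ, A 1 0 * x ^ 2 + (A 1 1 - A 0 0) * x - A 0 1 ≠ 0 := by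
    by_contra hcon
    push Not at hcon
    have h0 := hcon 0
    have h1 := hcon 1
    have h2 := hcon (-1)
    exact hA ⟨by linarith, by linarith, by linarith⟩
  set p := A 1 0 * x ^ 2 + (A 1 1 - A 0 0) * x - A 0 1 with hp
  have hlim : Filter.Tendsto (fun y : ℝ => (A 1 0 * (x ^ 2 + y ^ 2) + (A 1 1 - A 0 0) * x - A 0 1) ^ 2
      * (y⁻¹) ^ 2 + ((A 0 0 + A 1 1) ^ 2 - 4)) (nhdsWithin 0 (Set.Ioi 0)) Filter.atTop := by
    refine Filter.tendsto_atTop_add_const_right _ _ ?_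
    have h1 : Filter.Tendsto (fun y : ℝ => (A 1 0 * (x ^ 2 + y ^ 2) + (A 1 1 - A 0 0) * x - A 0 1) ^ 2)
        (nhdsWithin 0 (Set.Ioi 0)) (nhds (p ^ 2)) := by
      have hc : Continuous fun y : ℝ =>
        (A 1 0 * (x ^ 2 + y ^ 2) + (A 1 1 - A 0 0) * x - A 0 1) ^ 2 := by fun_prop
      have := (hc.tendsto 0).mono_left (nhdsWithin_le_nhds (s := Set.Ioi 0))
      simpa [hp] using this
    refine h1.pos_mul_atTop (by positivity) ?_
    exact (Filter.tendsto_pow_atTop two_ne_zero).comp tendsto_inv_nhdsGT_zero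
  obtain ⟨y, hy, hy0⟩ := ((hlim.eventually_ge_atTop M).and self_mem_nhdsWithin).exists
  refine ⟨⟨⟨x, y⟩, hy0⟩, hy.trans (le_of_eq ?_)⟩
  have hy0' : y ≠ 0 := ne_of_gt hy0
  change _ = ((A 1 0 * (x ^ 2 + y ^ 2) + (A 1 1 - A 0 0) * x - A 0 1) / y) ^ 2
    + (A 0 0 + A 1 1) ^ 2 - 4
  rw [div_pow, inv_pow]; ring

lemma trace_sq_sub_le_displ (A : SL(2, ℝ)) (z : ℍ) : (A 0 0 + A 1 1) ^ 2 - 4 ≤ displ A z := by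
  unfold displ
  rw [add_sub_assoc]
  exact le_add_of_nonneg_left (sq_nonneg _)

/-- `δ` is minimal among the elements of `G` that commute with it. -/
def MinInCentralizer (G : Subgroup SL(2, ℝ)) (δ : SL(2, ℝ)) : Prop :=
  ∀ B ∈ G, NonScalar B → ∀ β, PropTo δ B β → 1 ≤ β ^ 2

/-- `β ^ 2` is a ratio of displacements, and these are invariant under simultaneous conjugation and
translation of the point. -/
lemma MinInCentralizer.conj {G : Subgroup SL(2, ℝ)} {δ g : SL(2, ℝ)} (h : MinInCentralizer G δ)
    (hg : g ∈ G) (hpos : ∀ z, 0 < displ δ z) : MinInCentralizer G (g * δ * g⁻¹) := by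
  intro B hB hB' β hβ
  have h1 : Commute (g * δ * g⁻¹) B := by
    have h0 : PropTo (g * δ * g⁻¹) (g * δ * g⁻¹) 1 := ⟨by ring, by ring, by ring⟩
    exact h0.commute hβ
  have hns : NonScalar (g⁻¹ * B * g) := by
    have := nonScalar_conj (g := g⁻¹) (A := B)
    rw [inv_inv] at this; exact this.2 hB'
  have hδ : NonScalar δ := by
    rintro ⟨h1, h2, h3⟩
    have hp := hpos UpperHalfPlane.I
    have hdet := det_eq_one' δ
    rw [displ, h1, h2, h3] at hp
    rw [h1, h2, h3] at hdet
    simp at hp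
    nlinarith
  have h2 : δ * (g⁻¹ * B * g) = (g⁻¹ * B * g) * δ := by
    have h3 : g * δ * g⁻¹ * B = B * (g * δ * g⁻¹) := h1
    calc δ * (g⁻¹ * B * g) = g⁻¹ * (g * δ * g⁻¹ * B) * g := by group
      _ = (g⁻¹ * B * g) * δ := by rw [h3]; group
  obtain ⟨β', hβ'⟩ := exists_propTo hδ h2
  have h3 := h _ (G.mul_mem (G.mul_mem (G.inv_mem hg) hB) hg) hns β' hβ'
  have e1 := hβ.displ (g • UpperHalfPlane.I)
  have e2 := hβ'.displ UpperHalfPlane.I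
  rw [displ_conj] at e1
  have e3 : displ B (g • UpperHalfPlane.I) = displ (g⁻¹ * B * g) UpperHalfPlane.I := by
    rw [← displ_conj g (g⁻¹ * B * g)]; congr 1; group
  rw [e3, e2] at e1
  have := mul_right_cancel₀ (hpos UpperHalfPlane.I).ne' e1
  linarith

/-- At a thin point `z` let `A₀` have least displacement. Somewhere `A₀` has displacement exactly
`ε`, and that point `z'` is `ε`-thick: anything moving it less commutes with `A₀` by the Margulis
lemma, hence has displacement at least that of `A₀`. Translating `z'` into the compact set
conjugates `A₀` into a fixed finite set. A second, smaller threshold `ε₁` then rules out hyperbolic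
elements. -/
lemma exists_thick_thin {Γ : Subgroup PSL(2, ℝ)} (hΓ : IsLattice Γ) (hΓ' : TorsionFree Γ) {ε : ℝ}
    (hε : 0 < ε) (hε' : ε < 1 / 100) :
    ∃ (K : Set ℍ) (S : Set SL(2, ℝ)), IsCompact K ∧ S.Finite ∧
      (∀ δ ∈ S, δ ∈ lift Γ ∧ NonScalar δ ∧ δ 0 0 + δ 1 1 = 2) ∧
      ∀ z : ℍ, ∃ A ∈ lift Γ, A • z ∈ K ∨
        ∃ δ ∈ S, displ δ (A • z) < ε ∧ MinInCentralizer (lift Γ) δ := by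
  have hG := noElliptic_lift hΓ.discrete hΓ'
  obtain ⟨K₀, hK₀, hthick₀⟩ := exists_compact_thick hΓ hε
  have hfin := finite_of_displ_le hG.discrete hK₀ ε
  set S₀ := {A : SL(2, ℝ) | A ∈ lift Γ ∧ ∃ z ∈ K₀, displ A z ≤ ε} with hS₀
  -- `ε₁` lies below `tr ^ 2 - 4` for the finitely many hyperbolic elements of `S₀`. This is a lower
  -- bound for their displacement everywhere, so they never move a point by less than `ε₁`.
  obtain ⟨ε₁, hε₁, hε₁', hhyp⟩ : ∃ ε₁, 0 < ε₁ ∧ ε₁ ≤ ε ∧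
      ∀ δ ∈ S₀, 4 < (δ 0 0 + δ 1 1) ^ 2 → ε₁ ≤ (δ 0 0 + δ 1 1) ^ 2 - 4 := by
    set S₁ := {δ ∈ S₀ | 4 < (δ 0 0 + δ 1 1) ^ 2} with hS₁
    have hf : S₁.Finite := hfin.subset fun δ h => h.1
    rcases S₁.eq_empty_or_nonempty with h | h
    · refine ⟨ε, hε, le_rfl, fun δ hδ h4 => ?_⟩
      have : δ ∈ S₁ := ⟨hδ, h4⟩
      rw [h] at this; exact absurd this (Set.notMem_empty _)
    · obtain ⟨δ₀, h1, h2⟩ := hf.exists_minimalFor (fun δ => (δ 0 0 + δ 1 1) ^ 2 - 4) _ h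
      refine ⟨min ε ((δ₀ 0 0 + δ₀ 1 1) ^ 2 - 4), lt_min hε (by linarith [h1.2]), min_le_left _ _,
        fun δ hδ h4 => (min_le_right _ _).trans ?_⟩
      rcases le_total ((δ₀ 0 0 + δ₀ 1 1) ^ 2 - 4) ((δ 0 0 + δ 1 1) ^ 2 - 4) with h | h
      · exact h
      · exact h2 ⟨hδ, h4⟩ h
  obtain ⟨K₁, hK₁, hthick₁⟩ := exists_compact_thick hΓ hε₁
  refine ⟨K₁, {δ | (δ ∈ S₀ ∨ -δ ∈ S₀) ∧ NonScalar δ ∧ δ 0 0 + δ 1 1 = 2}, hK₁, ?_, ?_, ?_⟩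
  · refine (hfin.union (hfin.image Neg.neg)).subset ?_
    rintro δ ⟨h | h, -, -⟩
    · exact Or.inl h
    · exact Or.inr ⟨-δ, h, neg_neg δ⟩
  · rintro δ ⟨h | h, h2, h3⟩
    · exact ⟨h.1, h2, h3⟩
    · exact ⟨by simpa using hG.neg_mem h.1, h2, h3⟩
  intro z
  by_cases hz : z ∈ thick (lift Γ) ε₁
  · obtain ⟨A, hA, hAz⟩ := hthick₁ z hz
    exact ⟨A, hA, Or.inl hAz⟩
  simp only [thick, Set.mem_ofPred_eq, not_forall, not_le] at hz
  obtain ⟨A, hA, hA', hAz⟩ := hz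
  obtain ⟨A₀, hA₀, hA₀', hle, hmin⟩ := exists_minimal hG.discrete z hA hA'
  have hA₀z : displ A₀ z < ε₁ := hle.trans_lt hAz
  obtain ⟨z₁, hz₁⟩ := exists_displ_ge hA₀' ε
  -- Intermediate value theorem: the displacement of `A₀` is below `ε` at `z` and at least `ε` at
  -- `z₁`.
  obtain ⟨z', hz'⟩ := mem_range_of_exists_le_of_exists_ge (continuous_displ A₀)
    ⟨z, (hA₀z.trans_le hε₁').le⟩ ⟨z₁, hz₁⟩
  have hprop : ∀ B ∈ lift Γ, NonScalar B → ∀ β, PropTo A₀ B β → 1 ≤ β ^ 2 := by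
    intro B hB hB' β hβ
    have h1 := hmin B hB hB'
    rw [hβ.displ] at h1
    have h2 := hG.displ_pos hA₀ hA₀' z
    by_contra hlt
    nlinarith
  have hthick' : z' ∈ thick (lift Γ) ε := by
    intro B hB hB'
    by_contra hlt
    push Not at hlt
    obtain ⟨β, hβ⟩ := exists_propTo hA₀' (hG.commute (z := z') hA₀ hA₀' hB (by rwa [hz']) (hlt.trans hε'))
    have h1 := hprop B hB hB' β hβ
    rw [hβ.displ, hz'] at hlt
    nlinarith
  obtain ⟨α, hα, hαz⟩ := hthick₀ z' hthick'
  have hδG : α * A₀ * α⁻¹ ∈ lift Γ := (lift Γ).mul_mem ((lift Γ).mul_mem hα hA₀) ((lift Γ).inv_mem hα)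
  have hδS : α * A₀ * α⁻¹ ∈ S₀ := ⟨hδG, α • z', hαz, by rw [displ_conj, hz']⟩
  have hδns : NonScalar (α * A₀ * α⁻¹) := nonScalar_conj.2 hA₀'
  have hδtr : ((α * A₀ * α⁻¹) 0 0 + (α * A₀ * α⁻¹) 1 1) ^ 2 = 4 := by
    by_contra hne
    have h1 := hG.two_le_trace _ hδG
    have h2 := pow_le_pow_left₀ (by norm_num) h1 2
    rw [sq_abs] at h2
    have h3 := hhyp _ hδS (lt_of_le_of_ne (by linarith) (Ne.symm hne))
    have h4 := trace_sq_sub_le_displ (α * A₀ * α⁻¹) (α • z)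
    rw [displ_conj] at h4
    linarith
  have hmin' : MinInCentralizer (lift Γ) (α * A₀ * α⁻¹) :=
    MinInCentralizer.conj hprop hα (hG.displ_pos hA₀ hA₀')
  refine ⟨α, hα, Or.inr ?_⟩
  -- The trace is 2 or -2; in the second case the negative of the conjugate is used.
  have h5 : ((α * A₀ * α⁻¹) 0 0 + (α * A₀ * α⁻¹) 1 1 - 2) *
      ((α * A₀ * α⁻¹) 0 0 + (α * A₀ * α⁻¹) 1 1 + 2) = 0 := by linear_combination hδtr
  rcases mul_eq_zero.1 h5 with h | h
  · refine ⟨_, ⟨Or.inl hδS, hδns, by linarith⟩, ?_, hmin'⟩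
    rw [displ_conj]; linarith
  · refine ⟨-(α * A₀ * α⁻¹), ⟨Or.inr (by rwa [neg_neg]), hδns.neg, ?_⟩, ?_, ?_⟩
    · simp only [Matrix.SpecialLinearGroup.coe_neg, Matrix.neg_apply]; linarith
    · rw [displ_neg, displ_conj]; linarith
    · intro B hB hB' β ⟨b1, b2, b3⟩
      have := hmin' B hB hB' (-β) ⟨by simpa using b1, by simpa using b2, by
        rw [b3]; simp only [Matrix.SpecialLinearGroup.coe_neg, Matrix.neg_apply]; ring⟩
      simpa using this

end

section

/-! ### Polynomial growth of representations that are unitary at the cusps -/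

variable {Γ : Subgroup PSL(2, ℝ)} {V : Type*} [NormedAddCommGroup V] [InnerProductSpace ℂ V]

/-- The pullback of a representation to the preimage in `SL(2, ℝ)`. -/
def liftRep (χ : Γ →* (V →L[ℂ] V)) : lift Γ →* (V →L[ℂ] V) :=
  χ.comp ((QuotientGroup.mk' (Subgroup.center SL(2, ℝ))).subgroupComap Γ)

lemma liftRep_apply (χ : Γ →* (V →L[ℂ] V)) (A : SL(2, ℝ)) (hA : A ∈ lift Γ) :
    liftRep χ ⟨A, hA⟩ = χ ⟨(A : PSL(2, ℝ)), hA⟩ := rfl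

lemma norm_map_mul_le {G : Type*} [Group G] (χ : G →* (V →L[ℂ] V)) (x y : G) :
    ‖χ (x * y)‖ ≤ ‖χ x‖ * ‖χ y‖ := by
  rw [map_mul]; exact norm_mul_le _ _

lemma norm_le_one_of_inner {T : V →L[ℂ] V} (h : ∀ v w : V, ⟪T v, T w⟫_ℂ = ⟪v, w⟫_ℂ) :
    ‖T‖ ≤ 1 := by
  refine T.opNorm_le_bound zero_le_one fun v => ?_
  have h1 := h v v
  rw [inner_self_eq_norm_sq_to_K, inner_self_eq_norm_sq_to_K] at h1
  have h2 : ‖T v‖ ^ 2 = ‖v‖ ^ 2 := by exact_mod_cast h1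
  rw [one_mul]
  exact le_of_eq ((sq_eq_sq₀ (norm_nonneg _) (norm_nonneg _)).1 h2)

lemma isParabolic_toGL {δ : SL(2, ℝ)} (h : NonScalar δ) (htr : δ 0 0 + δ 1 1 = 2) :
    (Matrix.SpecialLinearGroup.toGL δ).IsParabolic := by
  refine ⟨?_, ?_⟩
  · rintro ⟨r, hr⟩
    have h1 (i j) : Matrix.scalar (Fin 2) r i j = δ i j := congrFun (congrFun hr i) j
    exact h ⟨by rw [← h1]; simp, by rw [← h1]; simp, by rw [← h1, ← h1]; simp⟩
  · have h1 : Matrix.discr (δ : Matrix (Fin 2) (Fin 2) ℝ) = 0 := by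
      rw [Matrix.discr_fin_two, Matrix.trace_fin_two, δ.det_coe, htr]; norm_num
    exact h1

/-- Anything commuting with a parabolic element fixes its unique boundary fixed point, which is a
cusp. -/
lemma norm_liftRep_le_one {χ : Γ →* (V →L[ℂ] V)} (hχ : UnitaryAtCusps χ) {δ ζ : SL(2, ℝ)}
    (hδ : δ ∈ lift Γ) (hδ' : NonScalar δ) (htr : δ 0 0 + δ 1 1 = 2) (hζ : ζ ∈ lift Γ)
    (hcomm : ζ * δ = δ * ζ) : ‖liftRep χ ⟨ζ, hζ⟩‖ ≤ 1 := by
  have hp := isParabolic_toGL hδ' htr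
  set x := (Matrix.SpecialLinearGroup.toGL δ).parabolicFixedPoint with hx
  have hfix : Matrix.SpecialLinearGroup.toGL δ • x = x := hp.smul_eq_self_iff.2 rfl
  have hζx : Matrix.SpecialLinearGroup.toGL ζ • x = x := by
    rw [hx, ← hp.smul_eq_self_iff, ← hx]
    rw [← mul_smul, ← map_mul, ← hcomm, map_mul, mul_smul, hfix]
  rw [liftRep_apply]
  refine norm_le_one_of_inner (hχ x ⟨_, ⟨δ, hδ, rfl⟩, hp, hfix⟩ _ ?_)
  rw [Subgroup.smul_def, smul_mk_boundary]
  exact hζx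

/-- Elements that conjugate one of finitely many parabolic elements to one of finitely many
elements have bounded image. -/
lemma exists_bound_of_conj {χ : Γ →* (V →L[ℂ] V)} (hχ : UnitaryAtCusps χ) {S T : Set SL(2, ℝ)}
    (hS : S.Finite) (hT : T.Finite)
    (hSp : ∀ δ ∈ S, δ ∈ lift Γ ∧ NonScalar δ ∧ δ 0 0 + δ 1 1 = 2) :
    ∃ C : ℝ, ∀ γ : lift Γ, ∀ δ ∈ S, (γ : SL(2, ℝ)) * δ * (γ : SL(2, ℝ))⁻¹ ∈ T →
      ‖liftRep χ γ‖ ≤ C ∧ ‖liftRep χ γ⁻¹‖ ≤ C := by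
  classical
  have key : ∀ p : SL(2, ℝ) × SL(2, ℝ), p ∈ S ×ˢ T → ∃ C : ℝ, ∀ γ : lift Γ,
      (γ : SL(2, ℝ)) * p.1 * (γ : SL(2, ℝ))⁻¹ = p.2 → ‖liftRep χ γ‖ ≤ C ∧ ‖liftRep χ γ⁻¹‖ ≤ C := by
    rintro ⟨δ, σ⟩ ⟨hδ, -⟩
    obtain ⟨h1, h2, h3⟩ := hSp δ hδ
    by_cases hex : ∃ γ₀ : lift Γ, (γ₀ : SL(2, ℝ)) * δ * (γ₀ : SL(2, ℝ))⁻¹ = σ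
    · obtain ⟨γ₀, hγ₀⟩ := hex
      refine ⟨max ‖liftRep χ γ₀‖ ‖liftRep χ γ₀⁻¹‖, fun γ hγ => ?_⟩
      -- Two elements conjugating `δ` to the same `σ` differ by an element of the centralizer of
      -- `δ`, where `χ` is a contraction together with its inverse.
      have hcomm : ((γ₀⁻¹ * γ : lift Γ) : SL(2, ℝ)) * δ = δ * ((γ₀⁻¹ * γ : lift Γ) : SL(2, ℝ)) := by
        have h4 : (γ : SL(2, ℝ)) * δ * (γ : SL(2, ℝ))⁻¹ =
          (γ₀ : SL(2, ℝ)) * δ * (γ₀ : SL(2, ℝ))⁻¹ := by rw [hγ, hγ₀]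
        push_cast
        calc (γ₀ : SL(2, ℝ))⁻¹ * γ * δ = (γ₀ : SL(2, ℝ))⁻¹ * (γ * δ * (γ : SL(2, ℝ))⁻¹) * γ := by group
          _ = δ * ((γ₀ : SL(2, ℝ))⁻¹ * γ) := by rw [h4]; group
      have h5 := norm_liftRep_le_one hχ h1 h2 h3 (γ₀⁻¹ * γ).2 hcomm
      have h6 := norm_liftRep_le_one hχ h1 h2 h3 (γ₀⁻¹ * γ)⁻¹.2 (ζ := ((γ₀⁻¹ * γ)⁻¹ : lift Γ)) (by
        have : Commute ((γ₀⁻¹ * γ : lift Γ) : SL(2, ℝ)) δ := hcomm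
        exact this.inv_left)
      constructor
      · refine le_trans ?_ (le_max_left _ _)
        have h7 := norm_map_mul_le (liftRep χ) γ₀ (γ₀⁻¹ * γ)
        rw [mul_inv_cancel_left] at h7
        exact h7.trans (mul_le_of_le_one_right (norm_nonneg _) h5)
      · refine le_trans ?_ (le_max_right _ _)
        have h7 := norm_map_mul_le (liftRep χ) (γ₀⁻¹ * γ)⁻¹ γ₀⁻¹
        have h8 : (γ₀⁻¹ * γ)⁻¹ * γ₀⁻¹ = γ⁻¹ := by group
        rw [h8] at h7
        exact h7.trans (mul_le_of_le_one_left (norm_nonneg _) h6)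
    · exact ⟨0, fun γ hγ => absurd ⟨γ, hγ⟩ hex⟩
  choose! C hC using key
  obtain ⟨M, hM⟩ := ((hS.prod hT).image C).bddAbove
  refine ⟨M, fun γ δ hδ hγ => ?_⟩
  have h1 := hC (δ, _) ⟨hδ, hγ⟩ γ rfl
  have h2 := hM (Set.mem_image_of_mem C (show (δ, _) ∈ S ×ˢ T from ⟨hδ, hγ⟩))
  exact ⟨h1.1.trans h2, h1.2.trans h2⟩

lemma eq_or_eq_inv_of_propTo {δ τ : SL(2, ℝ)} {β : ℝ} (h : PropTo δ τ β) (hβ : β ^ 2 = 1)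
    (h1 : δ 0 0 + δ 1 1 = 2) (h2 : τ 0 0 + τ 1 1 = 2) : τ = δ ∨ τ = δ⁻¹ := by
  obtain ⟨b1, b2, b3⟩ := h
  have : (β - 1) * (β + 1) = 0 := by linear_combination hβ
  rcases mul_eq_zero.1 this with hb | hb
  · left
    obtain rfl : β = 1 := by linarith
    ext i j; fin_cases i <;> fin_cases j <;> simp <;> linarith
  · right
    obtain rfl : β = -1 := by linarith
    ext i j; fin_cases i <;> fin_cases j <;>
      simp [Matrix.SpecialLinearGroup.coe_inv, Matrix.adjugate_fin_two] <;> linarith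

/-- There is a set of representatives such that elements relating nearby representatives have
bounded image. -/
lemma exists_local_bound (hΓ : IsLattice Γ) (hΓ' : TorsionFree Γ) {χ : Γ →* (V →L[ℂ] V)}
    (hχ : UnitaryAtCusps χ) :
    ∃ (F : Set ℍ) (ρ C : ℝ), 0 < ρ ∧ ρ ≤ 1 ∧ 1 ≤ C ∧ (∀ z : ℍ, ∃ A : lift Γ, A • z ∈ F) ∧
      ∀ p ∈ F, ∀ q ∈ F, ∀ γ : lift Γ, dist p (γ • q) ≤ ρ → ‖liftRep χ γ‖ ≤ C := by
  have hG := noElliptic_lift hΓ.discrete hΓ'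
  -- Thin points are moved by less than `r / 2`. Carrying the parabolic over to a point at distance
  -- at most `r / 4` from the orbit costs `r / 4` twice, so the total is at most `r`, still below
  -- the Margulis constant.
  obtain ⟨r, hr, hr1, hrc⟩ := exists_chord_lt (ε := 1 / 100) (by norm_num)
  have hε : chord (r / 2) < 1 / 100 :=
    lt_of_le_of_lt ((chord_le_chord (by linarith) hr.le).2 (by linarith)) hrc
  obtain ⟨K, S, hK, hS, hSp, hcover⟩ := exists_thick_thin hΓ hΓ' (chord_pos (half_pos hr)) hε
  set F : Set ℍ := {p | p ∈ K ∨ ∃ δ ∈ S, displ δ p < chord (r / 2) ∧ MinInCentralizer (lift Γ) δ}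
    with hF
  obtain ⟨R, hR⟩ := Metric.isBounded_iff.1 hK.isBounded
  have hfin₁ := finite_of_dist_le hG.discrete hK (R + r / 4)
  have hfin₂ := finite_of_dist_le hG.discrete hK r
  set T₁ := {A : SL(2, ℝ) | A ∈ lift Γ ∧ ∃ z ∈ K, dist z (A • z) ≤ R + r / 4}
  set T₂ := {A : SL(2, ℝ) | A ∈ lift Γ ∧ ∃ z ∈ K, dist z (A • z) ≤ r}
  obtain ⟨C₁, hC₁⟩ : ∃ C₁ : ℝ, ∀ γ : lift Γ, (γ : SL(2, ℝ)) ∈ T₁ → ‖liftRep χ γ‖ ≤ C₁ := by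
    have hf : {γ : lift Γ | (γ : SL(2, ℝ)) ∈ T₁}.Finite :=
      hfin₁.preimage Subtype.val_injective.injOn
    obtain ⟨M, hM⟩ := (hf.image fun γ => ‖liftRep χ γ‖).bddAbove
    exact ⟨M, fun γ hγ => hM ⟨γ, hγ, rfl⟩⟩
  obtain ⟨C₂, hC₂⟩ := exists_bound_of_conj hχ hS
    (hfin₂.union (hS.union (hS.image fun δ => δ⁻¹))) hSp
  have hd_of (δ : SL(2, ℝ)) (p : ℍ) (h : displ δ p < chord (r / 2)) : dist p (δ • p) < r / 2 := by
    rw [displ_eq_chord] at h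
    by_contra hcon
    exact absurd ((chord_le_chord (by linarith) dist_nonneg).2 (not_lt.1 hcon)) (not_le.2 h)
  have hmove (γ δ : SL(2, ℝ)) (p q : ℍ) (hpq : dist p (γ • q) ≤ r / 4)
      (h : displ δ q < chord (r / 2)) : dist p ((γ * δ * γ⁻¹) • p) ≤ r := by
    calc dist p ((γ * δ * γ⁻¹) • p) ≤ dist p (γ • q) + dist (γ • q) ((γ * δ * γ⁻¹) • γ • q)
          + dist ((γ * δ * γ⁻¹) • γ • q) ((γ * δ * γ⁻¹) • p) := dist_triangle4 _ _ _ _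
      _ = dist p (γ • q) + dist q (δ • q) + dist p (γ • q) := by
          rw [dist_smul, dist_comm (γ • q) p, mul_smul (γ * δ), inv_smul_smul, mul_smul, dist_smul]
      _ ≤ r := by linarith [hd_of δ q h]
  refine ⟨F, r / 4, max 1 (max C₁ C₂), by positivity, by linarith, le_max_left _ _, ?_, ?_⟩
  · intro z
    obtain ⟨A, hA, h⟩ := hcover z
    exact ⟨⟨A, hA⟩, h⟩
  intro p hp q hq γ hpq
  refine le_trans ?_ (le_max_right _ _)
  have hpq' : dist p ((γ : SL(2, ℝ)) • q) ≤ r / 4 := hpq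
  -- If both points are in `K`, then `γ` is in the finite set `T₁`. If one is thin and the other in
  -- `K`, a conjugate of the parabolic is in the finite set `T₂`. If both are thin, the conjugate of
  -- `δ'` is shown to be `δ` or `δ⁻¹`.
  rcases hq with hq | ⟨δ', hδ', hq, hm'⟩
  · rcases hp with hp | ⟨δ, hδ, hp, hm⟩
    · refine (hC₁ γ ⟨γ.2, q, hq, ?_⟩).trans (le_max_left _ _)
      calc dist q ((γ : SL(2, ℝ)) • q) ≤ dist q p + dist p ((γ : SL(2, ℝ)) • q) := dist_triangle _ _ _
        _ ≤ R + r / 4 := add_le_add (hR hq hp) hpq'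
    · have hqp : dist q ((γ⁻¹ : SL(2, ℝ)) • p) ≤ r / 4 := by
        rw [← dist_smul (γ : SL(2, ℝ)), smul_inv_smul, dist_comm]; exact hpq'
      have h1 := hC₂ γ⁻¹ δ hδ (Or.inl ⟨?_, q, hq, hmove _ _ _ _ hqp hp⟩)
      · rw [inv_inv] at h1
        exact h1.2.trans (le_max_right _ _)
      · exact (lift Γ).mul_mem ((lift Γ).mul_mem (γ⁻¹).2 (hSp δ hδ).1) ((lift Γ).inv_mem (γ⁻¹).2)
  · refine le_trans ?_ (le_max_right _ _)
    have hd := hmove _ _ _ _ hpq' hq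
    have hτ : (γ : SL(2, ℝ)) * δ' * (γ : SL(2, ℝ))⁻¹ ∈ lift Γ :=
      (lift Γ).mul_mem ((lift Γ).mul_mem γ.2 (hSp δ' hδ').1) ((lift Γ).inv_mem γ.2)
    rcases hp with hp | ⟨δ, hδ, hp, hm⟩
    · exact (hC₂ γ δ' hδ' (Or.inl ⟨hτ, p, hp, hd⟩)).1
    · refine (hC₂ γ δ' hδ' (Or.inr ?_)).1
      obtain ⟨s1, s2, s3⟩ := hSp δ hδ
      obtain ⟨t1, t2, t3⟩ := hSp δ' hδ'
      set τ := (γ : SL(2, ℝ)) * δ' * (γ : SL(2, ℝ))⁻¹ with hτd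
      have hτns : NonScalar τ := nonScalar_conj.2 t2
      have hτp : displ τ p < 1 / 100 := by
        rw [displ_eq_chord]
        exact ((chord_le_chord dist_nonneg hr.le).2 hd).trans_lt hrc
      have hcomm := hG.commute (z := p) s1 s2 hτ (hp.trans hε) hτp
      obtain ⟨β, hβ⟩ := exists_propTo s2 hcomm
      obtain ⟨β', hβ'⟩ := exists_propTo hτns hcomm.symm
      have h1 := hm τ hτ hτns β hβ
      have h2 := (hm'.conj γ.2 (hG.displ_pos t1 t2)) δ s1 s2 β' hβ'
      have h3 := hβ.displ p
      have h4 := hβ'.displ p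
      have h5 := hG.displ_pos s1 s2 p
      -- Both parabolics are minimal in their centralizers, so both squares are at least 1. Being
      -- reciprocal, they equal 1.
      have h6 : β' ^ 2 * β ^ 2 = 1 := by
        rw [h3] at h4
        have : (β' ^ 2 * β ^ 2 - 1) * displ δ p = 0 := by linarith
        rcases mul_eq_zero.1 this with h | h
        · linarith
        · exact absurd h h5.ne'
      have h7 : β ^ 2 = 1 := le_antisymm (by nlinarith) h1
      rcases eq_or_eq_inv_of_propTo hβ h7 s3 ((trace_conj _ _).trans t3) with h | h
      · rw [h]; exact Or.inl hδ
      · rw [h]; exact Or.inr ⟨δ, hδ, rfl⟩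

/-! ### Chaining local bounds along paths through high horocycles. -/

/-- The point `x + i exp u`. -/
def horoPt (x u : ℝ) : ℍ := ⟨⟨x, Real.exp u⟩, Real.exp_pos u⟩

lemma dist_horoPt_vertical (x u v : ℝ) : dist (horoPt x u) (horoPt x v) = |u - v| := by
  rw [UpperHalfPlane.dist_of_re_eq (by rfl)]
  change dist (Real.log (Real.exp u)) (Real.log (Real.exp v)) = _
  rw [Real.log_exp, Real.log_exp, Real.dist_eq]

lemma dist_horoPt_horizontal (x y u : ℝ) :
    dist (horoPt x u) (horoPt y u) ≤ |x - y| / Real.exp u := by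
  refine (UpperHalfPlane.dist_le_dist_coe_div_sqrt _ _).trans (le_of_eq ?_)
  have h1 : (horoPt x u).im = Real.exp u := rfl
  have h2 : (horoPt y u).im = Real.exp u := rfl
  rw [h1, h2, Real.sqrt_mul_self (Real.exp_pos u).le]
  congr 1
  rw [Complex.dist_eq]
  have : ((horoPt x u : ℍ) : ℂ) - (horoPt y u : ℍ) = ((x - y : ℝ) : ℂ) := by
    apply Complex.ext
    · rw [Complex.ofReal_re]; rfl
    · rw [Complex.ofReal_im, Complex.sub_im]
      change Real.exp u - Real.exp u = 0
      ring
  rw [this, Complex.norm_real, Real.norm_eq_abs]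

lemma exists_horoPt (z : ℍ) : ∃ x u, z = horoPt x u := by
  refine ⟨z.re, Real.log z.im, UpperHalfPlane.ext_re_im ?_ ?_⟩
  · rfl
  · change z.im = Real.exp (Real.log z.im)
    rw [Real.exp_log z.im_pos]

/-- Go up from `I` to height `exp U`, across to abscissa `x` in one step, and down to the target.
Each vertical step of length `ρ` costs a factor `C`, so the total is `exp (κ (2 U - u))` up to a
constant, and `exp (2 U - u)` is at most a multiple of `cosh` of the distance. -/
lemma chain_bound {c : ℍ → ℍ → ℝ} {ρ C : ℝ} (hρ : 0 < ρ) (hρ' : ρ ≤ 1) (hC : 1 ≤ C)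
    (h0 : ∀ z w, 0 ≤ c z w)
    (hself : ∀ z, c z z ≤ 1) (hmul : ∀ z p w, c z w ≤ c z p * c p w)
    (hnear : ∀ z w, dist z w ≤ ρ → c z w ≤ C) :
    ∃ M κ : ℝ, 0 < M ∧ 0 ≤ κ ∧
      ∀ z, c UpperHalfPlane.I z ≤ M * (2 * Real.cosh (dist UpperHalfPlane.I z)) ^ κ := by
  have hC0 : 0 < C := by linarith
  have hvert : ∀ n : ℕ, ∀ x u v : ℝ, |u - v| ≤ n * ρ → c (horoPt x u) (horoPt x v) ≤ C ^ n := by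
    intro n
    induction n with
    | zero =>
      intro x u v h
      have : u = v := by
        rw [← sub_eq_zero, ← abs_nonpos_iff]; simpa using h
      subst this
      simpa using hself _
    | succ n ih =>
      intro x u v h
      have hn : (0 : ℝ) < n + 1 := by positivity
      -- The last of `n + 1` equal vertical steps starts here.
      set m := u + (v - u) * (n / (n + 1)) with hm
      have h1 : |u - m| ≤ n * ρ := by
        have : u - m = (u - v) * (n / (n + 1)) := by rw [hm]; ring
        rw [this, abs_mul, abs_of_nonneg (by positivity : (0 : ℝ) ≤ n / (n + 1))]
        push_cast at h
        calc |u - v| * (n / (n + 1)) ≤ (n + 1) * ρ * (n / (n + 1)) := by gcongr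
          _ = n * ρ := by field_simp
      have h2 : |m - v| ≤ ρ := by
        have : m - v = (u - v) * (1 / (n + 1)) := by rw [hm]; field_simp; ring
        rw [this, abs_mul, abs_of_nonneg (by positivity : (0 : ℝ) ≤ 1 / (n + 1))]
        push_cast at h
        calc |u - v| * (1 / (n + 1)) ≤ (n + 1) * ρ * (1 / (n + 1)) := by gcongr
          _ = ρ := by field_simp
      calc c (horoPt x u) (horoPt x v) ≤ c (horoPt x u) (horoPt x m) * c (horoPt x m) (horoPt x v) :=
            hmul _ _ _
        _ ≤ C ^ n * C := mul_le_mul (ih x u m h1) (hnear _ _ (by rwa [dist_horoPt_vertical]))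
            (h0 _ _) (by positivity)
        _ = C ^ (n + 1) := by ring
  have hvert' : ∀ x u v : ℝ, c (horoPt x u) (horoPt x v) ≤ C * Real.exp (Real.log C / ρ * |u - v|) := by
    intro x u v
    have h1 := hvert ⌈|u - v| / ρ⌉₊ x u v (by
      rw [← div_le_iff₀ hρ]; exact Nat.le_ceil _)
    refine h1.trans ?_
    have h2 : (⌈|u - v| / ρ⌉₊ : ℝ) ≤ |u - v| / ρ + 1 :=
      (Nat.ceil_lt_add_one (by positivity)).le
    calc C ^ ⌈|u - v| / ρ⌉₊ = C ^ ((⌈|u - v| / ρ⌉₊ : ℕ) : ℝ) := (Real.rpow_natCast _ _).symm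
      _ ≤ C ^ (|u - v| / ρ + 1) := Real.rpow_le_rpow_of_exponent_le hC h2
      _ = C * Real.exp (Real.log C / ρ * |u - v|) := by
        rw [Real.rpow_add hC0, Real.rpow_one, Real.rpow_def_of_pos hC0, mul_comm]
        congr 2
        ring
  set κ := Real.log C / ρ with hκ
  have hκ0 : 0 ≤ κ := div_nonneg (Real.log_nonneg hC) hρ.le
  -- One factor `C` comes from the horizontal step and one from rounding up the number of steps of
  -- each vertical segment. The factor `3 / ρ ^ 2` comes from comparing `exp (2 U - u)` with `2
  -- cosh`.
  refine ⟨C ^ 3 * (3 / ρ ^ 2) ^ κ, κ, by positivity, hκ0, fun z => ?_⟩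
  obtain ⟨x, u, rfl⟩ := exists_horoPt z
  have hI : UpperHalfPlane.I = horoPt 0 0 := UpperHalfPlane.ext_re_im rfl (by
    change (1 : ℝ) = Real.exp 0
    rw [Real.exp_zero])
  have hexpu := Real.exp_pos u
  -- The three summands ensure `0 ≤ U`, a horizontal step of length at most `ρ`, and `u ≤ U`.
  set U := Real.log (1 + |x| / ρ + Real.exp u) with hU
  have hpos : 0 < 1 + |x| / ρ + Real.exp u := by positivity
  have hexpU : Real.exp U = 1 + |x| / ρ + Real.exp u := Real.exp_log hpos
  have hxρ : 0 ≤ |x| / ρ := by positivity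
  have hU0 : 0 ≤ U := Real.log_nonneg (by linarith)
  have hUu : u ≤ U := by
    rw [← Real.exp_le_exp, hexpU]; linarith
  have hhor : c (horoPt 0 U) (horoPt x U) ≤ C := by
    refine hnear _ _ ((dist_horoPt_horizontal _ _ _).trans ?_)
    rw [zero_sub, abs_neg, div_le_iff₀ (Real.exp_pos U), hexpU, ← div_le_iff₀' hρ]
    linarith
  have hcosh : 2 * Real.cosh (dist UpperHalfPlane.I (horoPt x u)) =
      (1 + x ^ 2 + Real.exp u ^ 2) / Real.exp u := by
    rw [UpperHalfPlane.cosh_dist']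
    change 2 * (((0 - x) ^ 2 + 1 ^ 2 + Real.exp u ^ 2) / (2 * 1 * Real.exp u)) = _
    field_simp
    ring
  have hbig : Real.exp (2 * U - u) ≤
      3 / ρ ^ 2 * (2 * Real.cosh (dist UpperHalfPlane.I (horoPt x u))) := by
    have e1 : Real.exp (2 * U - u) = (1 + |x| / ρ + Real.exp u) ^ 2 / Real.exp u := by
      rw [Real.exp_sub, two_mul, Real.exp_add, hexpU]; ring
    rw [e1, hcosh, ← mul_div_assoc]
    gcongr
    have e2 : (1 + |x| / ρ + Real.exp u) ^ 2 ≤ 3 * (1 + (|x| / ρ) ^ 2 + Real.exp u ^ 2) := by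
      nlinarith [sq_nonneg (1 - |x| / ρ), sq_nonneg (1 - Real.exp u), sq_nonneg (|x| / ρ - Real.exp u)]
    refine e2.trans ?_
    rw [div_mul_eq_mul_div, le_div_iff₀ (by positivity), div_pow, sq_abs]
    have hρ2 : ρ ^ 2 ≤ 1 := by nlinarith
    have e3 : x ^ 2 / ρ ^ 2 * ρ ^ 2 = x ^ 2 := by field_simp
    nlinarith [sq_nonneg (Real.exp u)]
  calc c UpperHalfPlane.I (horoPt x u)
      ≤ c (horoPt 0 0) (horoPt 0 U) * (c (horoPt 0 U) (horoPt x U) * c (horoPt x U) (horoPt x u)) := by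
        rw [hI]
        exact (hmul _ (horoPt 0 U) _).trans (mul_le_mul_of_nonneg_left (hmul _ _ _) (h0 _ _))
    _ ≤ (C * Real.exp (κ * U)) * (C * (C * Real.exp (κ * (U - u)))) := by
        have a1 := hvert' 0 0 U
        have a2 := hvert' x U u
        rw [zero_sub, abs_neg, abs_of_nonneg hU0] at a1
        rw [abs_of_nonneg (by linarith)] at a2
        have := h0 (horoPt 0 U) (horoPt x U)
        have := h0 (horoPt x U) (horoPt x u)
        gcongr
    _ = C ^ 3 * (Real.exp (2 * U - u)) ^ κ := by
        rw [← Real.exp_mul]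
        have : (2 * U - u) * κ = κ * U + κ * (U - u) := by ring
        rw [this, Real.exp_add]; ring
    _ ≤ C ^ 3 * (3 / ρ ^ 2 * (2 * Real.cosh (dist UpperHalfPlane.I (horoPt x u)))) ^ κ := by
        gcongr
    _ = _ := by
        rw [Real.mul_rpow (by positivity) (by positivity)]; ring

/-- Choose `a z` moving `z` into `F` and apply `chain_bound` to `‖χ(a z (a w)⁻¹)‖`. For `z = γ I`
the element `a z γ (a I)⁻¹` maps one point of `F` to another point of `F`, so it is bounded too, and
`γ` is a product of these elements and of `a I` and its inverse. -/
lemma exists_mu_bound (hΓ : IsLattice Γ) (hΓ' : TorsionFree Γ) {χ : Γ →* (V →L[ℂ] V)}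
    (hχ : UnitaryAtCusps χ) :
    ∃ M κ : ℝ, 0 < M ∧ 0 ≤ κ ∧ ∀ γ : lift Γ, ‖liftRep χ γ‖ ≤ M * (msq (γ : SL(2, ℝ))) ^ κ := by
  obtain ⟨F, ρ, C, hρ, hρ', hC, hcover, hbound⟩ := exists_local_bound hΓ hΓ' hχ
  choose a ha using hcover
  have hone : ‖liftRep χ 1‖ ≤ 1 := by
    rw [map_one]; exact ContinuousLinearMap.norm_id_le
  obtain ⟨M, κ, hM, hκ, h⟩ := chain_bound (c := fun z w => ‖liftRep χ (a z * (a w)⁻¹)‖) hρ hρ' hC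
    (fun _ _ => norm_nonneg _) (fun z => by simpa using hone)
    (fun z p w => by
      have := norm_map_mul_le (liftRep χ) (a z * (a p)⁻¹) (a p * (a w)⁻¹)
      rwa [show a z * (a p)⁻¹ * (a p * (a w)⁻¹) = a z * (a w)⁻¹ by group] at this)
    (fun z w hzw => hbound _ (ha z) _ (ha w) _ (by
      rw [mul_smul, inv_smul_smul]
      exact ((dist_smul (a z : SL(2, ℝ)) z w).trans_le hzw)))
  refine ⟨(‖liftRep χ (a UpperHalfPlane.I)⁻¹‖ + 1) * M * C * (‖liftRep χ (a UpperHalfPlane.I)‖ + 1), κ,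
    by positivity, hκ, fun γ => ?_⟩
  set z : ℍ := γ • UpperHalfPlane.I with hz
  have h1 := h z
  have hmsq : msq (γ : SL(2, ℝ)) = 2 * Real.cosh (dist UpperHalfPlane.I z) := msq_eq_cosh _
  rw [← hmsq] at h1
  have h2 : ‖liftRep χ (a z * γ * (a UpperHalfPlane.I)⁻¹)‖ ≤ C := by
    refine hbound _ (ha z) _ (ha UpperHalfPlane.I) _ ?_
    rw [mul_smul, inv_smul_smul, mul_smul, ← hz, dist_self]
    exact hρ.le
  have e : γ = (a UpperHalfPlane.I)⁻¹ * (a UpperHalfPlane.I * (a z)⁻¹) *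
    (a z * γ * (a UpperHalfPlane.I)⁻¹) * a UpperHalfPlane.I := by group
  have hm0 : 0 ≤ msq (γ : SL(2, ℝ)) := msq_nonneg _
  calc ‖liftRep χ γ‖ = ‖liftRep χ ((a UpperHalfPlane.I)⁻¹ * (a UpperHalfPlane.I * (a z)⁻¹) *
        (a z * γ * (a UpperHalfPlane.I)⁻¹) * a UpperHalfPlane.I)‖ := by rw [← e]
    _ ≤ ‖liftRep χ (a UpperHalfPlane.I)⁻¹‖ * ‖liftRep χ (a UpperHalfPlane.I * (a z)⁻¹)‖ *
        ‖liftRep χ (a z * γ * (a UpperHalfPlane.I)⁻¹)‖ * ‖liftRep χ (a UpperHalfPlane.I)‖ := by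
        refine (norm_map_mul_le _ _ _).trans ?_
        gcongr
        refine (norm_map_mul_le _ _ _).trans ?_
        gcongr
        exact norm_map_mul_le _ _ _
    _ ≤ (‖liftRep χ (a UpperHalfPlane.I)⁻¹‖ + 1) * (M * msq (γ : SL(2, ℝ)) ^ κ) * C *
        (‖liftRep χ (a UpperHalfPlane.I)‖ + 1) := by
        gcongr <;> linarith
    _ = _ := by ring

lemma two_le_msq (A : SL(2, ℝ)) : 2 ≤ msq A := by
  rw [msq_eq_cosh]; linarith [Real.one_le_cosh (dist UpperHalfPlane.I (A • UpperHalfPlane.I))]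

lemma cosh_add_le {x y : ℝ} : Real.cosh (x + y) ≤ 2 * Real.cosh x * Real.cosh y := by
  have h := Real.cosh_sub x y
  have h1 := Real.cosh_pos (x - y)
  rw [Real.cosh_add]; linarith

lemma exists_isGrowthExponent (hΓ : IsLattice Γ) (hΓ' : TorsionFree Γ) {χ : Γ →* (V →L[ℂ] V)}
    (hχ : UnitaryAtCusps χ) : ∃ σ₀ : ℝ, IsGrowthExponent χ σ₀ := by
  obtain ⟨M, κ, hM, hκ, h⟩ := exists_mu_bound hΓ hΓ' hχ
  have hbound : ∀ γ : lift Γ, ‖liftRep χ γ‖ ≤ M * (msq (γ : SL(2, ℝ))) ^ (κ + 1) := by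
    intro γ
    refine (h γ).trans ?_
    gcongr
    · linarith [two_le_msq (γ : SL(2, ℝ))]
    · linarith
  -- Since `msq ≥ 2`, the exponent may be raised from `κ` to `κ + 1`; this makes `σ₀ > 1` even for
  -- `κ = 0`.
  refine ⟨κ + 2, by linarith, ⟨M, hM, fun A hA => ?_⟩, ?_⟩
  · rw [show κ + 2 - 1 = κ + 1 by ring]
    exact hbound ⟨A, hA⟩
  -- The triangle inequality through `z` and `γ w` together with `cosh (x + y) ≤ 2 cosh x cosh y`
  -- turns the bound in `msq` into one in `u(z, γ w)`.
  · refine ⟨fun p => M * (4 * Real.cosh (dist UpperHalfPlane.I p.1 + dist p.2 UpperHalfPlane.I))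
      ^ (κ + 1), ?_, ?_, ?_⟩
    · have hc : Continuous fun p : ℍ × ℍ =>
          4 * Real.cosh (dist UpperHalfPlane.I p.1 + dist p.2 UpperHalfPlane.I) := by fun_prop
      exact continuous_const.mul (hc.rpow_const fun p => Or.inr (by linarith))
    · intro p
      have := Real.cosh_pos (dist UpperHalfPlane.I p.1 + dist p.2 UpperHalfPlane.I)
      positivity
    · rintro ⟨g, hg⟩ z w
      obtain ⟨A, rfl⟩ := QuotientGroup.mk_surjective g
      have h1 := hbound ⟨A, hg⟩
      change ‖χ ⟨A, hg⟩‖ ≤ M * msq A ^ (κ + 1) at h1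
      refine h1.trans ?_
      rw [show κ + 2 - 1 = κ + 1 by ring, mul_assoc]
      have hcp := Real.cosh_pos (dist UpperHalfPlane.I z + dist w UpperHalfPlane.I)
      have hu := uDist_nonneg z ((⟨(A : PSL(2, ℝ)), hg⟩ : Γ) • w)
      rw [← Real.mul_rpow (by positivity) (by linarith)]
      gcongr
      · linarith [two_le_msq A]
      · have hw : (⟨(A : PSL(2, ℝ)), hg⟩ : Γ) • w = A • w := by
          rw [Subgroup.smul_def, ← smul_mk_uhp]
        rw [hw] at hu ⊢
        have hu2 : uDist z (A • w) = 2 * Real.cosh (dist z (A • w)) - 2 := uDist_eq _ _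
        change msq A ≤ _
        rw [msq_eq_cosh]
        have htri : dist UpperHalfPlane.I (A • UpperHalfPlane.I) ≤
            (dist UpperHalfPlane.I z + dist w UpperHalfPlane.I) + dist z (A • w) := by
          have := dist_triangle4 UpperHalfPlane.I z (A • w) (A • UpperHalfPlane.I)
          rw [dist_smul] at this
          linarith
        have h2 : Real.cosh (dist UpperHalfPlane.I (A • UpperHalfPlane.I)) ≤
            Real.cosh ((dist UpperHalfPlane.I z + dist w UpperHalfPlane.I) + dist z (A • w)) := by
          rw [Real.cosh_le_cosh, abs_of_nonneg dist_nonneg, abs_of_nonneg (by positivity)]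
          exact htri
        have h3 := h2.trans cosh_add_le
        nlinarith

end

section

/-! ### Bottom rows -/

lemma coe_translSL (x : ℝ) : (translSL x : Matrix (Fin 2) (Fin 2) ℝ) = !![1, x; 0, 1] := rfl

lemma coe_translSL_mul_mul (x y : ℝ) (A : SL(2, ℝ)) :
    ((translSL x * A * translSL y : SL(2, ℝ)) : Matrix (Fin 2) (Fin 2) ℝ) =
      !![A 0 0 + x * A 1 0, (A 0 0 + x * A 1 0) * y + (A 0 1 + x * A 1 1);
        A 1 0, A 1 0 * y + A 1 1] := by
  rw [Matrix.SpecialLinearGroup.coe_mul, Matrix.SpecialLinearGroup.coe_mul, coe_translSL,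
    coe_translSL, Matrix.eta_fin_two (A : Matrix (Fin 2) (Fin 2) ℝ), Matrix.mul_fin_two,
    Matrix.mul_fin_two]
  simp

lemma translSL_add (x y : ℝ) : translSL x * translSL y = translSL (x + y) := by
  ext i j; fin_cases i <;> fin_cases j <;> simp [coe_translSL, Matrix.mul_apply, Fin.sum_univ_two, add_comm]

lemma transl_add (x y : ℝ) : transl x * transl y = transl (x + y) := by
  unfold transl; rw [← translSL_add]; rfl

lemma transl_zero : transl 0 = 1 := by
  have : translSL 0 = 1 := by ext i j; fin_cases i <;> fin_cases j <;> simp [translSL]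
  unfold transl; rw [this]; rfl

lemma transl_neg (x : ℝ) : transl (-x) = (transl x)⁻¹ := by
  rw [eq_inv_iff_mul_eq_one, transl_add, neg_add_cancel, transl_zero]

lemma transl_zpow (k : ℤ) : (transl 1) ^ k = transl k := by
  induction k using Int.induction_on with
  | zero => simp [transl_zero]
  | succ n ih => rw [zpow_add_one, ih, transl_add]; push_cast; rfl
  | pred n ih => rw [zpow_sub_one, ih, ← transl_neg, transl_add]; push_cast; rfl

lemma HasBottomRow.mul_transl {g : PSL(2, ℝ)} {c d : ℝ} (h : HasBottomRow g c d) (x : ℝ) :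
    HasBottomRow (g * transl x) c (d + c * x) := by
  obtain ⟨A, rfl, rfl, rfl⟩ := h
  refine ⟨A * translSL x, rfl, ?_, ?_⟩ <;>
    simp [coe_translSL, Matrix.mul_apply, Fin.sum_univ_two]
  ring

lemma HasBottomRow.transl_mul {g : PSL(2, ℝ)} {c d : ℝ} (h : HasBottomRow g c d) (x : ℝ) :
    HasBottomRow (transl x * g) c d := by
  obtain ⟨A, rfl, rfl, rfl⟩ := h
  refine ⟨translSL x * A, rfl, ?_, ?_⟩ <;>
    simp [coe_translSL, Matrix.mul_apply, Fin.sum_univ_two]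

lemma HasBottomRow.unique {g : PSL(2, ℝ)} {c d c' d' : ℝ} (h : HasBottomRow g c d)
    (h' : HasBottomRow g c' d') : (c' = c ∧ d' = d) ∨ (c' = -c ∧ d' = -d) := by
  obtain ⟨A, rfl, rfl, rfl⟩ := h
  obtain ⟨B, hB, rfl, rfl⟩ := h'
  rcases mk_eq_mk_iff.1 hB.symm with rfl | rfl
  · exact Or.inl ⟨rfl, rfl⟩
  · exact Or.inr ⟨rfl, rfl⟩

lemma HasBottomRow.neg {g : PSL(2, ℝ)} {c d : ℝ} (h : HasBottomRow g c d) :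
    HasBottomRow g (-c) (-d) := by
  obtain ⟨A, rfl, rfl, rfl⟩ := h
  exact ⟨-A, mk_eq_mk_iff.2 (Or.inr (by simp)), rfl, rfl⟩

lemma HasBottomRow.smul_infty {g : PSL(2, ℝ)} {d : ℝ} (h : HasBottomRow g 0 d) :
    g • (OnePoint.infty : OnePoint ℝ) = OnePoint.infty := by
  obtain ⟨A, rfl, h0, -⟩ := h
  rw [smul_mk_boundary, OnePoint.smul_infty_eq_self_iff]
  exact h0

lemma hasBottomRow_zero_of_smul_infty {g : PSL(2, ℝ)}
    (h : g • (OnePoint.infty : OnePoint ℝ) = OnePoint.infty) : ∃ d, HasBottomRow g 0 d := by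
  obtain ⟨A, rfl⟩ := QuotientGroup.mk_surjective g
  rw [smul_mk_boundary, OnePoint.smul_infty_eq_self_iff] at h
  exact ⟨A 1 1, A, rfl, h, rfl⟩

/-- The minor of two bottom rows is itself a lower left entry. Its vanishing detects equal cosets,
and its size gives the separation of fractions. -/
lemma HasBottomRow.mul_inv {g g' : PSL(2, ℝ)} {c d c' d' : ℝ} (h : HasBottomRow g c d)
    (h' : HasBottomRow g' c' d') : ∃ e, HasBottomRow (g' * g⁻¹) (c' * d - d' * c) e := by
  obtain ⟨A, rfl, rfl, rfl⟩ := h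
  obtain ⟨B, rfl, rfl, rfl⟩ := h'
  refine ⟨_, B * A⁻¹, rfl, ?_, rfl⟩
  simp [Matrix.mul_apply, Fin.sum_univ_two, Matrix.SpecialLinearGroup.coe_inv,
    Matrix.adjugate_fin_two]
  ring

lemma HasBottomRow.im_smul {g : PSL(2, ℝ)} {c d : ℝ} (h : HasBottomRow g c d) (z : ℍ) :
    (g • z).im = z.im / ((c * z.re + d) ^ 2 + (c * z.im) ^ 2) := by
  obtain ⟨A, rfl, rfl, rfl⟩ := h
  rw [smul_mk_uhp, im_smul_SL]

variable {Γ : Subgroup PSL(2, ℝ)}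

lemma ScaledCusp.mem_stab_iff (a : ScaledCusp Γ) {γ : Γ} :
    γ ∈ a.stab ↔ ∃ k : ℤ, a.σ⁻¹ * (γ : PSL(2, ℝ)) * a.σ = transl k := by
  rw [← a.conj_stabilizer]
  have : a.σ * (a.σ⁻¹ * (γ : PSL(2, ℝ)) * a.σ) * a.σ⁻¹ = γ := by group
  rw [this]
  exact ⟨fun h => ⟨γ.2, h⟩, fun h => h.2⟩

lemma ScaledCusp.mem_stab_of_row (a : ScaledCusp Γ) {γ : Γ} {d : ℝ}
    (h : HasBottomRow (a.σ⁻¹ * γ * a.σ) 0 d) : γ ∈ a.stab := by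
  have h1 := h.smul_infty
  rw [mul_smul, mul_smul, a.smul_infty, inv_smul_eq_iff, a.smul_infty] at h1
  exact h1

lemma ScaledCusp.coe_gen_zpow (a : ScaledCusp Γ) (k : ℤ) :
    ((a.gen ^ k : Γ) : PSL(2, ℝ)) = a.σ * transl k * a.σ⁻¹ := by
  rw [← transl_zpow, ← conj_zpow]; rfl

lemma ScaledCusp.gen_zpow_mem_stab (a : ScaledCusp Γ) (k : ℤ) : a.gen ^ k ∈ a.stab := by
  rw [a.mem_stab_iff, a.coe_gen_zpow]
  exact ⟨k, by group⟩

lemma ScaledCusp.mem_stab_iff_gen (a : ScaledCusp Γ) {γ : Γ} :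
    γ ∈ a.stab ↔ ∃ k : ℤ, γ = a.gen ^ k := by
  constructor
  · intro h
    obtain ⟨k, hk⟩ := a.mem_stab_iff.1 h
    refine ⟨k, Subtype.ext ?_⟩
    rw [a.coe_gen_zpow, ← hk]; group
  · rintro ⟨k, rfl⟩; exact a.gen_zpow_mem_stab k

lemma ScaledCusp.mul_inv_mem_stab_of_row {a b : ScaledCusp Γ} {γ γ' : Γ} {c d c' d' : ℝ}
    (h : HasBottomRow (a.σ⁻¹ * γ * b.σ) c d) (h' : HasBottomRow (a.σ⁻¹ * γ' * b.σ) c' d')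
    (h0 : c' * d - d' * c = 0) : γ' * γ⁻¹ ∈ a.stab := by
  obtain ⟨e, he⟩ := h.mul_inv h'
  rw [h0] at he
  refine a.mem_stab_of_row (d := e) ?_
  convert he using 1
  push_cast
  group

lemma ScaledCusp.row_of_mul_stab {a b : ScaledCusp Γ} {γ τ : Γ} {c d : ℝ} (hτ : τ ∈ a.stab)
    (h : HasBottomRow (a.σ⁻¹ * γ * b.σ) c d) :
    HasBottomRow (a.σ⁻¹ * (τ * γ : Γ) * b.σ) c d := by
  obtain ⟨k, hk⟩ := a.mem_stab_iff.1 hτ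
  convert h.transl_mul k using 1
  rw [← hk]; push_cast; group

lemma ScaledCusp.row_of_mul_gen {a b : ScaledCusp Γ} {γ : Γ} {c d : ℝ} (k : ℤ)
    (h : HasBottomRow (a.σ⁻¹ * γ * b.σ) c d) :
    HasBottomRow (a.σ⁻¹ * (γ * b.gen ^ k : Γ) * b.σ) c (d + c * k) := by
  convert h.mul_transl k using 1
  rw [Subgroup.coe_mul, b.coe_gen_zpow]
  group

/-- Nonzero lower left entries of elements of `σ⁻¹ Γ σ` are bounded away from zero. -/
lemma ScaledCusp.exists_lower_left_bound (hd : DiscreteTopology Γ) (a : ScaledCusp Γ) :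
    ∃ κ : ℝ, 0 < κ ∧ ∀ (γ : Γ) (c d : ℝ), HasBottomRow (a.σ⁻¹ * γ * a.σ) c d → c ≠ 0 → κ ≤ |c| := by
  obtain ⟨s, hs⟩ := QuotientGroup.mk_surjective a.σ
  set H : Set SL(2, ℝ) := {A | (s * A * s⁻¹) ∈ lift Γ} with hH
  have hfin : {A ∈ H | msq A ≤ 18}.Finite := by
    refine ((finite_of_displ_le (discreteTopology_lift hd)
      (isCompact_singleton (x := s • UpperHalfPlane.I)) 16).preimage
      (f := fun A => s * A * s⁻¹) ?_).subset ?_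
    · intro A _ B _ h; simpa using h
    · rintro A ⟨hA, hA'⟩
      refine ⟨hA, _, rfl, ?_⟩
      rw [displ_conj, displ_I]; linarith
  have hT : ∀ (A : SL(2, ℝ)), A ∈ H → ∀ k l : ℤ, translSL k * A * translSL l ∈ H := by
    intro A hA k l
    have hk : ∀ k : ℤ, s * translSL k * s⁻¹ ∈ lift Γ := by
      intro k
      have := ((a.conj_stabilizer (transl k)).2 ⟨k, rfl⟩).1
      rw [← hs] at this
      exact this
    have := (lift Γ).mul_mem ((lift Γ).mul_mem (hk k) hA) (hk l)
    have e : s * translSL k * s⁻¹ * (s * A * s⁻¹) * (s * translSL l * s⁻¹) =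
      s * (translSL k * A * translSL l) * s⁻¹ := by group
    rw [e] at this
    exact this
  have hκ : ∃ κ : ℝ, 0 < κ ∧ κ ≤ 1 ∧ ∀ A ∈ H, msq A ≤ 18 → 0 < A 1 0 → κ ≤ A 1 0 := by
    set S := {A ∈ {A ∈ H | msq A ≤ 18} | 0 < A 1 0} with hS
    have hf : S.Finite := hfin.subset fun A h => h.1
    rcases S.eq_empty_or_nonempty with h | h
    · refine ⟨1, one_pos, le_rfl, fun A h1 h2 h3 => ?_⟩
      have : A ∈ S := ⟨⟨h1, h2⟩, h3⟩
      rw [h] at this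
      exact absurd this (Set.notMem_empty _)
    · obtain ⟨A₀, h1, h2⟩ := hf.exists_minimalFor (fun A => A 1 0) _ h
      refine ⟨min 1 (A₀ 1 0), lt_min one_pos h1.2, min_le_left _ _, fun A h3 h4 h5 => ?_⟩
      refine (min_le_right _ _).trans ?_
      rcases le_total (A₀ 1 0) (A 1 0) with h6 | h6
      · exact h6
      · exact h2 ⟨⟨h3, h4⟩, h5⟩ h6
  obtain ⟨κ, hκ0, hκ1, hκ⟩ := hκ
  have main : ∀ A ∈ H, 0 < A 1 0 → κ ≤ A 1 0 := by
    intro A hA hc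
    by_cases hc1 : 1 ≤ A 1 0
    · exact hκ1.trans hc1
    push Not at hc1
    -- Translations bring both diagonal entries into `[1, 1 + c)` with `c < 1`. Starting the
    -- interval at 1 makes the numerator of `B 0 1 = (B 0 0 * B 1 1 - 1) / c` lie between 0 and `3
    -- c`, so `msq B ≤ 4 + 9 + 1 + 4 = 18`.
    obtain ⟨k, hk, -⟩ := existsUnique_add_zsmul_mem_Ico hc (A 0 0) 1
    obtain ⟨l, hl, -⟩ := existsUnique_add_zsmul_mem_Ico hc (A 1 1) 1
    simp only [zsmul_eq_mul, Set.mem_Ico] at hk hl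
    set B := translSL k * A * translSL l with hB
    have e10 : B 1 0 = A 1 0 := by
      rw [hB, coe_translSL_mul_mul]; simp
    have e00 : B 0 0 = A 0 0 + k * A 1 0 := by
      rw [hB, coe_translSL_mul_mul]; simp
    have e11 : B 1 1 = A 1 1 + l * A 1 0 := by
      rw [hB, coe_translSL_mul_mul]; simp; ring
    have hdet := det_eq_one' B
    rw [← e00] at hk
    rw [← e11] at hl
    rw [e10] at hdet
    have hb : B 0 1 ≤ 3 ∧ 0 ≤ B 0 1 := by
      constructor
      · by_contra h
        nlinarith
      · by_contra h
        nlinarith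
    have := hκ B (hT A hA k l) ?_ (by rwa [e10])
    · rwa [e10] at this
    · unfold msq
      rw [e10]
      nlinarith
  refine ⟨κ, hκ0, fun γ c d ⟨A, hA, hc, hd'⟩ hc0 => ?_⟩
  have hmem : ∀ B : SL(2, ℝ), (B : PSL(2, ℝ)) = a.σ⁻¹ * γ * a.σ → B ∈ H := by
    intro B hB
    change ((s * B * s⁻¹ : SL(2, ℝ)) : PSL(2, ℝ)) ∈ Γ
    have : ((s * B * s⁻¹ : SL(2, ℝ)) : PSL(2, ℝ)) = (s : PSL(2, ℝ)) * B * (s : PSL(2, ℝ))⁻¹ := rfl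
    rw [this, hB, hs]
    have e : a.σ * (a.σ⁻¹ * (γ : PSL(2, ℝ)) * a.σ) * a.σ⁻¹ = γ := by group
    rw [e]; exact γ.2
  rcases lt_or_gt_of_ne hc0 with h | h
  · rw [abs_of_neg h]
    have := main (-A) (hmem _ (by rw [← hA, mk_eq_mk_iff]; simp)) (by simp [hc, h])
    simpa [hc] using this
  · rw [abs_of_pos h]
    have := main A (hmem _ hA) (by rwa [hc])
    rwa [hc] at this

/-- Distinct bottom rows are separated. -/
lemma ScaledCusp.exists_row_separation (hd : DiscreteTopology Γ) (a b : ScaledCusp Γ) :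
    ∃ κ : ℝ, 0 < κ ∧ ∀ (γ γ' : Γ) (c d c' d' : ℝ), 0 < c → 0 < c' →
      HasBottomRow (a.σ⁻¹ * γ * b.σ) c d → HasBottomRow (a.σ⁻¹ * γ' * b.σ) c' d' →
      (c = c' ∧ d = d') ∨ κ ≤ |c' * d - d' * c| := by
  obtain ⟨κ, hκ, h⟩ := a.exists_lower_left_bound hd
  refine ⟨κ, hκ, fun γ γ' c d c' d' hc hc' h1 h2 => ?_⟩
  by_cases h0 : c' * d - d' * c = 0
  · left
    have h3 := mul_inv_mem_stab_of_row h1 h2 h0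
    have h4 := row_of_mul_stab h3 h1
    rw [inv_mul_cancel_right] at h4
    rcases h4.unique h2 with ⟨rfl, rfl⟩ | ⟨rfl, rfl⟩
    · exact ⟨rfl, rfl⟩
    · linarith
  · right
    obtain ⟨e, he⟩ := h1.mul_inv h2
    refine h (γ' * γ⁻¹) _ e ?_ h0
    convert he using 1
    push_cast
    group

/-- The rows `(c, d)` and `(c, d + c)` both occur, and their minor is `-c ^ 2`. -/
lemma ScaledCusp.exists_moduli_bound (hd : DiscreteTopology Γ) (a b : ScaledCusp Γ) :
    ∃ c₀ : ℝ, 0 < c₀ ∧ ∀ (γ : Γ) (c d : ℝ), 0 < c →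
      HasBottomRow (a.σ⁻¹ * γ * b.σ) c d → c₀ ≤ c := by
  obtain ⟨κ, hκ, h⟩ := exists_row_separation hd a b
  refine ⟨Real.sqrt κ, Real.sqrt_pos.2 hκ, fun γ c d hc h1 => ?_⟩
  have h2 := row_of_mul_gen 1 h1
  rcases h γ _ c d c _ hc hc h1 h2 with ⟨-, h3⟩ | h3
  · push_cast at h3; linarith
  · rw [Real.sqrt_le_left hc.le]
    have : c * d - (d + c * (1 : ℤ)) * c = -c ^ 2 := by push_cast; ring
    rwa [this, abs_neg, abs_of_pos (by positivity)] at h3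

/-! ### Counting -/

section Counting

variable {ι : Type*} {c x : ι → ℝ} {κ : ℝ}

/-- Pigeonhole: points with `c i ≤ X` are at least `κ / X ^ 2` apart, so they fall into different
cells of that length. -/
lemma card_le_of_separated (hc : ∀ i, 0 < c i) (hx : ∀ i, 0 ≤ x i ∧ x i < 1) (hκ : 0 < κ)
    (hsep : ∀ i j, i ≠ j → κ ≤ c i * c j * |x i - x j|) {X : ℝ} (T : Finset ι)
    (hT : ∀ i ∈ T, c i ≤ X) : (T.card : ℝ) ≤ X ^ 2 / κ + 1 := by
  rcases T.eq_empty_or_nonempty with rfl | ⟨i₀, hi₀⟩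
  · simp; positivity
  have hX : 0 < X := (hc i₀).trans_le (hT i₀ hi₀)
  have hXκ : 0 < X ^ 2 / κ := by positivity
  have hcard : T.card ≤ (Finset.range (⌊X ^ 2 / κ⌋₊ + 1)).card := by
    refine Finset.card_le_card_of_injOn (fun i => ⌊x i * (X ^ 2 / κ)⌋₊) ?_ ?_
    · intro i _
      rw [Finset.coe_range, Set.mem_Iio, Nat.lt_succ_iff]
      refine Nat.floor_le_floor ?_
      have := (hx i).2
      nlinarith
    · intro i hi j hj hij
      by_contra hne
      have h1 := hsep i j hne
      have hi1 := Nat.floor_le (mul_nonneg (hx i).1 hXκ.le)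
      have hi2 := Nat.lt_floor_add_one (x i * (X ^ 2 / κ))
      have hj1 := Nat.floor_le (mul_nonneg (hx j).1 hXκ.le)
      have hj2 := Nat.lt_floor_add_one (x j * (X ^ 2 / κ))
      simp only at hij
      rw [hij] at hi1 hi2
      have h2 : |x i - x j| * (X ^ 2 / κ) < 1 := by
        rw [← abs_of_pos hXκ, ← abs_mul, abs_lt, sub_mul]
        constructor <;> linarith
      have h3 : c i * c j * |x i - x j| ≤ X ^ 2 * |x i - x j| := by
        have := hT i hi
        have := hT j hj
        have := hc i
        have := hc j
        rw [pow_two]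
        gcongr
      rw [mul_div_assoc', div_lt_one hκ] at h2
      linarith
  rw [Finset.card_range] at hcard
  have h4 := Nat.floor_le hXκ.le
  have h5 : (T.card : ℝ) ≤ ⌊X ^ 2 / κ⌋₊ + 1 := by exact_mod_cast hcard
  linarith

lemma finite_of_separated (hc : ∀ i, 0 < c i) (hx : ∀ i, 0 ≤ x i ∧ x i < 1) (hκ : 0 < κ)
    (hsep : ∀ i j, i ≠ j → κ ≤ c i * c j * |x i - x j|) (X : ℝ) : {i | c i ≤ X}.Finite := by
  by_contra hinf
  obtain ⟨N, hN⟩ := exists_nat_gt (X ^ 2 / κ + 1)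
  obtain ⟨T, hT, hTN⟩ := Set.Infinite.exists_subset_card_eq hinf N
  have := card_le_of_separated hc hx hκ hsep T (fun i hi => hT hi)
  rw [hTN] at this
  linarith

/-- Dyadic decomposition: the block `c ≈ c₀ 2 ^ m` has `O(4 ^ m)` members of size `O(2 ^ (-2 τ m))`,
which is geometric for `τ > 1`. -/
lemma summable_of_separated (hκ : 0 < κ) {c₀ : ℝ} (hc₀ : 0 < c₀) (hc : ∀ i, c₀ ≤ c i)
    (hx : ∀ i, 0 ≤ x i ∧ x i < 1)
    (hsep : ∀ i j, i ≠ j → κ ≤ c i * c j * |x i - x j|) {τ : ℝ} (hτ : 1 < τ) :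
    Summable fun i => c i ^ (-2 * τ) := by
  classical
  have hcpos : ∀ i, 0 < c i := fun i => hc₀.trans_le (hc i)
  have hn : ∀ i, ∃ n : ℕ, (2 : ℝ) ^ n ≤ c i / c₀ ∧ c i / c₀ < 2 ^ (n + 1) := fun i =>
    exists_nat_pow_near ((one_le_div hc₀).2 (hc i)) one_lt_two
  choose n hn1 hn2 using hn
  set f : ℕ → ℝ := fun m => ((c₀ * 2 ^ (m + 1)) ^ 2 / κ + 1) * (c₀ * 2 ^ m) ^ (-2 * τ) with hf
  have hfnn : ∀ m, 0 ≤ f m := fun m => by simp only [hf]; positivity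
  have hfsum : Summable f := by
    have e : ∀ m, f m = (4 * c₀ ^ 2 / κ * c₀ ^ (-2 * τ)) * ((2 : ℝ) ^ (2 - 2 * τ)) ^ m +
        c₀ ^ (-2 * τ) * ((2 : ℝ) ^ (-2 * τ)) ^ m := by
      intro m
      simp only [hf]
      rw [Real.mul_rpow hc₀.le (by positivity)]
      have h1 : ((2 : ℝ) ^ m) ^ (-2 * τ) = ((2 : ℝ) ^ (-2 * τ)) ^ m := by
        rw [← Real.rpow_natCast, ← Real.rpow_mul (by norm_num), mul_comm, Real.rpow_mul (by norm_num),
          Real.rpow_natCast]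
      have h2 : ((2 : ℝ) ^ (2 - 2 * τ)) ^ m = (2 ^ m) ^ 2 * ((2 : ℝ) ^ (-2 * τ)) ^ m := by
        rw [show (2 : ℝ) - 2 * τ = 2 + -2 * τ by ring, Real.rpow_add (by norm_num), mul_pow]
        congr 1
        rw [← pow_mul, mul_comm m 2, pow_mul]
        norm_num
      rw [h1, h2, pow_succ]
      field_simp
      ring
    simp_rw [funext e]
    refine Summable.add (Summable.mul_left _ (summable_geometric_of_lt_one (by positivity) ?_))
      (Summable.mul_left _ (summable_geometric_of_lt_one (by positivity) ?_))
    · exact Real.rpow_lt_one_of_one_lt_of_neg one_lt_two (by linarith)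
    · exact Real.rpow_lt_one_of_one_lt_of_neg one_lt_two (by linarith)
  refine summable_of_sum_le (c := ∑' m, f m) (fun i => by have := hcpos i; positivity) fun T => ?_
  rw [← Finset.sum_fiberwise_of_maps_to (g := n) (t := T.image n)
    (fun i hi => Finset.mem_image_of_mem n hi)]
  refine le_trans (Finset.sum_le_sum fun m _ => ?_) (hfsum.sum_le_tsum (T.image n) fun m _ => hfnn m)
  have hle : ∀ i ∈ T.filter (fun i => n i = m), c i ≤ c₀ * 2 ^ (m + 1) := by
    intro i hi
    have := hn2 i
    rw [(Finset.mem_filter.1 hi).2, div_lt_iff₀' hc₀] at this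
    exact this.le
  have hge : ∀ i ∈ T.filter (fun i => n i = m), c i ^ (-2 * τ) ≤ (c₀ * 2 ^ m) ^ (-2 * τ) := by
    intro i hi
    have := hn1 i
    rw [(Finset.mem_filter.1 hi).2, le_div_iff₀' hc₀] at this
    exact Real.rpow_le_rpow_of_nonpos (by positivity) this (by linarith)
  calc ∑ i ∈ T.filter (fun i => n i = m), c i ^ (-2 * τ)
      ≤ (T.filter (fun i => n i = m)).card • (c₀ * 2 ^ m) ^ (-2 * τ) :=
        Finset.sum_le_card_nsmul _ _ _ hge
    _ ≤ f m := by
        rw [nsmul_eq_mul]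
        simp only [hf]
        gcongr
        exact card_le_of_separated hcpos hx hκ hsep _ hle

end Counting

/-! ### Double coset representatives -/

variable {a b : ScaledCusp Γ}

lemma DoubleCosetReps.eq_of_mem (R : DoubleCosetReps a b) {c : ℝ} (hc : 0 < c) {d d' : ℝ}
    (hd : d ∈ R.D c) (hd' : d' ∈ R.D c) {k : ℤ} (h : d = d' + k * c) : d = d' := by
  obtain ⟨e, -, he⟩ := R.existsUnique c hc d (R.γ c d) (R.bottomRow c hc d hd)
  rw [he d ⟨hd, 0, by simp⟩, he d' ⟨hd', k, h⟩]

/-- The index set of pairs `(c, d)`. -/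
abbrev DoubleCosetReps.Idx (R : DoubleCosetReps a b) : Type := Σ c : moduli a b, R.D c

/-- Reducing `d` modulo `c` makes `d / c` its fractional part, and the minor of two rows is `c c'`
times the difference of the fractions. Equal rows would come from representatives congruent modulo
`c`. -/
lemma DoubleCosetReps.separated (hd : DiscreteTopology Γ) (R : DoubleCosetReps a b) :
    ∃ κ : ℝ, 0 < κ ∧ ∀ i j : R.Idx, i ≠ j →
      κ ≤ (i.1 : ℝ) * (j.1 : ℝ) * |Int.fract ((i.2 : ℝ) / i.1) - Int.fract ((j.2 : ℝ) / j.1)| := by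
  obtain ⟨κ, hκ, h⟩ := ScaledCusp.exists_row_separation hd a b
  refine ⟨κ, hκ, ?_⟩
  rintro ⟨⟨c, hc⟩, ⟨d, hd⟩⟩ ⟨⟨c', hc'⟩, ⟨d', hd'⟩⟩ hne
  change κ ≤ c * c' * |Int.fract (d / c) - Int.fract (d' / c')|
  have h1 := ScaledCusp.row_of_mul_gen (-⌊d / c⌋) (R.bottomRow c hc.1 d hd)
  have h2 := ScaledCusp.row_of_mul_gen (-⌊d' / c'⌋) (R.bottomRow c' hc'.1 d' hd')
  have hcp := hc.1
  have hcp' := hc'.1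
  rcases h _ _ _ _ _ _ hc.1 hc'.1 h1 h2 with ⟨rfl, h4⟩ | h3
  · exfalso
    apply hne
    have : d = d' := R.eq_of_mem hc.1 hd hd' (k := ⌊d / c⌋ - ⌊d' / c⌋) (by
      push_cast at h4 ⊢; linarith)
    subst this
    rfl
  · refine h3.trans (le_of_eq ?_)
    rw [← abs_of_pos (mul_pos hc.1 hc'.1), ← abs_mul]
    congr 1
    rw [Int.fract, Int.fract]
    push_cast
    field_simp
    ring

lemma DoubleCosetReps.finite_D (hd : DiscreteTopology Γ) (R : DoubleCosetReps a b) (c : ℝ)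
    (hc : 0 < c) : (R.D c).Finite := by
  by_cases hcm : c ∈ moduli a b
  · obtain ⟨κ, hκ, hsep⟩ := R.separated hd
    have h := finite_of_separated (fun i : R.Idx => i.1.2.1)
      (fun i => ⟨Int.fract_nonneg _, Int.fract_lt_one _⟩) hκ hsep c
    have h2 := h.preimage (f := fun d : R.D c => (⟨⟨c, hcm⟩, d⟩ : R.Idx)) (by
      intro d _ d' _ hdd
      simpa using hdd)
    have : Finite (R.D c) := by
      refine Set.finite_univ_iff.1 (h2.subset fun d _ => ?_)
      exact le_refl c
    exact Set.toFinite _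
  · have : R.D c = ∅ := by
      rw [Set.eq_empty_iff_forall_notMem]
      intro d hd
      exact hcm ⟨hc, _, d, R.bottomRow c hc d hd⟩
    rw [this]; exact Set.finite_empty

lemma DoubleCosetReps.summable_rpow (hd : DiscreteTopology Γ) (R : DoubleCosetReps a b) {τ : ℝ}
    (hτ : 1 < τ) : Summable fun i : R.Idx => (i.1 : ℝ) ^ (-2 * τ) := by
  obtain ⟨κ, hκ, hsep⟩ := R.separated hd
  obtain ⟨c₀, hc₀, h⟩ := ScaledCusp.exists_moduli_bound hd a b
  refine summable_of_separated hκ hc₀ (fun i => ?_)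
    (fun i => ⟨Int.fract_nonneg _, Int.fract_lt_one _⟩) hsep hτ
  obtain ⟨hc, γ, d, hγ⟩ := i.1.2
  exact h γ _ d hc hγ

end

section

variable {Γ : Subgroup PSL(2, ℝ)} {V : Type*} [NormedAddCommGroup V] [InnerProductSpace ℂ V]
  {a b : ScaledCusp Γ}

/-! ### Bounds on double cosets -/

lemma inner_map_stab {χ : Γ →* (V →L[ℂ] V)} (hχ : UnitaryAtCusps χ) {γ : Γ} (hγ : γ ∈ a.stab)
    (v w : V) : ⟪χ γ v, χ γ w⟫_ℂ = ⟪v, w⟫_ℂ :=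
  hχ a.pt a.isCusp γ hγ v w

lemma norm_map_stab_le {χ : Γ →* (V →L[ℂ] V)} (hχ : UnitaryAtCusps χ) {γ : Γ} (hγ : γ ∈ a.stab) :
    ‖χ γ‖ ≤ 1 :=
  norm_le_one_of_inner (inner_map_stab hχ hγ)

/-- Multiplying `γ` on both sides by stabilizer elements, on which `χ` is unitary, brings the
diagonal entries into `[0, c)`. Then all entries are `O(c)`, and the bound in `μ` applies. -/
lemma exists_norm_inv_le (hd : DiscreteTopology Γ) {χ : Γ →* (V →L[ℂ] V)} (hχ : UnitaryAtCusps χ)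
    {σ₀ : ℝ} (hσ₀ : IsGrowthExponent χ σ₀) (a b : ScaledCusp Γ) :
    ∃ C : ℝ, 0 ≤ C ∧ ∀ (γ : Γ) (c d : ℝ), 0 < c → HasBottomRow (a.σ⁻¹ * γ * b.σ) c d →
      ‖χ γ⁻¹‖ ≤ C * c ^ (2 * (σ₀ - 1)) := by
  obtain ⟨c₀, hc₀, hmod⟩ := ScaledCusp.exists_moduli_bound hd a b
  obtain ⟨M, hM, hbound⟩ := hσ₀.bound_mu
  have hσ := hσ₀.one_lt
  obtain ⟨s, hs⟩ := QuotientGroup.mk_surjective a.σ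
  obtain ⟨t, ht⟩ := QuotientGroup.mk_surjective b.σ
  set L := msq s * msq t * (3 + (1 + 1 / c₀ ^ 2) ^ 2) with hL
  have hL0 : 0 ≤ L := by
    have := msq_nonneg s
    have := msq_nonneg t
    positivity
  refine ⟨M * L ^ (σ₀ - 1), by positivity, fun γ c d hc hrow => ?_⟩
  have hcc := hmod γ c d hc hrow
  obtain ⟨A, hA, hAc, hAd⟩ := hrow
  obtain ⟨k, hk, -⟩ := existsUnique_add_zsmul_mem_Ico hc (A 0 0) 0
  obtain ⟨l, hl, -⟩ := existsUnique_add_zsmul_mem_Ico hc (A 1 1) 0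
  simp only [zsmul_eq_mul, Set.mem_Ico, zero_add] at hk hl
  set B := translSL k * A * translSL l with hB
  have e10 : B 1 0 = c := by rw [hB, coe_translSL_mul_mul]; simpa using hAc
  have e00 : B 0 0 = A 0 0 + k * c := by rw [hB, coe_translSL_mul_mul, ← hAc]; simp
  have e11 : B 1 1 = A 1 1 + l * c := by rw [hB, coe_translSL_mul_mul, ← hAc]; simp; ring
  rw [← e00] at hk
  rw [← e11] at hl
  have hdet := det_eq_one' B
  rw [e10] at hdet
  -- `B 0 1` is at most `c + 1 / c` in absolute value, and `c ≥ c₀` absorbs `1 / c` into a multiple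
  -- of `c`.
  have hb : |B 0 1| ≤ c * (1 + 1 / c₀ ^ 2) := by
    have h1 : B 0 1 = (B 0 0 * B 1 1 - 1) / c := by field_simp; linarith
    have h2 : 1 / c ≤ c * (1 / c₀ ^ 2) := by
      rw [mul_one_div, div_le_div_iff₀ hc (by positivity)]
      nlinarith
    have h3 : |B 0 0 * B 1 1 - 1| ≤ c * c + 1 := by
      rw [abs_le]; constructor <;> nlinarith
    rw [h1, abs_div, abs_of_pos hc]
    calc |B 0 0 * B 1 1 - 1| / c ≤ (c * c + 1) / c := by gcongr
      _ = c + 1 / c := by field_simp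
      _ ≤ c * (1 + 1 / c₀ ^ 2) := by linarith
  have hmsq : msq B ≤ c ^ 2 * (3 + (1 + 1 / c₀ ^ 2) ^ 2) := by
    have h1 : B 0 1 ^ 2 ≤ (c * (1 + 1 / c₀ ^ 2)) ^ 2 := by
      rw [← sq_abs]; exact pow_le_pow_left₀ (abs_nonneg _) hb 2
    unfold msq
    rw [e10]
    nlinarith
  set γ' : Γ := a.gen ^ k * γ * b.gen ^ l with hγ'
  have hγ'e : ((γ'⁻¹ : Γ) : PSL(2, ℝ)) = ((s * B * t⁻¹)⁻¹ : SL(2, ℝ)) := by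
    have h1 : ((s * B * t⁻¹ : SL(2, ℝ)) : PSL(2, ℝ)) =
      a.σ * (transl k * (a.σ⁻¹ * γ * b.σ) * transl l) * b.σ⁻¹ := by rw [← hA, ← hs, ← ht]; rfl
    have h2 : (γ' : PSL(2, ℝ)) = (s * B * t⁻¹ : SL(2, ℝ)) := by
      rw [h1, hγ', Subgroup.coe_mul, Subgroup.coe_mul, a.coe_gen_zpow, b.coe_gen_zpow]; group
    rw [Subgroup.coe_inv, h2]; rfl
  have hmem : (((s * B * t⁻¹)⁻¹ : SL(2, ℝ)) : PSL(2, ℝ)) ∈ Γ := by rw [← hγ'e]; exact (γ'⁻¹).2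
  have h1 := hbound _ hmem
  have h2 : (⟨_, hmem⟩ : Γ) = γ'⁻¹ := Subtype.ext hγ'e.symm
  rw [h2] at h1
  change ‖χ γ'⁻¹‖ ≤ M * msq ((s * B * t⁻¹)⁻¹ : SL(2, ℝ)) ^ (σ₀ - 1) at h1
  rw [msq_inv] at h1
  have h3 : msq (s * B * t⁻¹ : SL(2, ℝ)) ≤ L * c ^ 2 := by
    rw [Matrix.SpecialLinearGroup.coe_mul, Matrix.SpecialLinearGroup.coe_mul]
    refine (msq_mul_le _ _).trans ?_
    rw [msq_inv]
    have h4 := msq_mul_le (s : Matrix (Fin 2) (Fin 2) ℝ) B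
    have h5 := msq_nonneg s
    have h6 := msq_nonneg t
    calc msq (↑s * ↑B) * msq t ≤ (msq s * (c ^ 2 * (3 + (1 + 1 / c₀ ^ 2) ^ 2))) * msq t := by
          gcongr; exact h4.trans (by gcongr)
      _ = L * c ^ 2 := by rw [hL]; ring
  have h7 : ‖χ γ⁻¹‖ ≤ ‖χ γ'⁻¹‖ := by
    have e : γ⁻¹ = b.gen ^ l * γ'⁻¹ * a.gen ^ k := by rw [hγ']; group
    rw [e]
    calc ‖χ (b.gen ^ l * γ'⁻¹ * a.gen ^ k)‖ ≤ ‖χ (b.gen ^ l * γ'⁻¹)‖ * ‖χ (a.gen ^ k)‖ :=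
          norm_map_mul_le _ _ _
      _ ≤ ‖χ (b.gen ^ l * γ'⁻¹)‖ * 1 := by
          gcongr; exact norm_map_stab_le hχ (a.gen_zpow_mem_stab k)
      _ ≤ ‖χ (b.gen ^ l)‖ * ‖χ γ'⁻¹‖ := by rw [mul_one]; exact norm_map_mul_le _ _ _
      _ ≤ 1 * ‖χ γ'⁻¹‖ := by gcongr; exact norm_map_stab_le hχ (b.gen_zpow_mem_stab l)
      _ = ‖χ γ'⁻¹‖ := one_mul _
  refine h7.trans (h1.trans ?_)
  have h8 : msq (s * B * t⁻¹ : SL(2, ℝ)) ^ (σ₀ - 1) ≤ (L * c ^ 2) ^ (σ₀ - 1) :=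
    Real.rpow_le_rpow (msq_nonneg _) h3 (by linarith)
  calc M * msq (s * B * t⁻¹ : SL(2, ℝ)) ^ (σ₀ - 1) ≤ M * (L * c ^ 2) ^ (σ₀ - 1) := by gcongr
    _ = M * L ^ (σ₀ - 1) * c ^ (2 * (σ₀ - 1)) := by
      rw [Real.mul_rpow hL0 (by positivity), Real.rpow_mul hc.le, mul_assoc]
      congr 3
      norm_num

/-! ### The cosets -/

/-- Two scaling matrices for one cusp may differ, but `a.σ⁻¹ * b.σ` is upper triangular and
conjugates the integral translations to integral translations. So the square of its upper left entry
is a positive integer; the same holds for the inverse, hence it is 1. -/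
lemma im_smul_of_pt_eq (h : a.pt = b.pt) (z : ℍ) : (a.σ⁻¹ • b.σ • z).im = z.im := by
  have key : ∀ a b : ScaledCusp Γ, a.pt = b.pt → ∀ A : SL(2, ℝ),
      (A : PSL(2, ℝ)) = a.σ⁻¹ * b.σ → A 1 0 = 0 → 1 ≤ A 0 0 ^ 2 := by
    intro a b h A hA h10
    have hdet := det_eq_one' A
    rw [h10] at hdet
    have h1 := (b.conj_stabilizer (transl 1)).2 ⟨1, by simp⟩
    have h2 : a.σ * (a.σ⁻¹ * b.σ * transl 1 * (a.σ⁻¹ * b.σ)⁻¹) * a.σ⁻¹ =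
      b.σ * transl 1 * b.σ⁻¹ := by group
    rw [← h, ← h2, a.conj_stabilizer] at h1
    obtain ⟨k, hk⟩ := h1
    rw [← hA] at hk
    have h3 : ((A * translSL 1 * A⁻¹ : SL(2, ℝ)) : PSL(2, ℝ)) = (translSL k : SL(2, ℝ)) := hk
    have e00 : (A * translSL 1 * A⁻¹) 0 0 = 1 := by
      simp [Matrix.SpecialLinearGroup.coe_mul, coe_translSL, Matrix.mul_apply, Fin.sum_univ_two,
        Matrix.SpecialLinearGroup.coe_inv, Matrix.adjugate_fin_two, h10]
      linarith
    have e01 : (A * translSL 1 * A⁻¹) 0 1 = A 0 0 ^ 2 := by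
      simp [Matrix.SpecialLinearGroup.coe_mul, coe_translSL, Matrix.mul_apply, Fin.sum_univ_two,
        Matrix.SpecialLinearGroup.coe_inv, Matrix.adjugate_fin_two]
      ring
    have hpos : 0 < A 0 0 ^ 2 := by
      have : A 0 0 ≠ 0 := by rintro h0; rw [h0] at hdet; simp at hdet
      positivity
    rcases mk_eq_mk_iff.1 h3 with h4 | h4
    · rw [← h4] at e01
      simp [coe_translSL] at e01
      rw [← e01] at hpos ⊢
      have : (0 : ℤ) < k := by exact_mod_cast hpos
      exact_mod_cast this
    · have h5 : translSL k 0 0 = -1 := by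
        rw [h4, Matrix.SpecialLinearGroup.coe_neg, Matrix.neg_apply, e00]
      simp [coe_translSL] at h5
      norm_num at h5
  obtain ⟨A, hA⟩ := QuotientGroup.mk_surjective (a.σ⁻¹ * b.σ)
  have hinf : (A : PSL(2, ℝ)) • (OnePoint.infty : OnePoint ℝ) = OnePoint.infty := by
    rw [hA, mul_smul, b.smul_infty, inv_smul_eq_iff, a.smul_infty, h]
  have h10 : A 1 0 = 0 := by
    rw [smul_mk_boundary, OnePoint.smul_infty_eq_self_iff] at hinf
    exact hinf
  have h1 := key a b h A hA h10
  have h2 := key b a h.symm A⁻¹ (by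
    have : ((A⁻¹ : SL(2, ℝ)) : PSL(2, ℝ)) = (A : PSL(2, ℝ))⁻¹ := rfl
    rw [this, hA]; group) (by
    simp [Matrix.SpecialLinearGroup.coe_inv, Matrix.adjugate_fin_two, h10])
  have h3 : (A⁻¹ : SL(2, ℝ)) 0 0 = A 1 1 := by
    simp [Matrix.SpecialLinearGroup.coe_inv, Matrix.adjugate_fin_two]
  rw [h3] at h2
  have hdet := det_eq_one' A
  rw [h10] at hdet
  have h4 : A 1 1 ^ 2 = 1 := by
    have h5 : A 0 0 ^ 2 * A 1 1 ^ 2 = 1 := by rw [← mul_pow]; nlinarith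
    nlinarith
  rw [← mul_smul, ← hA, smul_mk_uhp, im_smul_SL, h10]
  simp [h4]

/-- The coset of the element of bottom row `(c, d + k c)`. -/
def DoubleCosetReps.coset (R : DoubleCosetReps a b) (p : R.Idx × ℤ) :
    Quotient (QuotientGroup.rightRel a.stab) :=
  Quotient.mk _ (R.γ p.1.1 p.1.2 * b.gen ^ p.2)

lemma DoubleCosetReps.row (R : DoubleCosetReps a b) (p : R.Idx × ℤ) :
    HasBottomRow (a.σ⁻¹ * (R.γ p.1.1 p.1.2 * b.gen ^ p.2 : Γ) * b.σ) p.1.1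
      (p.1.2 + p.1.1 * p.2) :=
  ScaledCusp.row_of_mul_gen _ (R.bottomRow _ p.1.1.2.1 _ p.1.2.2)

lemma DoubleCosetReps.coset_injective (R : DoubleCosetReps a b) : Function.Injective R.coset := by
  rintro ⟨⟨⟨c, hc⟩, ⟨d, hd⟩⟩, k⟩ ⟨⟨⟨c', hc'⟩, ⟨d', hd'⟩⟩, k'⟩ h
  have h1 := QuotientGroup.rightRel_apply.1 (Quotient.exact h)
  have r1 := R.row ⟨⟨⟨c, hc⟩, ⟨d, hd⟩⟩, k⟩
  have r2 := R.row ⟨⟨⟨c', hc'⟩, ⟨d', hd'⟩⟩, k'⟩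
  have r3 := ScaledCusp.row_of_mul_stab h1 r1
  rw [inv_mul_cancel_right] at r3
  have hcp := hc.1
  have hcp' := hc'.1
  simp only at r2 r3
  rcases r3.unique r2 with ⟨rfl, h3⟩ | ⟨h3, -⟩
  · obtain rfl : d = d' := R.eq_of_mem hc.1 hd hd' (k := k' - k) (by push_cast; linarith)
    have h4 : (k : ℝ) = k' := by
      have : c' * (k : ℝ) = c' * k' := by linarith
      exact mul_left_cancel₀ hcp.ne' this
    obtain rfl : k = k' := by exact_mod_cast h4
    rfl
  · linarith

/-- A row with `c = 0` means that `γ` maps the cusp of `b` to that of `a`; then the cusps are equal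
and `γ` is in the trivial coset. Otherwise the sign is chosen with `c > 0` and `d` is reduced modulo
`c`. -/
lemma DoubleCosetReps.mem_range_coset (R : DoubleCosetReps a b)
    (hab : a.pt = b.pt ∨ ∀ γ : Γ, γ • b.pt ≠ a.pt)
    (q : Quotient (QuotientGroup.rightRel a.stab)) :
    q ∈ Set.range R.coset ∨ (a.pt = b.pt ∧ q = Quotient.mk _ 1) := by
  induction q using Quotient.inductionOn with
  | h γ =>
  have hex : ∃ c d, 0 ≤ c ∧ HasBottomRow (a.σ⁻¹ * γ * b.σ) c d := by
    obtain ⟨A, hA⟩ := QuotientGroup.mk_surjective (a.σ⁻¹ * (γ : PSL(2, ℝ)) * b.σ)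
    have h1 : HasBottomRow (a.σ⁻¹ * γ * b.σ) (A 1 0) (A 1 1) := ⟨A, hA, rfl, rfl⟩
    rcases le_total 0 (A 1 0) with h | h
    · exact ⟨_, _, h, h1⟩
    · exact ⟨_, _, by linarith, h1.neg⟩
  obtain ⟨c, d, hc, hrow⟩ := hex
  rcases hc.eq_or_lt with rfl | hc
  · right
    have h1 := hrow.smul_infty
    rw [mul_smul, mul_smul, b.smul_infty, inv_smul_eq_iff, a.smul_infty] at h1
    have hpt : a.pt = b.pt := by
      rcases hab with h | h
      · exact h
      · exact absurd h1 (h γ)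
    refine ⟨hpt, Quotient.sound (QuotientGroup.rightRel_apply.2 ?_)⟩
    rw [one_mul]
    refine a.stab.inv_mem ?_
    rw [← hpt] at h1
    exact h1
  · left
    obtain ⟨d', ⟨hd', k, hk⟩, -⟩ := R.existsUnique c hc d γ hrow
    refine ⟨⟨⟨⟨c, hc, γ, d, hrow⟩, ⟨d', hd'⟩⟩, k⟩,
      Quotient.sound (QuotientGroup.rightRel_apply.2 ?_)⟩
    have r1 := R.row ⟨⟨⟨c, hc, γ, d, hrow⟩, ⟨d', hd'⟩⟩, k⟩
    refine ScaledCusp.mul_inv_mem_stab_of_row r1 hrow ?_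
    change c * (d' + c * k) - d * c = 0
    rw [hk]; ring

lemma DoubleCosetReps.one_notMem_range_coset (R : DoubleCosetReps a b) (h : a.pt = b.pt) :
    (Quotient.mk _ 1 : Quotient (QuotientGroup.rightRel a.stab)) ∉ Set.range R.coset := by
  rintro ⟨p, hp⟩
  have h1 := QuotientGroup.rightRel_apply.1 (Quotient.exact hp)
  have r1 := ScaledCusp.row_of_mul_stab h1 (R.row p)
  rw [inv_mul_cancel_right] at r1
  have h2 : (a.σ⁻¹ * ((1 : Γ) : PSL(2, ℝ)) * b.σ) • (OnePoint.infty : OnePoint ℝ) =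
      OnePoint.infty := by
    rw [Subgroup.coe_one, mul_one, mul_smul, b.smul_infty, inv_smul_eq_iff, a.smul_infty, h]
  obtain ⟨e, he⟩ := hasBottomRow_zero_of_smul_infty h2
  have hc := p.1.1.2.1
  rcases r1.unique he with ⟨h3, -⟩ | ⟨h3, -⟩ <;> linarith

end

section

open MeasureTheory

/-! ### The Fourier transform of `(t² + y²)⁻ˢ` -/

lemma e_add (x y : ℝ) : e (x + y) = e x * e y := by
  rw [e, e, e, ← Complex.exp_add]; push_cast; ring_nf

lemma e_zero : e 0 = 1 := by simp [e]

lemma e_ne_zero (x : ℝ) : e x ≠ 0 := Complex.exp_ne_zero _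

lemma norm_e (x : ℝ) : ‖e x‖ = 1 := by
  rw [e, show (2 * Real.pi * Complex.I * x : ℂ) = ((2 * Real.pi * x : ℝ) : ℂ) * Complex.I by
    push_cast; ring, Complex.norm_exp_ofReal_mul_I]

lemma e_intCast (k : ℤ) : e k = 1 := by
  rw [e, Complex.exp_eq_one_iff]; exact ⟨k, by push_cast; ring⟩

lemma continuous_e : Continuous e := by unfold e; fun_prop

/-- The function `(t² + y²)⁻ˢ`. -/
def powerKernel (s : ℂ) (y t : ℝ) : ℂ := ((t ^ 2 + y ^ 2 : ℝ) : ℂ) ^ (-s)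

/-- The Fourier transform of `(t² + y²)⁻ˢ`. -/
def powerKernelFourier (s : ℂ) (y r : ℝ) : ℂ := ∫ t : ℝ, powerKernel s y t * e (-(r * t))

section

variable {s : ℂ} {y : ℝ}

lemma norm_powerKernel (hy : 0 < y) (t : ℝ) :
    ‖powerKernel s y t‖ = (t ^ 2 + y ^ 2) ^ (-s.re) := by
  rw [powerKernel, Complex.norm_cpow_eq_rpow_re_of_pos (by positivity), Complex.neg_re]

lemma continuous_powerKernel (hy : 0 < y) : Continuous (powerKernel s y) := by
  unfold powerKernel
  refine Continuous.cpow (by fun_prop) continuous_const fun t => ?_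
  left
  rw [Complex.ofReal_re]
  positivity

lemma rpow_sq_add_sq_le (hy : 0 < y) {σ : ℝ} (hσ : 1 ≤ σ) (t : ℝ) :
    (t ^ 2 + y ^ 2) ^ (-σ) ≤ (min 1 (y ^ 2)) ^ (-σ) * (1 + t ^ 2)⁻¹ := by
  have hm : 0 < min 1 (y ^ 2) := by positivity
  have h1 : min 1 (y ^ 2) * (1 + t ^ 2) ≤ t ^ 2 + y ^ 2 := by
    have := min_le_left 1 (y ^ 2)
    have := min_le_right 1 (y ^ 2)
    nlinarith [sq_nonneg t]
  calc (t ^ 2 + y ^ 2) ^ (-σ) ≤ (min 1 (y ^ 2) * (1 + t ^ 2)) ^ (-σ) :=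
        Real.rpow_le_rpow_of_nonpos (by positivity) h1 (by linarith)
    _ = (min 1 (y ^ 2)) ^ (-σ) * (1 + t ^ 2) ^ (-σ) := Real.mul_rpow hm.le (by positivity)
    _ ≤ (min 1 (y ^ 2)) ^ (-σ) * (1 + t ^ 2)⁻¹ := by
        gcongr
        rw [← Real.rpow_neg_one]
        exact Real.rpow_le_rpow_of_exponent_le (by nlinarith [sq_nonneg t]) (by linarith)

lemma integrable_rpow_sq_add_sq (hy : 0 < y) {σ : ℝ} (hσ : 1 ≤ σ) :
    Integrable fun t : ℝ => (t ^ 2 + y ^ 2) ^ (-σ) := by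
  refine (integrable_inv_one_add_sq.const_mul ((min 1 (y ^ 2)) ^ (-σ))).mono' ?_
    (Filter.Eventually.of_forall fun t => ?_)
  · exact (Continuous.rpow_const (by fun_prop) fun t => Or.inl (by positivity)).aestronglyMeasurable
  · rw [Real.norm_of_nonneg (by positivity)]
    exact rpow_sq_add_sq_le hy hσ t

lemma integral_gaussian_mul_e {u : ℝ} (hu : 0 < u) (r : ℝ) :
    ∫ t : ℝ, Complex.exp (-(u * t ^ 2)) * e (-(r * t)) =
      (Real.pi : ℂ) ^ (1 / 2 : ℂ) * (u : ℂ) ^ (-(1 / 2) : ℂ) *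
        (Real.exp (-(Real.pi ^ 2 * r ^ 2 / u)) : ℂ) := by
  have h := fourierIntegral_gaussian (b := u) (by simpa using hu) (-(2 * Real.pi * r))
  have e1 : ((Real.pi : ℂ) / u) ^ (1 / 2 : ℂ) =
      (Real.pi : ℂ) ^ (1 / 2 : ℂ) * (u : ℂ) ^ (-(1 / 2) : ℂ) := by
    rw [div_eq_mul_inv, ← Complex.ofReal_inv,
      Complex.mul_cpow_ofReal_nonneg Real.pi_pos.le (by positivity), Complex.ofReal_inv,
      Complex.inv_cpow, Complex.cpow_neg]
    rw [Complex.arg_ofReal_of_nonneg hu.le]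
    exact Real.pi_pos.ne
  rw [← e1]
  convert h using 2
  · ext t
    rw [mul_comm, e]
    congr 2 <;> (push_cast; ring)
  · rw [Complex.ofReal_exp]
    congr 1
    push_cast
    have : (u : ℂ) ≠ 0 := by exact_mod_cast hu.ne'
    field_simp
    ring

/-- Write `Γ(s) (t ^ 2 + y ^ 2) ^ (-s)` as a Mellin integral in `u`, interchange the integrals and
use the Fourier transform of the Gaussian, whose factor `u ^ (-1/2)` lowers the exponent to `s - 3 /
2`. -/
lemma gamma_mul_powerKernelFourier (hs : 1 ≤ s.re) (hy : 0 < y) (r : ℝ) :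
    Complex.Gamma s * powerKernelFourier s y r =
      (Real.pi : ℂ) ^ (1 / 2 : ℂ) * ∫ u in Set.Ioi (0 : ℝ), (u : ℂ) ^ (s - 3 / 2) *
        (Real.exp (-(y ^ 2 * u + Real.pi ^ 2 * r ^ 2 / u)) : ℂ) := by
  have hs0 : 0 < s.re := by linarith
  set F : ℝ → ℝ → ℂ := fun u t =>
    (u : ℂ) ^ (s - 1) * Complex.exp (-((t ^ 2 + y ^ 2 : ℝ) * u)) * e (-(r * t)) with hF
  have hnorm : ∀ t : ℝ, ∀ u ∈ Set.Ioi (0 : ℝ), ‖F u t‖ =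
      u ^ (s.re - 1) * Real.exp (-((t ^ 2 + y ^ 2) * u)) := by
    intro t u hu
    rw [hF]
    simp only [norm_mul, norm_e, mul_one]
    rw [Complex.norm_cpow_eq_rpow_re_of_pos hu, ← Complex.ofReal_mul, ← Complex.ofReal_neg,
      Complex.norm_exp_ofReal]
    simp
  have hint : ∀ t : ℝ, ∫ u in Set.Ioi (0 : ℝ), ‖F u t‖ =
      (t ^ 2 + y ^ 2) ^ (-s.re) * Real.Gamma s.re := by
    intro t
    rw [setIntegral_congr_fun measurableSet_Ioi (hnorm t),
      Real.integral_rpow_mul_exp_neg_mul_Ioi hs0 (by positivity), one_div,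
      Real.inv_rpow (by positivity), ← Real.rpow_neg (by positivity)]
  have hmeas : Measurable (Function.uncurry F) := by
    have := continuous_e.measurable
    unfold Function.uncurry
    rw [hF]
    fun_prop
  have hFint : Integrable (Function.uncurry F) ((volume.restrict (Set.Ioi 0)).prod volume) := by
    rw [integrable_prod_iff' hmeas.aestronglyMeasurable]
    constructor
    · refine Filter.Eventually.of_forall fun t => ?_
      have h1 : Integrable (fun u => ‖F u t‖) (volume.restrict (Set.Ioi 0)) := by
        -- The integral of a nonintegrable function is 0 by convention, so the positive value
        -- already shows integrability.
        apply Integrable.of_integral_ne_zero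
        rw [hint]
        have := Real.Gamma_pos_of_pos hs0
        positivity
      refine (integrable_norm_iff ?_).1 h1
      exact (hmeas.comp (measurable_id.prodMk measurable_const)).aestronglyMeasurable
    · simp only [Function.uncurry]
      simp_rw [hint]
      exact (integrable_rpow_sq_add_sq hy hs).mul_const _
  have hswap := integral_integral_swap hFint
  have h1 : ∫ t : ℝ, ∫ u in Set.Ioi (0 : ℝ), F u t = Complex.Gamma s * powerKernelFourier s y r := by
    rw [powerKernelFourier, ← integral_const_mul]
    congr 1
    ext t
    rw [hF]
    simp only
    rw [integral_mul_const, Complex.integral_cpow_mul_exp_neg_mul_Ioi hs0 (by positivity),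
      powerKernel, Complex.cpow_neg, one_div, Complex.inv_cpow]
    · ring
    · rw [Complex.arg_ofReal_of_nonneg (by positivity)]
      exact Real.pi_pos.ne
  rw [← h1, ← hswap, ← integral_const_mul]
  refine setIntegral_congr_fun measurableSet_Ioi fun u hu => ?_
  have hu' : 0 < u := hu
  have huc : (u : ℂ) ≠ 0 := by exact_mod_cast hu'.ne'
  have h2 : ∀ t : ℝ, F u t = ((u : ℂ) ^ (s - 1) * Complex.exp (-(y ^ 2 * u))) *
      (Complex.exp (-(u * t ^ 2)) * e (-(r * t))) := by
    intro t
    rw [hF]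
    simp only
    rw [← mul_assoc, mul_assoc _ _ (Complex.exp (-(u * t ^ 2))), ← Complex.exp_add]
    congr 3
    push_cast; ring
  simp_rw [h2]
  rw [integral_const_mul, integral_gaussian_mul_e hu']
  have h3 : (u : ℂ) ^ (s - 3 / 2) = (u : ℂ) ^ (s - 1) * (u : ℂ) ^ (-(1 / 2) : ℂ) := by
    rw [← Complex.cpow_add _ _ huc]; congr 1; ring
  have h4 : (Real.exp (-(y ^ 2 * u + Real.pi ^ 2 * r ^ 2 / u)) : ℂ) =
      Complex.exp (-(y ^ 2 * u)) * (Real.exp (-(Real.pi ^ 2 * r ^ 2 / u)) : ℂ) := by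
    rw [Complex.ofReal_exp, Complex.ofReal_exp, ← Complex.exp_add]
    congr 1; push_cast; ring
  rw [h3, h4]
  ring

lemma powerKernelFourier_zero (hs : 1 ≤ s.re) (hy : 0 < y) :
    powerKernelFourier s y 0 = (Real.pi : ℂ) ^ (1 / 2 : ℂ) * Complex.Gamma (s - 1 / 2) /
      Complex.Gamma s * (y : ℂ) ^ (1 - 2 * s) := by
  have hG : Complex.Gamma s ≠ 0 := Complex.Gamma_ne_zero_of_re_pos (by linarith)
  have h := gamma_mul_powerKernelFourier hs hy 0
  have h1 := Complex.integral_cpow_mul_exp_neg_mul_Ioi (a := s - 1 / 2) (r := y ^ 2)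
    (by simp; linarith) (by positivity)
  have h2 : ∫ u in Set.Ioi (0 : ℝ), (u : ℂ) ^ (s - 3 / 2) *
        (Real.exp (-(y ^ 2 * u + Real.pi ^ 2 * 0 ^ 2 / u)) : ℂ) =
      ∫ u in Set.Ioi (0 : ℝ), (u : ℂ) ^ (s - 1 / 2 - 1) * Complex.exp (-((y ^ 2 : ℝ) * u)) := by
    congr 1
    ext u
    rw [Complex.ofReal_exp]
    congr 2
    · ring
    · push_cast; ring
  rw [h2, h1] at h
  have h3 : (1 / ((y ^ 2 : ℝ) : ℂ)) ^ (s - 1 / 2) = (y : ℂ) ^ (1 - 2 * s) := by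
    rw [one_div, Complex.inv_cpow, ← Complex.cpow_neg, pow_two, Complex.ofReal_mul,
      Complex.mul_cpow_ofReal_nonneg hy.le hy.le, ← Complex.cpow_add]
    · congr 1; ring
    · exact_mod_cast hy.ne'
    · rw [Complex.arg_ofReal_of_nonneg (by positivity)]
      exact Real.pi_pos.ne
  rw [h3] at h
  generalize Complex.Gamma (s - 1 / 2) = G' at *
  field_simp
  linear_combination h

/-- The substitution `u = (π |r| / y) t` makes the exponent symmetric in `t` and `t⁻¹`. -/
lemma gamma_mul_powerKernelFourier_besselK (hs : 1 ≤ s.re) (hy : 0 < y) {r : ℝ} (hr : r ≠ 0) :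
    Complex.Gamma s * powerKernelFourier s y r =
      (Real.pi : ℂ) ^ (1 / 2 : ℂ) * (((Real.pi * |r| / y : ℝ) : ℂ) ^ (s - 1 / 2) *
        (2 * besselK (s - 1 / 2) (2 * Real.pi * (|r| * y)))) := by
  have hr' : 0 < |r| := abs_pos.2 hr
  set κ := Real.pi * |r| / y with hκ
  have hκ0 : 0 < κ := by positivity
  have hκc : (κ : ℂ) ≠ 0 := by exact_mod_cast hκ0.ne'
  rw [gamma_mul_powerKernelFourier hs hy r]
  congr 1
  have h := integral_comp_mul_left_Ioi (fun u : ℝ => (u : ℂ) ^ (s - 3 / 2) *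
        (Real.exp (-(y ^ 2 * u + Real.pi ^ 2 * r ^ 2 / u)) : ℂ)) 0 hκ0
  rw [mul_zero, eq_inv_smul_iff₀ hκ0.ne'] at h
  rw [← h, besselK, ← mul_assoc 2, mul_one_div_cancel two_ne_zero, one_mul, ← integral_const_mul,
    ← integral_smul]
  refine setIntegral_congr_fun measurableSet_Ioi fun t ht => ?_
  have ht' : 0 < t := ht
  have htc : (t : ℂ) ≠ 0 := by exact_mod_cast ht'.ne'
  have e1 : -(y ^ 2 * (κ * t) + Real.pi ^ 2 * r ^ 2 / (κ * t)) =
      -(2 * Real.pi * (|r| * y)) * (t + t⁻¹) / 2 := by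
    rw [hκ, ← sq_abs r]
    have := Real.pi_ne_zero
    field_simp
  have e2 : (κ : ℂ) ^ (s - 1 / 2) = κ * (κ : ℂ) ^ (s - 3 / 2) := by
    nth_rw 2 [← Complex.cpow_one (κ : ℂ)]
    rw [← Complex.cpow_add _ _ hκc]; congr 1; ring
  have e3 : (t : ℂ) ^ (s - 1 / 2) = t * (t : ℂ) ^ (s - 3 / 2) := by
    nth_rw 2 [← Complex.cpow_one (t : ℂ)]
    rw [← Complex.cpow_add _ _ htc]; congr 1; ring
  rw [e1, e2, e3, Complex.ofReal_mul κ t, Complex.mul_cpow_ofReal_nonneg hκ0.le ht'.le,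
    Complex.real_smul]
  field_simp

lemma whittaker_mul_eq (hs : 1 ≤ s.re) {r : ℝ} (hr : r ≠ 0) (z : ℍ) :
    whittaker s ((r : ℂ) * z) *
        ((Real.pi : ℂ) ^ s / Complex.Gamma s * ((|r| : ℝ) : ℂ) ^ (s - 1)) =
      (z.im : ℂ) ^ s * powerKernelFourier s z.im r * e (r * z.re) := by
  have hG : Complex.Gamma s ≠ 0 := Complex.Gamma_ne_zero_of_re_pos (by linarith)
  have hr' : 0 < |r| := abs_pos.2 hr
  have hrc : ((|r| : ℝ) : ℂ) ≠ 0 := by exact_mod_cast hr'.ne'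
  have hy := z.im_pos
  have hyc : (z.im : ℂ) ≠ 0 := by exact_mod_cast hy.ne'
  have hpc : (Real.pi : ℂ) ≠ 0 := by exact_mod_cast Real.pi_ne_zero
  have h := gamma_mul_powerKernelFourier_besselK hs hy hr
  have him : ((r : ℂ) * z).im = r * z.im := by simp
  have hre : ((r : ℂ) * z).re = r * z.re := by simp
  have habs : |r * z.im| = |r| * z.im := by rw [abs_mul, abs_of_pos hy]
  rw [whittaker, him, hre, habs]
  set K := besselK (s - 1 / 2) (2 * Real.pi * (|r| * z.im))
  have e1 : (Real.sqrt (|r| * z.im) : ℂ) = ((|r| : ℝ) : ℂ) ^ (1 / 2 : ℂ) * (z.im : ℂ) ^ (1 / 2 : ℂ) := by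
    rw [Real.sqrt_eq_rpow, Complex.ofReal_cpow (by positivity), Complex.ofReal_mul,
      Complex.mul_cpow_ofReal_nonneg hr'.le hy.le]
    push_cast; rfl
  have e2 : ((Real.pi * |r| / z.im : ℝ) : ℂ) ^ (s - 1 / 2) = (Real.pi : ℂ) ^ (s - 1 / 2) *
      ((|r| : ℝ) : ℂ) ^ (s - 1 / 2) * ((z.im : ℂ) ^ (s - 1 / 2))⁻¹ := by
    rw [div_eq_mul_inv, Complex.ofReal_mul, Complex.mul_cpow_ofReal_nonneg (by positivity)
      (by positivity), Complex.ofReal_mul, Complex.mul_cpow_ofReal_nonneg (by positivity)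
      (by positivity), Complex.ofReal_inv, Complex.inv_cpow]
    rw [Complex.arg_ofReal_of_nonneg hy.le]
    exact Real.pi_pos.ne
  have e3 : (Real.pi : ℂ) ^ s = (Real.pi : ℂ) ^ (1 / 2 : ℂ) * (Real.pi : ℂ) ^ (s - 1 / 2) := by
    rw [← Complex.cpow_add _ _ hpc]; congr 1; ring
  have e4 : ((|r| : ℝ) : ℂ) ^ (s - 1 / 2) = ((|r| : ℝ) : ℂ) ^ (1 / 2 : ℂ) *
      ((|r| : ℝ) : ℂ) ^ (s - 1) := by
    rw [← Complex.cpow_add _ _ hrc]; congr 1; ring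
  have e5 : (z.im : ℂ) ^ s = (z.im : ℂ) ^ (1 / 2 : ℂ) * (z.im : ℂ) ^ (s - 1 / 2) := by
    rw [← Complex.cpow_add _ _ hyc]; congr 1; ring
  have hy2 : (z.im : ℂ) ^ (s - 1 / 2) ≠ 0 := by
    rw [Ne, Complex.cpow_eq_zero_iff]; tauto
  rw [e2, e4] at h
  rw [e1, e3, e5]
  generalize (z.im : ℂ) ^ (s - 1 / 2) = Y at *
  generalize (z.im : ℂ) ^ (1 / 2 : ℂ) = Y' at *
  have h' : powerKernelFourier s z.im r = (Real.pi : ℂ) ^ (1 / 2 : ℂ) *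
      ((Real.pi : ℂ) ^ (s - 1 / 2) * (((|r| : ℝ) : ℂ) ^ (1 / 2 : ℂ) *
      ((|r| : ℝ) : ℂ) ^ (s - 1)) * Y⁻¹ * (2 * K)) / Complex.Gamma s := by
    rw [← h]; field_simp
  rw [h']
  field_simp

/-- Quadratic decay is enough to sum over integers. With `q = π ^ 2 r ^ 2 / u`, the bounds `exp (-q)
≤ 1` and `q exp (-q) ≤ 1` give `(1 + r ^ 2) exp (-q) ≤ 1 + u`, and the extra `1 + u` is integrable
against `exp (-y ^ 2 u)`. -/
lemma norm_powerKernelFourier_le (hs : 1 ≤ s.re) (hy : 0 < y) :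
    ∃ C : ℝ, 0 ≤ C ∧ ∀ r : ℝ, ‖powerKernelFourier s y r‖ ≤ C * (1 + r ^ 2)⁻¹ := by
  have hG : Complex.Gamma s ≠ 0 := Complex.Gamma_ne_zero_of_re_pos (by linarith)
  set g : ℝ → ℝ := fun u => u ^ (s.re - 3 / 2) * Real.exp (-(y ^ 2) * u ^ (1 : ℝ)) +
    u ^ (s.re - 1 / 2) * Real.exp (-(y ^ 2) * u ^ (1 : ℝ)) with hg
  have hgint : IntegrableOn g (Set.Ioi 0) :=
    (integrableOn_rpow_mul_exp_neg_mul_rpow (by linarith) one_pos (by positivity)).add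
      (integrableOn_rpow_mul_exp_neg_mul_rpow (by linarith) one_pos (by positivity))
  have hg0 : 0 ≤ ∫ u in Set.Ioi (0 : ℝ), g u :=
    setIntegral_nonneg measurableSet_Ioi fun u hu => by
      have : 0 < u := hu
      rw [hg]; positivity
  refine ⟨‖Complex.Gamma s‖⁻¹ * (‖(Real.pi : ℂ) ^ (1 / 2 : ℂ)‖ * ∫ u in Set.Ioi (0 : ℝ), g u),
    by positivity, fun r => ?_⟩
  have h1 : powerKernelFourier s y r = (Complex.Gamma s)⁻¹ *
      (Complex.Gamma s * powerKernelFourier s y r) := by field_simp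
  rw [h1, gamma_mul_powerKernelFourier hs hy r, norm_mul, norm_mul, norm_inv, mul_assoc, mul_assoc]
  gcongr
  have h2 := norm_integral_le_of_norm_le (μ := volume.restrict (Set.Ioi 0))
    (f := fun u : ℝ => (u : ℂ) ^ (s - 3 / 2) *
        (Real.exp (-(y ^ 2 * u + Real.pi ^ 2 * r ^ 2 / u)) : ℂ))
    (g := fun u => g u * (1 + r ^ 2)⁻¹) (hgint.mul_const _) ?_
  · rw [integral_mul_const] at h2
    exact h2
  · refine (ae_restrict_iff' measurableSet_Ioi).2 (Filter.Eventually.of_forall fun u hu => ?_)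
    have hu' : 0 < u := hu
    rw [norm_mul, Complex.norm_cpow_eq_rpow_re_of_pos hu', Complex.norm_real,
      Real.norm_of_nonneg (Real.exp_pos _).le, neg_add, Real.exp_add]
    have e1 : (s - 3 / 2).re = s.re - 3 / 2 := by simp
    have e2 : u ^ (s.re - 1 / 2) = u ^ (s.re - 3 / 2) * u := by
      nth_rw 3 [← Real.rpow_one u]
      rw [← Real.rpow_add hu']; congr 1; ring
    have e3 : g u = u ^ (s.re - 3 / 2) * (Real.exp (-(y ^ 2 * u)) * (1 + u)) := by
      rw [hg]; simp only; rw [e2, Real.rpow_one]; ring_nf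
    rw [e1, e3, mul_assoc, mul_assoc]
    gcongr
    rw [← div_eq_mul_inv, le_div_iff₀ (by positivity)]
    set q := Real.pi ^ 2 * r ^ 2 / u with hq
    have hq0 : 0 ≤ q := by positivity
    have h3 : r ^ 2 ≤ q * u := by
      rw [hq, div_mul_cancel₀ _ hu'.ne']
      have : 1 ≤ Real.pi ^ 2 := by nlinarith [Real.pi_gt_three]
      nlinarith [sq_nonneg r]
    have h4 : Real.exp (-q) ≤ 1 := Real.exp_le_one_iff.2 (by linarith)
    have h5 : q * Real.exp (-q) ≤ 1 := by
      rw [Real.exp_neg, ← div_eq_mul_inv, div_le_one (Real.exp_pos _)]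
      linarith [Real.add_one_le_exp q]
    have h6 := Real.exp_pos (-q)
    nlinarith

end

end

section

open MeasureTheory

/-! ### Poisson summation -/

lemma summable_inv_one_add_int_sq : Summable fun k : ℤ => (1 + (k : ℝ) ^ 2)⁻¹ := by
  have h1 : Summable fun k : ℤ => 1 / (k : ℝ) ^ 2 := Real.summable_one_div_int_pow.2 one_lt_two
  have h2 : Summable fun k : ℤ => if k = 0 then (1 : ℝ) else 0 := (hasSum_ite_eq 0 1).summable
  refine Summable.of_nonneg_of_le (fun k => by positivity) (fun k => ?_) (h1.add h2)
  split_ifs with hk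
  · simp [hk]
  · have : (k : ℝ) ≠ 0 := by exact_mod_cast hk
    rw [add_zero, one_div]
    gcongr
    linarith

lemma inv_one_add_add_sq_le (x θ : ℝ) :
    (1 + (x + θ) ^ 2)⁻¹ ≤ 2 * (1 + θ ^ 2) * (1 + x ^ 2)⁻¹ := by
  rw [← div_eq_mul_inv, inv_eq_one_div, div_le_div_iff₀ (by positivity) (by positivity)]
  nlinarith [sq_nonneg (x + 2 * θ), sq_nonneg (θ * (x + θ)), sq_nonneg (x + θ), sq_nonneg θ]

lemma summable_inv_one_add_sq (θ : ℝ) : Summable fun k : ℤ => (1 + ((k : ℝ) + θ) ^ 2)⁻¹ :=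
  Summable.of_nonneg_of_le (fun k => by positivity) (fun k => inv_one_add_add_sq_le _ _)
    (summable_inv_one_add_int_sq.mul_left (2 * (1 + θ ^ 2)))

/-- Uniformity in `x` comes from shifting the summation index by `⌊x⌋`. -/
lemma exists_tsum_rpow_le {y : ℝ} (hy : 0 < y) {σ : ℝ} (hσ : 1 ≤ σ) :
    ∃ C : ℝ, 0 ≤ C ∧ ∀ x : ℝ, (Summable fun k : ℤ => ((x + k) ^ 2 + y ^ 2) ^ (-σ)) ∧
      ∑' k : ℤ, ((x + k) ^ 2 + y ^ 2) ^ (-σ) ≤ C := by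
  set g : ℤ → ℝ := fun k => (min 1 (y ^ 2)) ^ (-σ) * (4 * (1 + (k : ℝ) ^ 2)⁻¹) with hg
  have hgs : Summable g := (summable_inv_one_add_int_sq.mul_left 4).mul_left _
  have hm : 0 < min 1 (y ^ 2) := by positivity
  have key : ∀ x : ℝ, ∀ k : ℤ, ((x + k) ^ 2 + y ^ 2) ^ (-σ) ≤ g (k + ⌊x⌋) := by
    intro x k
    refine (rpow_sq_add_sq_le hy hσ _).trans ?_
    rw [hg]
    simp only
    gcongr
    have h1 : x + k = ((k + ⌊x⌋ : ℤ) : ℝ) + Int.fract x := by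
      push_cast; linarith [Int.floor_add_fract x]
    rw [h1]
    refine (inv_one_add_add_sq_le _ _).trans ?_
    have h2 := Int.fract_nonneg x
    have h3 := (Int.fract_lt_one x).le
    gcongr
    nlinarith
  have hs : ∀ x : ℝ, Summable fun k : ℤ => g (k + ⌊x⌋) := fun x =>
    (Equiv.addRight ⌊x⌋).summable_iff.2 hgs
  refine ⟨∑' k, g k, tsum_nonneg fun k => by rw [hg]; positivity, fun x => ?_⟩
  have h1 := Summable.of_nonneg_of_le (fun k => by positivity) (key x) (hs x)
  refine ⟨h1, ?_⟩
  calc _ ≤ ∑' k : ℤ, g (k + ⌊x⌋) := h1.tsum_le_tsum (key x) (hs x)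
    _ = ∑' k, g k := (Equiv.addRight ⌊x⌋).tsum_eq g

section

variable {s : ℂ} {y : ℝ}

lemma summable_norm_powerKernelFourier (hs : 1 ≤ s.re) (hy : 0 < y) (θ : ℝ) :
    Summable fun n : ℤ => ‖powerKernelFourier s y (n + θ)‖ := by
  obtain ⟨C, -, h⟩ := norm_powerKernelFourier_le hs hy
  exact Summable.of_nonneg_of_le (fun n => norm_nonneg _) (fun n => h _)
    ((summable_inv_one_add_sq θ).mul_left C)

/-- Poisson summation for the kernel times `e(-θ t)`: the twist shifts the frequencies from `n` to
`n + θ`. -/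
lemma tsum_powerKernel_mul_e (hs : 1 ≤ s.re) (hy : 0 < y) (θ x : ℝ) :
    ∑' k : ℤ, powerKernel s y (x + k) * e (-(θ * k)) =
      ∑' n : ℤ, powerKernelFourier s y (n + θ) * e ((n + θ) * x) := by
  set f : ℝ → ℂ := fun t => powerKernel s y t * e (-(θ * t)) with hf
  have hcont : Continuous f := by
    have := continuous_e
    have := continuous_powerKernel (s := s) hy
    rw [hf]; fun_prop
  have hfour : ∀ n : ℤ, FourierTransform.fourier f (n : ℝ) = powerKernelFourier s y (n + θ) := by
    intro n
    rw [Real.fourier_real_eq_integral_exp_smul, powerKernelFourier]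
    congr 1
    ext t
    have h1 : Complex.exp (((-2 * Real.pi * t * n : ℝ) : ℂ) * Complex.I) = e (-(n * t)) := by
      rw [e]; congr 1; push_cast; ring
    rw [h1, hf, smul_eq_mul]
    simp only
    rw [mul_left_comm, ← e_add]
    congr 2; ring
  have hO : f =O[Filter.cocompact ℝ] fun x => |x| ^ (-2 : ℝ) := by
    have hm : 0 < min 1 (y ^ 2) := by positivity
    refine Asymptotics.IsBigO.of_bound ((min 1 (y ^ 2)) ^ (-s.re)) ?_
    filter_upwards [(isCompact_singleton (x := (0 : ℝ))).compl_mem_cocompact] with t ht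
    have ht' : 0 < |t| := abs_pos.2 ht
    rw [hf]
    simp only
    rw [norm_mul, norm_e, mul_one, norm_powerKernel hy, Real.norm_of_nonneg (by positivity)]
    refine (rpow_sq_add_sq_le hy hs t).trans ?_
    gcongr
    rw [Real.rpow_neg ht'.le, Real.rpow_two, sq_abs]
    have : 0 < t ^ 2 := by rw [← sq_abs]; positivity
    gcongr
    linarith
  have hsum : Summable fun n : ℤ => FourierTransform.fourier f (n : ℝ) := by
    simp_rw [hfour]
    exact (summable_norm_powerKernelFourier hs hy θ).of_norm
  have h := Real.tsum_eq_tsum_fourier_of_rpow_decay_of_summable hcont one_lt_two hO hsum x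
  have h1 : ∀ k : ℤ, powerKernel s y (x + k) * e (-(θ * k)) = e (θ * x) * f (x + k) := by
    intro k
    rw [hf]
    simp only
    rw [mul_left_comm, ← e_add]
    congr 2; ring
  have h2 : ∀ n : ℤ, powerKernelFourier s y (n + θ) * e ((n + θ) * x) =
      e (θ * x) * (FourierTransform.fourier f (n : ℝ) * (fourier n) (x : UnitAddCircle)) := by
    intro n
    rw [hfour, fourier_coe_apply, add_mul, e_add, e]
    simp only [Complex.ofReal_one, div_one]
    push_cast
    ring_nf
  simp_rw [h1, h2]
  rw [tsum_mul_left, tsum_mul_left, h]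

end

/-! ### Spectral decomposition at the cusp -/

section

variable {V : Type*} [NormedAddCommGroup V] [InnerProductSpace ℂ V] {T : V →L[ℂ] V}

lemma exists_phase {z : ℂ} (hz : ‖z‖ = 1) : ∃ x ∈ Set.Ico (0 : ℝ) 1, e x = z := by
  obtain ⟨t, ht⟩ := (Complex.norm_eq_one_iff z).1 hz
  refine ⟨Int.fract (t / (2 * Real.pi)), ⟨Int.fract_nonneg _, Int.fract_lt_one _⟩, ?_⟩
  have h1 : e (t / (2 * Real.pi)) = z := by
    rw [← ht, e]
    congr 1
    have := Real.pi_ne_zero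
    push_cast
    field_simp
  rw [← h1]
  conv_rhs => rw [← Int.floor_add_fract (t / (2 * Real.pi)), e_add, e_intCast, one_mul]

lemma e_injOn : Set.InjOn e (Set.Ico (0 : ℝ) 1) := by
  intro x hx y hy h
  rw [e, e, Complex.exp_eq_exp_iff_exists_int] at h
  obtain ⟨n, hn⟩ := h
  have h1 : x = y + n := by
    have h2 : (2 * Real.pi * Complex.I : ℂ) * x = (2 * Real.pi * Complex.I) * (y + n) := by
      rw [hn]; ring
    exact_mod_cast mul_left_cancel₀ Complex.two_pi_I_ne_zero h2
  have h3 : (n : ℝ) < 1 := by linarith [hx.2, hy.1]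
  have h4 : (-1 : ℝ) < n := by linarith [hx.1, hy.2]
  have : n = 0 := by
    have : n < 1 := by exact_mod_cast h3
    have : -1 < n := by exact_mod_cast h4
    omega
  rw [h1, this]; simp

lemma norm_eq_one_of_hasEigenvalue (hT : ∀ v w, ⟪T v, T w⟫_ℂ = ⟪v, w⟫_ℂ) {z : ℂ}
    (hz : Module.End.HasEigenvalue (T : V →ₗ[ℂ] V) z) : ‖z‖ = 1 := by
  obtain ⟨v, hv⟩ := hz.exists_hasEigenvector
  have h1 : T v = z • v := hv.apply_eq_smul
  have h2 : ‖T v‖ = ‖v‖ := by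
    rw [@norm_eq_sqrt_re_inner ℂ, @norm_eq_sqrt_re_inner ℂ, hT]
  rw [h1, norm_smul] at h2
  exact mul_right_cancel₀ (norm_ne_zero_iff.2 hv.2) (h2.trans (one_mul _).symm)

lemma inner_eq_zero_of_mem_eigenspace (hT : ∀ v w, ⟪T v, T w⟫_ℂ = ⟪v, w⟫_ℂ) {x y : ℝ}
    (hxy : e x ≠ e y) {v w : V} (hv : v ∈ Module.End.eigenspace (T : V →ₗ[ℂ] V) (e x))
    (hw : w ∈ Module.End.eigenspace (T : V →ₗ[ℂ] V) (e y)) : ⟪v, w⟫_ℂ = 0 := by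
  have h1 : T v = e x • v := Module.End.mem_eigenspace_iff.1 hv
  have h2 : T w = e y • w := Module.End.mem_eigenspace_iff.1 hw
  have h3 := hT v w
  rw [h1, h2, inner_smul_left, inner_smul_right, ← mul_assoc] at h3
  by_contra h0
  have h4 : (starRingEnd ℂ) (e x) * e y = 1 :=
    mul_right_cancel₀ h0 (h3.trans (one_mul _).symm)
  have h5 : (starRingEnd ℂ) (e x) * e x = 1 := by
    rw [mul_comm, Complex.mul_conj, Complex.normSq_eq_norm_sq, norm_e]; simp
  have h6 : (starRingEnd ℂ) (e x) ≠ 0 := left_ne_zero_of_mul_eq_one h5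
  exact hxy (mul_left_cancel₀ h6 (h5.trans h4.symm))

variable [FiniteDimensional ℂ V]

lemma mul_eigenProj (T : V →L[ℂ] V) (x : ℝ) : T * eigenProj T x = e x • eigenProj T x := by
  ext v
  exact Module.End.mem_eigenspace_iff.1
    ((Module.End.eigenspace (T : V →ₗ[ℂ] V) (e x)).starProjection_apply_mem v)

/-- The common orthogonal complement of the listed eigenspaces is invariant under `T`. Were it
nonzero, it would contain an eigenvector, whose eigenvalue has modulus one and so is listed; the
vector would be orthogonal to itself. -/
lemma eq_zero_of_orthogonal_eigenspaces (hT : ∀ v w, ⟪T v, T w⟫_ℂ = ⟪v, w⟫_ℂ) {m : ℕ}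
    {ν : Fin (m + 1) → ℝ} (hν : IsPhaseList T ν) {v : V}
    (hv : ∀ j, ∀ w ∈ Module.End.eigenspace (T : V →ₗ[ℂ] V) (e (ν j)), ⟪w, v⟫_ℂ = 0) : v = 0 := by
  set W : Submodule ℂ V :=
    ⨅ j, (Module.End.eigenspace (T : V →ₗ[ℂ] V) (e (ν j)))ᗮ with hW
  have hmem : ∀ u, u ∈ W ↔ ∀ j, ∀ w ∈ Module.End.eigenspace (T : V →ₗ[ℂ] V) (e (ν j)),
      ⟪w, u⟫_ℂ = 0 := fun u => by simp [hW, Submodule.mem_iInf, Submodule.mem_orthogonal]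
  have hinv : ∀ u ∈ W, (T : V →ₗ[ℂ] V) u ∈ W := by
    intro u hu
    rw [hmem] at hu ⊢
    intro j w hw
    have h1 : T w = e (ν j) • w := Module.End.mem_eigenspace_iff.1 hw
    have h2 : w = T ((e (ν j))⁻¹ • w) := by
      rw [map_smul, h1, inv_smul_smul₀ (e_ne_zero _)]
    rw [h2]
    exact (hT _ _).trans (hu j _ (Submodule.smul_mem _ _ hw))
  by_contra hne
  have hvW : v ∈ W := (hmem v).2 hv
  have : Nontrivial W := ⟨⟨⟨v, hvW⟩, 0, fun h => hne (by simpa using h)⟩⟩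
  obtain ⟨z, hz⟩ := Module.End.exists_eigenvalue ((T : V →ₗ[ℂ] V).restrict hinv)
  obtain ⟨u, hu⟩ := hz.exists_hasEigenvector
  have hu1 : T (u : V) = z • (u : V) := congrArg Subtype.val hu.apply_eq_smul
  have hu0 : (u : V) ≠ 0 := fun h => hu.2 (by simpa using h)
  have hev : Module.End.HasEigenvalue (T : V →ₗ[ℂ] V) z :=
    Module.End.hasEigenvalue_of_hasEigenvector
      ⟨Module.End.mem_eigenspace_iff.2 hu1, hu0⟩
  obtain ⟨x, hx, rfl⟩ := exists_phase (norm_eq_one_of_hasEigenvalue hT hev)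
  obtain ⟨j, rfl⟩ := hν.complete x hx hev
  exact hu0 (inner_self_eq_zero.1 ((hmem u).1 u.2 j u (Module.End.mem_eigenspace_iff.2 hu1)))

lemma sum_eigenProj (hT : ∀ v w, ⟪T v, T w⟫_ℂ = ⟪v, w⟫_ℂ) {m : ℕ}
    {ν : Fin (m + 1) → ℝ} (hν : IsPhaseList T ν) : ∑ j, eigenProj T (ν j) = 1 := by
  ext v
  rw [one_apply_eq_self, ← sub_eq_zero, ← neg_eq_zero, neg_sub]
  refine eq_zero_of_orthogonal_eigenspaces hT hν fun j w hw => ?_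
  rw [sum_apply, ← Finset.add_sum_erase _ _ (Finset.mem_univ j), ← sub_sub,
    inner_sub_right, inner_sum, Finset.sum_eq_zero, sub_zero]
  · exact (Submodule.mem_orthogonal _ _).1
      (Submodule.sub_starProjection_mem_orthogonal
        (K := Module.End.eigenspace (T : V →ₗ[ℂ] V) (e (ν j))) v) w hw
  · intro i hi
    refine inner_eq_zero_of_mem_eigenspace hT (fun h => ?_) hw
      ((Module.End.eigenspace (T : V →ₗ[ℂ] V) (e (ν i))).starProjection_apply_mem v)
    exact (Finset.mem_erase.1 hi).1 (hν.injective (e_injOn (hν.mem_Ico j) (hν.mem_Ico i) h)).symm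

variable {Γ : Subgroup PSL(2, ℝ)} {b : ScaledCusp Γ}

lemma zpow_mul_eigenProj (χ : Γ →* (V →L[ℂ] V)) (γ : Γ) (x : ℝ) (k : ℤ) :
    χ (γ ^ k) * eigenProj (χ γ) x = e (k * x) • eigenProj (χ γ) x := by
  have hnat : ∀ n : ℕ, χ (γ ^ n) * eigenProj (χ γ) x = e (n * x) • eigenProj (χ γ) x := by
    intro n
    induction n with
    | zero => simp [e_zero]
    | succ n ih =>
      rw [pow_succ, map_mul, mul_assoc, mul_eigenProj, mul_smul_comm, ih, smul_smul, ← e_add]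
      congr 2; push_cast; ring
  obtain ⟨n, rfl | rfl⟩ := k.eq_nat_or_neg
  · simpa using hnat n
  · have h1 : χ (γ ^ (-(n : ℤ))) * χ (γ ^ n) = 1 := by
      rw [← map_mul, zpow_neg, zpow_natCast, inv_mul_cancel, map_one]
    have h2 := congrArg (χ (γ ^ (-(n : ℤ))) * ·) (hnat n)
    simp only [mul_smul_comm] at h2
    rw [← mul_assoc, h1, one_mul] at h2
    conv_rhs => rw [h2]
    rw [smul_smul, ← e_add]
    push_cast
    rw [neg_mul, neg_add_cancel, e_zero, one_smul]

lemma cuspProj_eq_eigenProj (χ : Γ →* (V →L[ℂ] V)) (b : ScaledCusp Γ) (ε : ℤˣ) :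
    eigenProj (χ (b.gen ^ (ε : ℤ))) 0 = cuspProj χ b := by
  have h : Module.End.eigenspace ((χ (b.gen ^ (ε : ℤ)) : V →L[ℂ] V) : V →ₗ[ℂ] V) (e 0) =
      fixedSpace χ b := by
    ext v
    rw [Module.End.mem_eigenspace_iff, e_zero, one_smul]
    constructor
    · intro hv γ hγ
      have hv' : χ (b.gen ^ (ε : ℤ)) v = v := hv
      obtain ⟨k, rfl⟩ := b.mem_stab_iff_gen.1 hγ
      have h1 : v ∈ Module.End.eigenspace ((χ (b.gen ^ (ε : ℤ)) : V →L[ℂ] V) : V →ₗ[ℂ] V) (e 0) := by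
        rw [Module.End.mem_eigenspace_iff, e_zero, one_smul]; exact hv
      have h2 := congrArg (fun A : V →L[ℂ] V => A v)
        (zpow_mul_eigenProj χ (b.gen ^ (ε : ℤ)) 0 ((ε : ℤ) * k))
      have h3 : eigenProj (χ (b.gen ^ (ε : ℤ))) 0 v = v :=
        Submodule.starProjection_eq_self_iff.2 h1
      simp only [mul_apply_eq_comp, mul_zero, e_zero, one_smul, h3] at h2
      -- As `ε ^ 2 = 1`, every power of `b.gen` is a power of `b.gen ^ ε`.
      have h4 : (ε : ℤ) * ((ε : ℤ) * k) = k := by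
        rw [← mul_assoc, ← sq, ← Units.val_pow_eq_pow_val, Int.units_sq]; simp
      rwa [← zpow_mul, h4] at h2
    · intro hv
      exact hv _ (b.gen_zpow_mem_stab _)
  simp only [eigenProj, cuspProj, h]

/-- Spectral decomposition of the translations; its phases produce the shift by `ε ν j` in the
frequencies. -/
lemma map_gen_zpow_neg {χ : Γ →* (V →L[ℂ] V)} (hχ : UnitaryAtCusps χ) (ε : ℤˣ) {m : ℕ}
    {ν : Fin (m + 1) → ℝ} (hν : IsPhaseList (χ (b.gen ^ (ε : ℤ))) ν) (k : ℤ) :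
    χ (b.gen ^ (-k)) =
      ∑ j, e (-((ε : ℤ) * ν j * k)) • eigenProj (χ (b.gen ^ (ε : ℤ))) (ν j) := by
  have h1 := sum_eigenProj (inner_map_stab hχ (b.gen_zpow_mem_stab (ε : ℤ))) hν
  have h4 : (b.gen ^ (ε : ℤ)) ^ (-((ε : ℤ) * k)) = b.gen ^ (-k) := by
    rw [← zpow_mul]
    congr 1
    have : (ε : ℤ) * (ε : ℤ) = 1 := by
      rw [← sq, ← Units.val_pow_eq_pow_val, Int.units_sq]; simp
    rw [mul_neg, ← mul_assoc, this, one_mul]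
  rw [← mul_one (χ (b.gen ^ (-k))), ← h1, Finset.mul_sum]
  refine Finset.sum_congr rfl fun j _ => ?_
  rw [← h4, zpow_mul_eigenProj]
  congr 2; push_cast; ring

lemma norm_eigenProj_le (T : V →L[ℂ] V) (x : ℝ) : ‖eigenProj T x‖ ≤ 1 :=
  Submodule.starProjection_norm_le _

lemma norm_cuspProj_le (χ : Γ →* (V →L[ℂ] V)) (b : ScaledCusp Γ) : ‖cuspProj χ b‖ ≤ 1 :=
  Submodule.starProjection_norm_le _

end

end

section

/-! ### Fourier expansion of sums of translates -/

section

variable {V : Type*} [NormedAddCommGroup V] [InnerProductSpace ℂ V]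
  {ι : Type*} {A : ι → V →L[ℂ] V} {s : ℂ} {y : ℝ}

lemma summable_norm_mul_powerKernel (hA : Summable fun i => ‖A i‖) (hs : 1 ≤ s.re) (hy : 0 < y)
    (u : ι → ℝ) : Summable fun p : ι × ℤ => ‖powerKernel s y (u p.1 + p.2)‖ * ‖A p.1‖ := by
  obtain ⟨C, hC, h⟩ := exists_tsum_rpow_le hy hs
  have h0 : ∀ i, ∀ k : ℤ, ‖powerKernel s y (u i + k)‖ = ((u i + k) ^ 2 + y ^ 2) ^ (-s.re) :=
    fun i k => norm_powerKernel hy _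
  rw [summable_prod_of_nonneg (fun p => mul_nonneg (norm_nonneg _) (norm_nonneg _))]
  refine ⟨fun i => ?_, ?_⟩
  · simp_rw [h0]
    exact (h (u i)).1.mul_right _
  · simp_rw [tsum_mul_right, h0]
    exact Summable.of_nonneg_of_le
      (fun i => mul_nonneg (tsum_nonneg fun k => by positivity) (norm_nonneg _))
      (fun i => mul_le_mul_of_nonneg_right (h (u i)).2 (norm_nonneg _)) (hA.mul_left C)

lemma norm_smul_mul_mul_le {A P Q : V →L[ℂ] V} (hP : ‖P‖ ≤ 1) (hQ : ‖Q‖ ≤ 1) (w : ℂ) :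
    ‖w • (P * A * Q)‖ ≤ ‖w‖ * ‖A‖ := by
  rw [norm_smul]
  refine mul_le_mul_of_nonneg_left ?_ (norm_nonneg _)
  calc ‖P * A * Q‖ ≤ ‖P * A‖ * ‖Q‖ := norm_mul_le _ _
    _ ≤ ‖P‖ * ‖A‖ * ‖Q‖ := by gcongr; exact norm_mul_le _ _
    _ ≤ 1 * ‖A‖ * 1 := by gcongr
    _ = ‖A‖ := by ring

variable [CompleteSpace V] {P Q : V →L[ℂ] V}

lemma summable_powerKernel_smul (hA : Summable fun i => ‖A i‖) (hs : 1 ≤ s.re) (hy : 0 < y)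
    (u : ι → ℝ) (hP : ‖P‖ ≤ 1) (hQ : ‖Q‖ ≤ 1) (θ : ℝ) :
    Summable fun p : ι × ℤ =>
      (powerKernel s y (u p.1 + p.2) * e (-(θ * p.2))) • (P * A p.1 * Q) := by
  refine Summable.of_norm_bounded (summable_norm_mul_powerKernel hA hs hy u) fun p => ?_
  refine (norm_smul_mul_mul_le hP hQ _).trans_eq ?_
  rw [norm_mul, norm_e, mul_one]

lemma summable_powerKernelFourier_smul (hA : Summable fun i => ‖A i‖) (hs : 1 ≤ s.re) (hy : 0 < y)
    (u : ι → ℝ) (hP : ‖P‖ ≤ 1) (hQ : ‖Q‖ ≤ 1) (θ x : ℝ) :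
    Summable fun n : ℤ => ‖(powerKernelFourier s y (n + θ) * e ((n + θ) * x)) •
      (P * (∑' i, e ((n + θ) * u i) • A i) * Q)‖ := by
  refine Summable.of_nonneg_of_le (fun n => norm_nonneg _) (fun n => ?_)
    ((summable_norm_powerKernelFourier hs hy θ).mul_right (∑' i, ‖A i‖))
  refine (norm_smul_mul_mul_le hP hQ _).trans ?_
  rw [norm_mul, norm_e, mul_one]
  refine mul_le_mul_of_nonneg_left ?_ (norm_nonneg _)
  have h : ∀ i, ‖e ((n + θ) * u i) • A i‖ = ‖A i‖ := fun i => by rw [norm_smul, norm_e, one_mul]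
  refine (norm_tsum_le_tsum_norm (by simpa only [h] using hA)).trans_eq ?_
  simp_rw [h]

/-- Poisson summation in the integer variable for each `i`, then interchange of the sums over `i`
and `n`, justified by norm summability of `A` and of the Fourier transform. -/
lemma tsum_powerKernel_smul (hA : Summable fun i => ‖A i‖) (hs : 1 ≤ s.re) (hy : 0 < y)
    (u : ι → ℝ) (hP : ‖P‖ ≤ 1) (hQ : ‖Q‖ ≤ 1) (θ x : ℝ) :
    ∑' p : ι × ℤ, (powerKernel s y (x + u p.1 + p.2) * e (-(θ * p.2))) • (P * A p.1 * Q) =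
      ∑' n : ℤ, (powerKernelFourier s y (n + θ) * e ((n + θ) * x)) •
        (P * (∑' i, e ((n + θ) * u i) • A i) * Q) := by
  have h1 := summable_powerKernel_smul hA hs hy (fun i => x + u i) hP hQ θ
  set G : ι → ℤ → V →L[ℂ] V := fun i n =>
    (powerKernelFourier s y (n + θ) * e ((n + θ) * (x + u i))) • (P * A i * Q) with hG
  have hGs : Summable (Function.uncurry G) := by
    refine Summable.of_norm_bounded (g := fun p : ι × ℤ =>
      ‖A p.1‖ * ‖powerKernelFourier s y (p.2 + θ)‖) ?_ fun p => ?_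
    · exact hA.mul_of_nonneg (summable_norm_powerKernelFourier hs hy θ)
        (fun _ => norm_nonneg _) (fun _ => norm_nonneg _)
    · refine (norm_smul_mul_mul_le hP hQ _).trans_eq ?_
      rw [norm_mul, norm_e, mul_one, mul_comm]
  rw [h1.tsum_prod]
  calc _ = ∑' i, ∑' n, G i n := by
        refine tsum_congr fun i => ?_
        rw [hG]
        simp only
        rw [Summable.tsum_smul_const, Summable.tsum_smul_const, tsum_powerKernel_mul_e hs hy]
        · refine Summable.of_norm ?_
          simp_rw [norm_mul, norm_e, mul_one]
          exact summable_norm_powerKernelFourier hs hy θ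
        · refine Summable.of_norm ?_
          simp_rw [norm_mul, norm_e, mul_one, norm_powerKernel hy]
          obtain ⟨C, -, h⟩ := exists_tsum_rpow_le hy hs
          exact (h _).1
    _ = ∑' n, ∑' i, G i n := hGs.tsum_comm.symm
    _ = _ := by
        refine tsum_congr fun n => ?_
        have h2 : Summable fun i => e ((n + θ) * u i) • A i := by
          refine Summable.of_norm ?_
          simpa only [norm_smul, norm_e, one_mul] using hA
        rw [← h2.tsum_mul_left, ← (h2.mul_left P).tsum_mul_right,
          ← ((h2.mul_left P).mul_right Q).tsum_const_smul]
        refine tsum_congr fun i => ?_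
        rw [hG]
        simp only
        rw [mul_smul_comm, smul_mul_assoc, smul_smul, mul_add, e_add,
          mul_assoc (powerKernelFourier s y (n + θ))]

end

/-! ### The unfolded Eisenstein series -/

variable {Γ : Subgroup PSL(2, ℝ)} {V : Type*} [NormedAddCommGroup V] [InnerProductSpace ℂ V]
  {a b : ScaledCusp Γ}

/-- The operator `c⁻²ˢ χ(γ⁻¹)` for the representative `γ` of bottom row `(c, d)`. -/
def DoubleCosetReps.weight (R : DoubleCosetReps a b) (χ : Γ →* (V →L[ℂ] V)) (s : ℂ) (i : R.Idx) :
    V →L[ℂ] V :=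
  (((i.1 : ℝ) : ℂ) ^ (-2 * s)) • χ (R.γ i.1 i.2)⁻¹

lemma DoubleCosetReps.summable_norm_weight (hd : DiscreteTopology Γ) (R : DoubleCosetReps a b)
    {χ : Γ →* (V →L[ℂ] V)} (hχ : UnitaryAtCusps χ) {σ₀ : ℝ} (hσ₀ : IsGrowthExponent χ σ₀) {s : ℂ}
    (hs : σ₀ < s.re) : Summable fun i => ‖R.weight χ s i‖ := by
  obtain ⟨C, hC, h⟩ := exists_norm_inv_le hd hχ hσ₀ a b
  refine Summable.of_nonneg_of_le (fun i => norm_nonneg _) (fun i => ?_)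
    -- The weight is `O` of `c` to the power `-2 Re s + 2 (σ₀ - 1) = -2 τ`, and `Re s > σ₀` is
    -- precisely `τ > 1`.
    ((R.summable_rpow hd (τ := s.re - σ₀ + 1) (by linarith)).mul_left C)
  have hc : 0 < (i.1 : ℝ) := i.1.2.1
  have h1 := h _ _ _ hc (R.bottomRow _ hc _ i.2.2)
  rw [weight, norm_smul, Complex.norm_cpow_eq_rpow_re_of_pos hc]
  calc _ ≤ (i.1 : ℝ) ^ (-2 * s).re * (C * (i.1 : ℝ) ^ (2 * (σ₀ - 1))) := by gcongr
    _ = C * ((i.1 : ℝ) ^ (-2 * s).re * (i.1 : ℝ) ^ (2 * (σ₀ - 1))) := by ring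
    _ = _ := by
      rw [← Real.rpow_add hc]
      congr 2
      simp; ring

lemma DoubleCosetReps.kloostermanTerm_eq_tsum (hd : DiscreteTopology Γ) (R : DoubleCosetReps a b)
    (χ : Γ →* (V →L[ℂ] V)) (r : ℝ) (s : ℂ) (c : moduli a b) :
    kloostermanTerm χ R r s c =
      ∑' d : R.D c, e (r * ((d : ℝ) / c)) • R.weight χ s ⟨c, d⟩ := by
  have hfin : Finite (R.D c) := R.finite_D hd c c.2.1
  rw [tsum_eq_finsum (Set.toFinite _), kloostermanTerm, kloosterman,
    ← finsum_set_coe_eq_finsum_mem, smul_finsum' _ (Set.toFinite _)]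
  refine finsum_congr fun d => ?_
  rw [weight, smul_comm, mul_div_assoc]

lemma DoubleCosetReps.summable_kloostermanTerm (hd : DiscreteTopology Γ) (R : DoubleCosetReps a b)
    {χ : Γ →* (V →L[ℂ] V)} {s : ℂ} (hA : Summable fun i => ‖R.weight χ s i‖) (r : ℝ) :
    Summable fun c => ‖kloostermanTerm χ R r s c‖ := by
  refine Summable.of_nonneg_of_le (fun c => norm_nonneg _) (fun c => ?_) hA.sigma
  rw [R.kloostermanTerm_eq_tsum hd]
  have h : ∀ d : R.D c, ‖e (r * ((d : ℝ) / c)) • R.weight χ s ⟨c, d⟩‖ = ‖R.weight χ s ⟨c, d⟩‖ :=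
    fun d => by rw [norm_smul, norm_e, one_mul]
  refine (norm_tsum_le_tsum_norm ?_).trans_eq (tsum_congr h)
  simp_rw [h]
  exact hA.sigma_factor c

lemma DoubleCosetReps.tsum_kloostermanTerm [CompleteSpace V] (hd : DiscreteTopology Γ)
    (R : DoubleCosetReps a b) {χ : Γ →* (V →L[ℂ] V)} {s : ℂ}
    (hA : Summable fun i => ‖R.weight χ s i‖) (r : ℝ) :
    ∑' c, kloostermanTerm χ R r s c =
      ∑' i : R.Idx, e (r * ((i.2 : ℝ) / i.1)) • R.weight χ s i := by
  have h : Summable fun i : R.Idx => e (r * ((i.2 : ℝ) / i.1)) • R.weight χ s i := by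
    refine Summable.of_norm ?_
    simpa only [norm_smul, norm_e, one_mul] using hA
  rw [h.tsum_sigma]
  exact tsum_congr fun c => R.kloostermanTerm_eq_tsum hd χ r s c

open Classical in
lemma DoubleCosetReps.hasSum_of_hasSum_coset (R : DoubleCosetReps a b)
    (hab : a.pt = b.pt ∨ ∀ γ : Γ, γ • b.pt ≠ a.pt) {E : Type*} [NormedAddCommGroup E]
    {f : Quotient (QuotientGroup.rightRel a.stab) → E} {S : E}
    (h : HasSum (fun p => f (R.coset p)) S) :
    HasSum f ((if a.pt = b.pt then f (Quotient.mk _ 1) else 0) + S) := by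
  have h1 : HasSum ((Set.range R.coset).indicator f) S :=
    hasSum_subtype_iff_indicator.1 (R.coset_injective.hasSum_range_iff.2 h)
  split_ifs with hpt
  · convert (hasSum_ite_eq (Quotient.mk _ 1) (f (Quotient.mk _ 1))).add h1 using 1
    funext q
    by_cases hq : q = Quotient.mk _ 1
    · rw [if_pos hq, hq, Set.indicator_of_notMem (R.one_notMem_range_coset hpt), add_zero]
    · rw [if_neg hq, zero_add, Set.indicator_of_mem]
      exact (R.mem_range_coset hab q).resolve_right fun h => hq h.2
  · rw [zero_add]
    convert h1 using 1
    refine (Set.indicator_eq_self.2 fun q _ => ?_).symm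
    exact (R.mem_range_coset hab q).resolve_right fun h => hpt h.1

/-- For `j ≠ 0` the phase lies strictly between 0 and 1, so only the block `j = 0` contains
frequency zero. -/
lemma IsPhaseList.add_ne_zero {T : V →L[ℂ] V} {m : ℕ} {ν : Fin (m + 1) → ℝ} (hν : IsPhaseList T ν)
    {j : Fin (m + 1)} (hj : j ≠ 0) (ε : ℤˣ) (k : ℤ) : (k : ℝ) + (ε : ℤ) * ν j ≠ 0 := by
  intro h
  have h0 : ν j ≠ 0 := fun h0 => hj (hν.injective (h0.trans hν.zero.symm))
  obtain ⟨h1, h2⟩ := hν.mem_Ico j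
  have h3 : 0 < ν j := lt_of_le_of_ne h1 h0.symm
  obtain ⟨l, hl⟩ : ∃ l : ℤ, ν j = l := by
    rcases Int.units_eq_one_or ε with rfl | rfl
    · exact ⟨-k, by push_cast at h ⊢; linarith⟩
    · exact ⟨k, by push_cast at h ⊢; linarith⟩
  rw [hl] at h2 h3
  have h4 : l < 1 := by exact_mod_cast h2
  have h5 : 0 < l := by exact_mod_cast h3
  omega

variable [FiniteDimensional ℂ V]

/-- For bottom row `(c, d + k c)` the imaginary part is `y c⁻² ((x + d / c + k) ^ 2 + y ^ 2)⁻¹`, so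
`k` enters only through a translation of the kernel and a power of the generator. -/
lemma DoubleCosetReps.eisSummand_coset (R : DoubleCosetReps a b) (χ : Γ →* (V →L[ℂ] V)) (s : ℂ)
    (z : ℍ) (p : R.Idx × ℤ) :
    eisSummand χ a s (b.σ • z) (R.coset p) =
      ((z.im : ℂ) ^ s * powerKernel s z.im (z.re + (p.1.2 : ℝ) / p.1.1 + p.2)) •
        (χ (b.gen ^ (-p.2)) * R.weight χ s p.1 * cuspProj χ a) := by
  obtain ⟨⟨⟨c, hc⟩, ⟨d, hd⟩⟩, k⟩ := p
  have hcp : 0 < c := hc.1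
  have hy := z.im_pos
  have hcc : (c : ℂ) ≠ 0 := by exact_mod_cast hcp.ne'
  change eisTerm χ a s (b.σ • z) (R.γ c d * b.gen ^ k) = _
  have hrow := (R.row ⟨⟨⟨c, hc⟩, ⟨d, hd⟩⟩, k⟩).im_smul z
  simp only at hrow
  have him : (a.σ⁻¹ • (R.γ c d * b.gen ^ k) • b.σ • z).im =
      z.im * ((c * c)⁻¹ * ((z.re + d / c + k) ^ 2 + z.im ^ 2)⁻¹) := by
    rw [Subgroup.smul_def, ← mul_smul, ← mul_smul, hrow, ← mul_inv, div_eq_mul_inv]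
    congr 2
    field_simp
    ring
  have hq : 0 < (z.re + d / c + k) ^ 2 + z.im ^ 2 := by positivity
  have harg : ∀ x : ℝ, 0 < x → (x : ℂ).arg ≠ Real.pi := fun x hx => by
    rw [Complex.arg_ofReal_of_nonneg hx.le]; exact Real.pi_pos.ne
  have hinv : ∀ x : ℝ, 0 < x → ((x⁻¹ : ℝ) : ℂ) ^ s = (x : ℂ) ^ (-s) := fun x hx => by
    rw [Complex.ofReal_inv, Complex.inv_cpow _ _ (harg x hx), Complex.cpow_neg]
  have hpow : (((a.σ⁻¹ • (R.γ c d * b.gen ^ k) • b.σ • z).im : ℝ) : ℂ) ^ s =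
      (z.im : ℂ) ^ s * ((c : ℂ) ^ (-2 * s) * powerKernel s z.im (z.re + d / c + k)) := by
    rw [him, Complex.ofReal_mul, Complex.mul_cpow_ofReal_nonneg hy.le (by positivity),
      Complex.ofReal_mul, Complex.mul_cpow_ofReal_nonneg (by positivity) (by positivity),
      hinv _ (mul_pos hcp hcp), hinv _ hq, powerKernel, Complex.ofReal_mul,
      Complex.mul_cpow_ofReal_nonneg hcp.le hcp.le, ← Complex.cpow_add _ _ hcc]
    congr 3
    ring
  rw [eisTerm, hpow, weight, mul_inv_rev, map_mul, ← zpow_neg, mul_smul_comm, smul_mul_assoc,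
    smul_smul]
  congr 1
  ring

/-- The unfolded Eisenstein series, decomposed by the eigenvalues at the cusp `b`. -/
lemma DoubleCosetReps.eisSummand_coset_eq_sum (R : DoubleCosetReps a b) {χ : Γ →* (V →L[ℂ] V)}
    (hχ : UnitaryAtCusps χ) (ε : ℤˣ) {m : ℕ} {ν : Fin (m + 1) → ℝ}
    (hν : IsPhaseList (χ (b.gen ^ (ε : ℤ))) ν) (s : ℂ) (z : ℍ) (p : R.Idx × ℤ) :
    eisSummand χ a s (b.σ • z) (R.coset p) = ∑ j, (z.im : ℂ) ^ s •
      ((powerKernel s z.im (z.re + (p.1.2 : ℝ) / p.1.1 + p.2) * e (-((ε : ℤ) * ν j * p.2))) •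
        (eigenProj (χ (b.gen ^ (ε : ℤ))) (ν j) * R.weight χ s p.1 * cuspProj χ a)) := by
  rw [R.eisSummand_coset, map_gen_zpow_neg hχ ε hν, Finset.sum_mul, Finset.sum_mul,
    Finset.smul_sum]
  refine Finset.sum_congr rfl fun j _ => ?_
  rw [smul_mul_assoc, smul_mul_assoc, smul_smul, smul_smul, mul_assoc]

lemma smul_powerKernelFourier_eq_whittaker_smul (χ : Γ →* (V →L[ℂ] V)) (R : DoubleCosetReps a b)
    (P : V →L[ℂ] V) {s : ℂ} (hs : 1 ≤ s.re) {r : ℝ} (hr : r ≠ 0) (z : ℍ) :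
    (z.im : ℂ) ^ s • ((powerKernelFourier s z.im r * e (r * z.re)) •
      (P * (∑' c, kloostermanTerm χ R r s c) * cuspProj χ a)) =
    whittaker s ((r : ℂ) * z) • fourierCoeff χ R P r s := by
  rw [fourierCoeff, smul_smul, smul_smul, whittaker_mul_eq hs hr,
    mul_assoc ((z.im : ℂ) ^ s)]

lemma smul_powerKernelFourier_zero_eq_constCoeff (χ : Γ →* (V →L[ℂ] V)) (R : DoubleCosetReps a b)
    {s : ℂ} (hs : 1 ≤ s.re) (z : ℍ) :
    (z.im : ℂ) ^ s • ((powerKernelFourier s z.im 0 * e (0 * z.re)) •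
      (cuspProj χ b * (∑' c, kloostermanTerm χ R 0 s c) * cuspProj χ a)) =
    (z.im : ℂ) ^ (1 - s) • constCoeff χ R s := by
  have hy : (z.im : ℂ) ≠ 0 := by exact_mod_cast z.im_pos.ne'
  rw [constCoeff, smul_smul, smul_smul, powerKernelFourier_zero hs z.im_pos, zero_mul, e_zero,
    mul_one]
  congr 1
  have : (z.im : ℂ) ^ (1 - s) = (z.im : ℂ) ^ s * (z.im : ℂ) ^ (1 - 2 * s) := by
    rw [← Complex.cpow_add _ _ hy]; congr 1; ring
  rw [this]
  ring

open Classical in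
lemma eisSummand_one_eq_cuspDelta_smul (χ : Γ →* (V →L[ℂ] V)) (a b : ScaledCusp Γ) (s : ℂ)
    (z : ℍ) :
    (if a.pt = b.pt then eisSummand χ a s (b.σ • z) (Quotient.mk _ 1) else 0) =
      (cuspDelta a b * (z.im : ℂ) ^ s) • cuspProj χ a := by
  rw [cuspDelta]
  split_ifs with h
  · change eisTerm χ a s (b.σ • z) 1 = _
    rw [eisTerm, one_smul, im_smul_of_pt_eq h, inv_one, map_one, one_mul, one_mul]
  · rw [zero_mul, zero_smul]

lemma tsum_eq_add_tsum_ne_zero {E : Type*} [NormedAddCommGroup E] {f : ℤ → E} (hf : Summable f) :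
    ∑' k, f k = f 0 + ∑' k : {k : ℤ // k ≠ 0}, f k := by
  rw [hf.tsum_eq_add_tsum_ite 0]
  congr 1
  rw [show (∑' k : {k : ℤ // k ≠ 0}, f k) = ∑' k, Set.indicator {k : ℤ | k ≠ 0} f k from
    tsum_subtype _ f]
  refine tsum_congr fun k => ?_
  by_cases hk : k = 0 <;> simp [hk]

end

end TwistedEisenstein

end

/-! ### Assembly of the Fourier expansion. -/

open TwistedEisenstein in
theorem theorem3p6
    (Γ : Subgroup PSL(2, ℝ)) (hΓ : IsLattice Γ) (hΓ' : TorsionFree Γ)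
    {V : Type*} [NormedAddCommGroup V] [InnerProductSpace ℂ V] [FiniteDimensional ℂ V]
    (χ : Γ →* (V →L[ℂ] V)) (hχ : UnitaryAtCusps χ)
    (a b : ScaledCusp Γ) (hab : a.pt = b.pt ∨ ∀ γ : Γ, γ • b.pt ≠ a.pt)
    (R : DoubleCosetReps a b)
    (ε : ℤˣ) {m : ℕ} (ν : Fin (m + 1) → ℝ) (hν : IsPhaseList (χ (b.gen ^ (ε : ℤ))) ν) :
    (∃ σ₀ : ℝ, IsGrowthExponent χ σ₀) ∧
    ∀ σ₀ : ℝ, IsGrowthExponent χ σ₀ → ∀ s : ℂ, σ₀ < s.re →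
      (∀ c : ℝ, 0 < c → (R.D c).Finite) ∧
      (∀ r : ℝ, Summable fun c : moduli a b => ‖kloostermanTerm χ R r s c‖) ∧
      ∀ z : ℍ,
        (Summable fun q => ‖eisSummand χ a s (b.σ • z) q‖) ∧
        (Summable fun k : {k : ℤ // k ≠ 0} =>
          ‖whittaker s (((k : ℝ) : ℂ) * z) •
            fourierCoeff χ R (eigenProj (χ (b.gen ^ (ε : ℤ))) (ν 0)) k s‖) ∧
        (∀ j : Fin (m + 1), j ≠ 0 → Summable fun k : ℤ =>
          ‖whittaker s (((k + (ε : ℤ) * ν j : ℝ) : ℂ) * z) •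
            fourierCoeff χ R (eigenProj (χ (b.gen ^ (ε : ℤ))) (ν j)) (k + (ε : ℤ) * ν j) s‖) ∧
        eisenstein χ a (b.σ • z) s =
          (cuspDelta a b * (z.im : ℂ) ^ s) • cuspProj χ a
          + ((z.im : ℂ) ^ (1 - s)) • constCoeff χ R s
          + ∑' k : {k : ℤ // k ≠ 0}, whittaker s (((k : ℝ) : ℂ) * z) •
              fourierCoeff χ R (eigenProj (χ (b.gen ^ (ε : ℤ))) (ν 0)) k s
          + ∑ j ∈ Finset.univ.erase (0 : Fin (m + 1)), ∑' k : ℤ,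
              whittaker s (((k + (ε : ℤ) * ν j : ℝ) : ℂ) * z) •
                fourierCoeff χ R (eigenProj (χ (b.gen ^ (ε : ℤ))) (ν j))
                  (k + (ε : ℤ) * ν j) s := by
  have hd := hΓ.discrete
  refine ⟨exists_isGrowthExponent hΓ hΓ' hχ, fun σ₀ hσ₀ s hs => ?_⟩
  have : CompleteSpace V := FiniteDimensional.complete ℂ V
  have hs1 : 1 ≤ s.re := (hσ₀.one_lt.trans hs).le
  have hA := R.summable_norm_weight hd hχ hσ₀ hs
  refine ⟨fun c hc => R.finite_D hd c hc, R.summable_kloostermanTerm hd hA, fun z => ?_⟩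
  have hy := z.im_pos
  set T := χ (b.gen ^ (ε : ℤ)) with hT
  set u : R.Idx → ℝ := fun i => (i.2 : ℝ) / i.1 with hu
  have hP : ∀ j, ‖eigenProj T (ν j)‖ ≤ 1 := fun j => norm_eigenProj_le T _
  have hQ : ‖cuspProj χ a‖ ≤ 1 := norm_cuspProj_le χ a
  -- The Fourier terms before the Whittaker normalization. This form also makes sense at frequency
  -- zero, where it gives the `y ^ (1 - s)` term.
  set h : Fin (m + 1) → ℤ → V →L[ℂ] V := fun j n => (z.im : ℂ) ^ s •
    ((powerKernelFourier s z.im (n + (ε : ℤ) * ν j) * e ((n + (ε : ℤ) * ν j) * z.re)) •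
      (eigenProj T (ν j) * (∑' c, kloostermanTerm χ R (n + (ε : ℤ) * ν j) s c) * cuspProj χ a))
    with hh
  have hhs : ∀ j, Summable fun n => ‖h j n‖ := by
    intro j
    have h1 := summable_powerKernelFourier_smul hA hs1 hy u (hP j) hQ ((ε : ℤ) * ν j) z.re
    rw [hh]
    simp only [norm_smul ((z.im : ℂ) ^ s)]
    simp_rw [R.tsum_kloostermanTerm hd hA]
    exact h1.mul_left _
  have hne : ∀ j, ∀ n : ℤ, (n : ℝ) + (ε : ℤ) * ν j ≠ 0 → h j n =
      whittaker s (((n + (ε : ℤ) * ν j : ℝ) : ℂ) * z) •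
        fourierCoeff χ R (eigenProj T (ν j)) (n + (ε : ℤ) * ν j) s :=
    fun j n hn => smul_powerKernelFourier_eq_whittaker_smul χ R _ hs1 hn z
  have hne0 : ∀ n : {k : ℤ // k ≠ 0}, h 0 n = whittaker s (((n : ℝ) : ℂ) * z) •
      fourierCoeff χ R (eigenProj T (ν 0)) n s := by
    intro n
    have h1 : ((n : ℤ) : ℝ) + (ε : ℤ) * ν 0 = (n : ℤ) := by rw [hν.zero, mul_zero, add_zero]
    rw [hne 0 n (by rw [h1]; exact_mod_cast n.2), h1]
  have hzero : h 0 0 = (z.im : ℂ) ^ (1 - s) • constCoeff χ R s := by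
    rw [← smul_powerKernelFourier_zero_eq_constCoeff χ R hs1 z, ← cuspProj_eq_eigenProj χ b ε, hh]
    simp only [hν.zero, mul_zero, add_zero, Int.cast_zero, ← hT]
  have hker : ∀ j, Summable fun p : R.Idx × ℤ => (z.im : ℂ) ^ s •
      ((powerKernel s z.im (z.re + u p.1 + p.2) * e (-((ε : ℤ) * ν j * p.2))) •
        (eigenProj T (ν j) * R.weight χ s p.1 * cuspProj χ a)) := fun j =>
    (summable_powerKernel_smul hA hs1 hy (fun i => z.re + u i) (hP j) hQ _).const_smul _
  have hnorm : Summable fun p => ‖eisSummand χ a s (b.σ • z) (R.coset p)‖ := by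
    refine Summable.of_nonneg_of_le (fun p => norm_nonneg _) (fun p => ?_)
      ((summable_norm_mul_powerKernel hA hs1 hy fun i => z.re + u i).mul_left ‖(z.im : ℂ) ^ s‖)
    rw [R.eisSummand_coset, ← mul_assoc, ← norm_mul]
    exact norm_smul_mul_mul_le (norm_map_stab_le hχ (b.gen_zpow_mem_stab _)) hQ _
  have hsum : ∑' p, eisSummand χ a s (b.σ • z) (R.coset p) = ∑ j, ∑' n, h j n := by
    simp_rw [R.eisSummand_coset_eq_sum hχ ε hν]
    rw [Summable.tsum_finsetSum fun j _ => hker j]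
    refine Finset.sum_congr rfl fun j _ => ?_
    have h1 := summable_powerKernel_smul hA hs1 hy (fun i => z.re + u i) (hP j) hQ ((ε : ℤ) * ν j)
    have h2 := summable_powerKernelFourier_smul hA hs1 hy u (hP j) hQ ((ε : ℤ) * ν j) z.re
    rw [h1.tsum_const_smul, tsum_powerKernel_smul hA hs1 hy u (hP j) hQ,
      ← h2.of_norm.tsum_const_smul]
    simp_rw [hh, R.tsum_kloostermanTerm hd hA]
    rfl
  have htotal := (R.hasSum_of_hasSum_coset hab (hnorm.of_norm).hasSum).tsum_eq
  -- The same passage from double cosets to all cosets, applied to the norms, gives absolute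
  -- convergence.
  have hnormtotal := (R.hasSum_of_hasSum_coset (f := fun q => ‖eisSummand χ a s (b.σ • z) q‖)
    hab hnorm.hasSum).summable
  refine ⟨hnormtotal, ?_, fun j hj => ?_, ?_⟩
  · simp_rw [← hne0]
    exact (hhs 0).comp_injective Subtype.val_injective
  · simp_rw [← hne j _ (hν.add_ne_zero hj ε _)]
    exact hhs j
  · rw [eisenstein, htotal, hsum, eisSummand_one_eq_cuspDelta_smul,
      ← Finset.add_sum_erase _ _ (Finset.mem_univ 0), tsum_eq_add_tsum_ne_zero (hhs 0).of_norm,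
      hzero, ← add_assoc, ← add_assoc]
    congr 1
    · congr 1
      exact tsum_congr hne0
    · refine Finset.sum_congr rfl fun j hj => tsum_congr fun k => ?_
      exact hne j k (hν.add_ne_zero (Finset.mem_erase.1 hj).1 ε k)
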